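/- Let $R$ be a division ring and let $V$ be an $n$-dimensional left vector space over $R$ with $n\ge 3$. Let $0\le k\le n$ with $n\ne 2k$, and let $\mathfrak{G}_k$ be the set of all pairs $(S,U)$ of subspaces of $V$ with $\dim S=k$, $\dim U=n-k$ and $S+U=V$. For a basis $B$ of $V$, the base subset of $\mathfrak{G}_k$ associated with $B$ is the set of all $(S,U)\in\mathfrak{G}_k$ such that each of $S$ and $U$ is spanned by vectors of $B$. Let $f:\mathfrak{G}_k\to\mathfrak{G}_k$ be a bijection such that, for every $X\subseteq\mathfrak{G}_k$, $f(X)$ is a base subset if and only if $X$ is a base subset. Then $f$ is induced by a semilinear isomorphism of $V$ to itself or to the dual space $V^*$. That is, at least one of the following holds: (1) there is a semilinear bijection $l:V\to V$ (with respect to some automorphism of $R$) such that $f(S,U)=(l(S),l(U))$ for all $(S,U)\in\mathfrak{G}_k$; (2) there is a semilinear bijection $s:V\to V^*$ (with respect to some anti-automorphism of $R$, where $V^*$ is the right vector space of all linear maps $V\to R$) such that $f(S,U)=(s(U)^0,s(S)^0)$ for all $(S,U)\in\mathfrak{G}_k$, where $W^0=\{v\in V:\varphi(v)=0\text{ for all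 }\varphi\in W\}$ for a subspace $W\subseteq V^*$. -/

import Mathlib

namespace LinearInvolutions

open Module

section

variable (R : Type*) (V : Type*) [DivisionRing R] [AddCommGroup V] [Module R V]

/-- The set of all pairs `(S, U)` of subspaces of `V` such that `dim S = k`,
`dim U = dim V - k` and `S + U = V`. -/
def complPairs (k : ℕ) : Set (Submodule R V × Submodule R V) :=
  {p | finrank R p.1 = k ∧ k + finrank R p.2 = finrank R V ∧ p.1 ⊔ p.2 = ⊤}

end

section

variable {R : Type*} {V : Type*} [DivisionRing R] [AddCommGroup V] [Module R V]

/-- The base subset associated with a basis `b` of `V`: all pairs `(S, U)` in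
`complPairs R V k` such that both `S` and `U` are spanned by vectors of `b`. -/
def baseSubset {ι : Type*} (b : Basis ι R V) (k : ℕ) : Set (complPairs R V k) :=
  {p | (∃ A : Set ι, p.1.1 = Submodule.span R (b '' A)) ∧
       (∃ C : Set ι, p.1.2 = Submodule.span R (b '' C))}

/-- A set of pairs is a base subset if it is associated with some basis of `V`. -/
def IsBaseSubset {k : ℕ} (X : Set (complPairs R V k)) : Prop :=
  ∃ b : Basis (Fin (finrank R V)) R V, X = baseSubset b k

/-- The annihilator in `V` of a subspace of the dual space. For a left vector space `V` over
the division ring `R`, the dual space `V →ₗ[R] R` is a right vector space over `R`, which is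
the same as a left vector space over the opposite ring `Rᵐᵒᵖ`. -/
def annihilator (W : Submodule Rᵐᵒᵖ (V →ₗ[R] R)) : Submodule R V where
  carrier := {v | ∀ φ ∈ W, φ v = 0}
  zero_mem' := fun φ _ => map_zero φ
  add_mem' := fun {a b} ha hb φ hφ => by rw [map_add, ha φ hφ, hb φ hφ, add_zero]
  smul_mem' := fun c v hv φ hφ => by rw [map_smul, hv φ hφ, smul_zero]

/-- `f` is induced by a semilinear isomorphism `l` of `V` to itself: it sends every pair
`(S, U)` to `(l(S), l(U))`. -/
def InducedBySemilinearAut {k : ℕ} (f : complPairs R V k ≃ complPairs R V k) : Prop :=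
  ∃ (σ : R ≃+* R) (l : V →ₛₗ[(σ : R →+* R)] V), Function.Bijective l ∧
    ∀ p : complPairs R V k,
      (f p : Submodule R V × Submodule R V) = (p.1.1.map l, p.1.2.map l)

/-- `f` is induced by a semilinear isomorphism `s` of `V` to the dual space: it sends every
pair `(S, U)` to the pair of annihilators of `s(U)` and `s(S)`. -/
def InducedBySemilinearDual {k : ℕ} (f : complPairs R V k ≃ complPairs R V k) : Prop :=
  ∃ (σ : R ≃+* Rᵐᵒᵖ) (s : V →ₛₗ[(σ : R →+* Rᵐᵒᵖ)] (V →ₗ[R] R)), Function.Bijective s ∧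
    ∀ p : complPairs R V k,
      (f p : Submodule R V × Submodule R V) =
        (annihilator (p.1.2.map s), annihilator (p.1.1.map s))

end

end LinearInvolutions

/-!
A pair `(S, U)` of complementary subspaces is the same as the projection onto `S` along `U`, and a
base subset consists of the projections of rank `k` that are diagonal in some basis. Interchanging
`S` and `U` one may assume `1 ≤ k` and `2 * k < dim V` (for `k = 0` and `k = dim V` there is only
one pair). The proof reduces the statement to `k = 1`, i.e. to antiflags (a point together with a
hyperplane that misses it), and then to the fundamental theorem of projective geometry.

*Reduction to antiflags.* Fix a basis `b`, and index the members of its base subset by `k`-element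
sets `K` of indices. The maximal subsets of it that lie in another base subset are the sets
`unseparated b k e`, for `e` a pair of indices, of all `K` that contain both or neither of the
elements of `e`. Therefore `f` induces a map from the pairs of indices of `b` to the pairs of
indices of the image basis. Whether two pairs are disjoint can be read off from base subsets
(`decoupled_of_disjoint`, `not_decoupled_of_not_disjoint`): changes of `b` inside disjoint planes
are compatible, while elementary changes inside planes with a common line give projections that do
not commute. Triangles are then told from stars by inclusions among the sets `unseparated b k e`, so
that the map on pairs of indices comes from a permutation (`exists_perm_of_triangles`). As
`dim V ≠ 2 * k`, a set `K` is determined by the pairs it separates, since its complement has a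
different size. It follows that `f` sends the coordinate pairs of `b` to those of a suitable basis
`b'` with the same index sets (`exists_carries`). The antiflag of `b'` at an index depends only on
the antiflag of `b` there, because elementary changes of `b` away from the index leave enough
coordinate pairs unchanged (`coordPair_singleton_eq_of_carries`). So `f` comes from a bijection `F`
of antiflags which preserves commutation (`exists_antiflag_equiv`).

*Antiflags.* Having the point or the hyperplane in common is expressible through commutation
(`adjacent_iff`). Hence `F` either preserves both relations "same point" and "same hyperplane" or
interchanges them (`straight_or_twisted`). In the first case it induces a collineation of `V`, in
the second one a collineation from `V` to its dual space, and the fundamental theorem of projective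
geometry (`IsCollineation.exists_semilinear`) provides the semilinear bijection.
-/

namespace LinearInvolutions

open Module

/-! ### The fundamental theorem of projective geometry -/

section FundamentalTheorem

variable {R V R' W : Type*} [DivisionRing R] [AddCommGroup V] [Module R V]
  [DivisionRing R'] [AddCommGroup W] [Module R' W]

/-- A collineation between the projective spaces of `V` and `W`, given by a choice of a
representative `g v` of the image of the point `⟨v⟩`; the value of `g` at `0` is irrelevant. -/
structure IsCollineation (R R' : Type*) {V W : Type*} [DivisionRing R] [AddCommGroup V]
    [Module R V] [DivisionRing R'] [AddCommGroup W] [Module R' W] (g : V → W) : Prop where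
  ne_zero : ∀ v, v ≠ 0 → g v ≠ 0
  mem_iff : ∀ u v x, u ≠ 0 → v ≠ 0 → x ≠ 0 →
    (x ∈ Submodule.span R {u, v} ↔ g x ∈ Submodule.span R' {g u, g v})
  surj : ∀ w, w ≠ 0 → ∃ v, v ≠ 0 ∧ w ∈ Submodule.span R' {g v}

/-- The nonzero vector `w` spans the image of the point spanned by the nonzero vector `v`. -/
def Represents (R' : Type*) {V W : Type*} [Zero V] [DivisionRing R'] [AddCommGroup W]
    [Module R' W] (g : V → W) (v : V) (w : W) : Prop :=
  v ≠ 0 ∧ w ≠ 0 ∧ w ∈ Submodule.span R' {g v}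

lemma span_singleton_eq_of_mem {a b : W} (ha : a ≠ 0) (h : a ∈ Submodule.span R' {b}) :
    Submodule.span R' {a} = Submodule.span R' {b} := by
  obtain ⟨c, rfl⟩ := Submodule.mem_span_singleton.1 h
  have hc : c ≠ 0 := by rintro rfl; simp at ha
  exact Submodule.span_singleton_smul_eq (IsUnit.mk0 c hc) b

lemma Represents.smul {g : V → W} {v : V} {w : W} (h : Represents R' g v w) {c : R'}
    (hc : c ≠ 0) : Represents R' g v (c • w) :=
  ⟨h.1, smul_ne_zero hc h.2.1, Submodule.smul_mem _ _ h.2.2⟩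

lemma Represents.span_eq {g : V → W} {v : V} {w : W} (h : Represents R' g v w) :
    Submodule.span R' {w} = Submodule.span R' {g v} :=
  span_singleton_eq_of_mem h.2.1 h.2.2

lemma Represents.congr {g : V → W} {v : V} {w w' : W} (h : Represents R' g v w)
    (h' : Represents R' g v w') : ∃ c : R', w' = c • w := by
  have := h'.2.2
  rw [← h.span_eq] at this
  obtain ⟨c, hc⟩ := Submodule.mem_span_singleton.1 this
  exact ⟨c, hc.symm⟩

section

variable {g : V → W} (hg : IsCollineation R R' g)
include hg

lemma IsCollineation.represents {v : V} (hv : v ≠ 0) : Represents R' g v (g v) :=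
  ⟨hv, hg.ne_zero v hv, Submodule.mem_span_singleton_self _⟩

lemma IsCollineation.mem_pair_iff {u v x : V} {w a b : W} (hu : Represents R' g u w)
    (hv : Represents R' g v a) (hx : Represents R' g x b) :
    x ∈ Submodule.span R {u, v} ↔ b ∈ Submodule.span R' {w, a} := by
  rw [hg.mem_iff u v x hu.1 hv.1 hx.1]
  have h1 : Submodule.span R' {w, a} = Submodule.span R' {g u, g v} := by
    rw [Submodule.span_insert, Submodule.span_insert, hu.span_eq, hv.span_eq]
  rw [h1, ← Submodule.span_singleton_le_iff_mem, ← Submodule.span_singleton_le_iff_mem,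
    hx.span_eq]

lemma IsCollineation.mem_singleton_iff {u x : V} {w b : W} (hu : Represents R' g u w)
    (hx : Represents R' g x b) :
    x ∈ Submodule.span R {u} ↔ b ∈ Submodule.span R' {w} := by
  simpa using hg.mem_pair_iff hu hu hx

/-- Normalising a representative of the image of `v` against a given representative for `u`. -/
lemma IsCollineation.exists_add {u v : V} {w : W} (hu : Represents R' g u w) (hv : v ≠ 0)
    (huv : v ∉ Submodule.span R {u}) :
    ∃ a, Represents R' g v a ∧ Represents R' g (u + v) (w + a) := by
  have huv0 : u + v ≠ 0 := by
    intro h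
    apply huv
    rw [eq_neg_of_add_eq_zero_right h]
    exact Submodule.neg_mem _ (Submodule.mem_span_singleton_self _)
  have hz := hg.represents huv0
  have hb := hg.represents hv
  have h1 : u + v ∈ Submodule.span R {u, v} :=
    Submodule.add_mem _ (Submodule.subset_span (by simp)) (Submodule.subset_span (by simp))
  rw [hg.mem_pair_iff hu hb hz, Submodule.mem_span_pair] at h1
  obtain ⟨α, β, h⟩ := h1
  have hα : α ≠ 0 := by
    rintro rfl
    have h2 : g (u + v) ∈ Submodule.span R' {g v} :=
      Submodule.mem_span_singleton.2 ⟨β, by simpa using h⟩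
    rw [← hg.mem_singleton_iff hb hz] at h2
    have h3 : u ∈ Submodule.span R {v} := by
      simpa using Submodule.sub_mem _ h2 (Submodule.mem_span_singleton_self v)
    rw [span_singleton_eq_of_mem hu.1 h3] at huv
    exact huv (Submodule.mem_span_singleton_self v)
  have hβ : β ≠ 0 := by
    rintro rfl
    have h2 : g (u + v) ∈ Submodule.span R' {w} :=
      Submodule.mem_span_singleton.2 ⟨α, by simpa using h⟩
    rw [← hg.mem_singleton_iff hu hz] at h2
    exact huv (by simpa using Submodule.sub_mem _ h2 (Submodule.mem_span_singleton_self u))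
  refine ⟨(α⁻¹ * β) • g v, hb.smul (mul_ne_zero (inv_ne_zero hα) hβ), ?_⟩
  have : w + (α⁻¹ * β) • g v = α⁻¹ • g (u + v) := by
    rw [← h, smul_add, smul_smul, smul_smul, inv_mul_cancel₀ hα, one_smul]
  rw [this]
  exact hz.smul (inv_ne_zero hα)

lemma IsCollineation.add_unique {u v : V} {w a a' : W} (hu : u ≠ 0)
    (huv : v ∉ Submodule.span R {u}) (ha : Represents R' g v a) (ha' : Represents R' g v a')
    (h : Represents R' g (u + v) (w + a)) (h' : Represents R' g (u + v) (w + a')) : a = a' := by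
  by_contra hne
  have h1 : Represents R' g v (a - a') :=
    ⟨ha.1, sub_ne_zero.2 hne, Submodule.sub_mem _ ha.2.2 ha'.2.2⟩
  have h2 : Represents R' g (u + v) (a - a') :=
    ⟨h.1, sub_ne_zero.2 hne, by simpa using Submodule.sub_mem _ h.2.2 h'.2.2⟩
  have h3 := (hg.mem_singleton_iff h1 h2).2 (Submodule.mem_span_singleton_self _)
  have h4 : u ∈ Submodule.span R {v} := by
    simpa using Submodule.sub_mem _ h3 (Submodule.mem_span_singleton_self v)
  rw [span_singleton_eq_of_mem hu h4] at huv
  exact huv (Submodule.mem_span_singleton_self v)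

lemma IsCollineation.independent {u v x : V} {w a b : W}
    (huv : v ∉ Submodule.span R {u}) (hx : x ∉ Submodule.span R {u, v})
    (hw : Represents R' g u w) (ha : Represents R' g v a) (hb : Represents R' g x b)
    {α β γ : R'} (h : α • w + β • a + γ • b = 0) : α = 0 ∧ β = 0 ∧ γ = 0 := by
  rw [hg.mem_pair_iff hw ha hb] at hx
  rw [hg.mem_singleton_iff hw ha] at huv
  have hγ : γ = 0 := by
    by_contra hγ
    apply hx
    have h2 : γ • b ∈ Submodule.span R' {w, a} := by
      rw [eq_neg_of_add_eq_zero_right h]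
      exact Submodule.neg_mem _ (Submodule.mem_span_pair.2 ⟨α, β, rfl⟩)
    exact (Submodule.smul_mem_iff _ hγ).1 h2
  subst hγ
  have hβ : β = 0 := by
    by_contra hβ
    apply huv
    have h2 : β • a ∈ Submodule.span R' {w} := by
      have h' : α • w + β • a = 0 := by simpa using h
      rw [eq_neg_of_add_eq_zero_right h']
      exact Submodule.neg_mem _ (Submodule.mem_span_singleton.2 ⟨α, rfl⟩)
    exact (Submodule.smul_mem_iff _ hβ).1 h2
  subst hβ
  refine ⟨?_, rfl, rfl⟩
  have h' : α • w = 0 := by simpa using h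
  exact (smul_eq_zero.1 h').resolve_right hw.2.1

/-- If `a` and `b` are both normalised against `w`, then the images of `u + v + x` and of `v + x`
are the expected ones: each is the intersection of two lines. -/
lemma IsCollineation.add_add {u v x : V} {w a b : W}
    (huv : v ∉ Submodule.span R {u}) (hx : x ∉ Submodule.span R {u, v})
    (hw : Represents R' g u w) (ha : Represents R' g v a) (hb : Represents R' g x b)
    (hwa : Represents R' g (u + v) (w + a)) (hwb : Represents R' g (u + x) (w + b)) :
    Represents R' g (u + v + x) (w + a + b) ∧ Represents R' g (v + x) (a + b) := by
  have indep := @IsCollineation.independent _ _ _ _ _ _ _ _ _ _ _ hg _ _ _ _ _ _ huv hx hw ha hb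
  have h0 : u + v + x ≠ 0 := by
    intro h
    apply hx
    rw [eq_neg_of_add_eq_zero_right h]
    exact Submodule.neg_mem _ (Submodule.add_mem _ (Submodule.subset_span (by simp))
      (Submodule.subset_span (by simp)))
  have h0' : v + x ≠ 0 := by
    intro h
    apply hx
    rw [eq_neg_of_add_eq_zero_right h]
    exact Submodule.neg_mem _ (Submodule.subset_span (by simp))
  have key : Represents R' g (u + v + x) (w + a + b) := by
    have hz := hg.represents h0
    have h1 : u + v + x ∈ Submodule.span R {u + v, x} :=
      Submodule.mem_span_pair.2 ⟨1, 1, by simp⟩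
    have h2 : u + v + x ∈ Submodule.span R {u + x, v} :=
      Submodule.mem_span_pair.2 ⟨1, 1, by simp; abel⟩
    rw [hg.mem_pair_iff hwa hb hz, Submodule.mem_span_pair] at h1
    rw [hg.mem_pair_iff hwb ha hz, Submodule.mem_span_pair] at h2
    obtain ⟨α, β, h1⟩ := h1
    obtain ⟨γ, δ, h2⟩ := h2
    have h3 : (α - γ) • w + (α - δ) • a + (β - γ) • b = 0 := by
      have : α • (w + a) + β • b - (γ • (w + b) + δ • a) = 0 := by rw [h1, h2, sub_self]
      rw [← this]
      simp only [sub_smul, smul_add]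
      abel
    obtain ⟨e1, -, e3⟩ := indep h3
    have e : β = α := by rw [sub_eq_zero.1 e3, sub_eq_zero.1 e1]
    subst e
    rw [← smul_add] at h1
    have hβ : β ≠ 0 := by rintro rfl; exact hz.2.1 (by simpa using h1.symm)
    have : w + a + b = β⁻¹ • g (u + v + x) := by
      rw [← h1, smul_smul, inv_mul_cancel₀ hβ, one_smul]
    rw [this]
    exact hz.smul (inv_ne_zero hβ)
  refine ⟨key, ?_⟩
  have hz := hg.represents h0'
  have h1 : v + x ∈ Submodule.span R {v, x} := Submodule.mem_span_pair.2 ⟨1, 1, by simp⟩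
  have h2 : v + x ∈ Submodule.span R {u, u + v + x} :=
    Submodule.mem_span_pair.2 ⟨-1, 1, by simp; abel⟩
  rw [hg.mem_pair_iff ha hb hz, Submodule.mem_span_pair] at h1
  rw [hg.mem_pair_iff hw key hz, Submodule.mem_span_pair] at h2
  obtain ⟨α, β, h1⟩ := h1
  obtain ⟨γ, δ, h2⟩ := h2
  have h3 : (-(γ + δ)) • w + (α - δ) • a + (β - δ) • b = 0 := by
    have : α • a + β • b - (γ • w + δ • (w + a + b)) = 0 := by rw [h1, h2, sub_self]
    rw [← this]
    simp only [sub_smul, smul_add, neg_smul, add_smul]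
    abel
  obtain ⟨-, e2, e3⟩ := indep h3
  have e : β = α := by rw [sub_eq_zero.1 e3, sub_eq_zero.1 e2]
  subst e
  rw [← smul_add] at h1
  have hβ : β ≠ 0 := by rintro rfl; exact hz.2.1 (by simpa using h1.symm)
  have : a + b = β⁻¹ • g (v + x) := by
    rw [← h1, smul_smul, inv_mul_cancel₀ hβ, one_smul]
  rw [this]
  exact hz.smul (inv_ne_zero hβ)

end

end FundamentalTheorem

section FundamentalTheorem

variable {R V R' W : Type*} [DivisionRing R] [AddCommGroup V] [Module R V]
  [DivisionRing R'] [AddCommGroup W] [Module R' W]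

/-- Linear independence of a triple, in the form in which it is built up one vector at a time. -/
def Independent₃ (R : Type*) {V : Type*} [DivisionRing R] [AddCommGroup V] [Module R V]
    (u v x : V) : Prop :=
  u ≠ 0 ∧ v ∉ Submodule.span R {u} ∧ x ∉ Submodule.span R {u, v}

lemma notMem_span_singleton_symm {u v : V} (hu : u ≠ 0) (h : v ∉ Submodule.span R {u}) :
    u ∉ Submodule.span R {v} := by
  intro h'
  rw [span_singleton_eq_of_mem hu h'] at h
  exact h (Submodule.mem_span_singleton_self v)

lemma ne_zero_of_notMem {s : Submodule R V} {v : V} (h : v ∉ s) : v ≠ 0 := by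
  rintro rfl; exact h s.zero_mem

lemma Independent₃.swap_left {u v x : V} (h : Independent₃ R u v x) : Independent₃ R v u x :=
  ⟨ne_zero_of_notMem h.2.1, notMem_span_singleton_symm h.1 h.2.1, by
    rw [Set.pair_comm]; exact h.2.2⟩

lemma Independent₃.swap_right {u v x : V} (h : Independent₃ R u v x) : Independent₃ R u x v := by
  refine ⟨h.1, fun h' => h.2.2 (Submodule.span_mono (by simp) h'), fun h' => h.2.2 ?_⟩
  rw [Set.pair_comm] at h' ⊢
  exact mem_span_insert_exchange h' h.2.1

lemma exists_notMem_span_pair (hV : 3 ≤ finrank R V) (u v : V) :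
    ∃ x, x ∉ Submodule.span R {u, v} := by
  classical
  by_contra! h
  have h1 : Submodule.span R (({u, v} : Finset V) : Set V) = ⊤ := by
    rw [eq_top_iff]; intro x _; simpa using h x
  have h2 := finrank_span_finset_le_card (R := R) ({u, v} : Finset V)
  rw [Set.finrank, h1, finrank_top] at h2
  have := Finset.card_le_two (a := u) (b := v)
  omega

lemma exists_independent₃ (hV : 3 ≤ finrank R V) {u v : V} (hu : u ≠ 0)
    (hv : v ∉ Submodule.span R {u}) : ∃ x, Independent₃ R u v x := by
  obtain ⟨x, hx⟩ := exists_notMem_span_pair hV u v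
  exact ⟨x, hu, hv, hx⟩

/-- Representatives `w` and `a` of the images of `u` and `v` are joined if they are normalised
against each other: their sum represents the image of `u + v`. -/
def Joined (R' : Type*) {V W : Type*} [AddCommGroup V] [DivisionRing R'] [AddCommGroup W]
    [Module R' W] (g : V → W) (u : V) (w : W) (v : V) (a : W) : Prop :=
  Represents R' g u w ∧ Represents R' g v a ∧ Represents R' g (u + v) (w + a)

lemma Joined.symm {g : V → W} {u v : V} {w a : W} (h : Joined R' g u w v a) :
    Joined R' g v a u w :=
  ⟨h.2.1, h.1, by rw [add_comm v, add_comm a]; exact h.2.2⟩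

section

variable {g : V → W} (hg : IsCollineation R R' g)
include hg

/-- Representatives that are normalised against a common third one are normalised against each
other. -/
lemma IsCollineation.joined_of_common {u v x : V} {w a b : W} (hi : Independent₃ R u v x)
    (ha : Joined R' g u w v a) (hb : Joined R' g u w x b) : Joined R' g v a x b :=
  ⟨ha.2.1, hb.2.1, (hg.add_add hi.2.1 hi.2.2 ha.1 ha.2.1 hb.2.1 ha.2.2 hb.2.2).2⟩

/-- The representatives of the images of all points can be chosen so that any two that belong
to independent vectors are joined. -/
lemma IsCollineation.exists_coherent (hV : 3 ≤ finrank R V) :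
    ∃ T : V → W, T 0 = 0 ∧ (∀ v, v ≠ 0 → Represents R' g v (T v)) ∧
      ∀ u v, u ≠ 0 → v ∉ Submodule.span R {u} → Joined R' g u (T u) v (T v) := by
  classical
  have : Nontrivial V := Module.nontrivial_of_finrank_pos (R := R) (by omega)
  obtain ⟨u0, hu0⟩ := exists_ne (0 : V)
  obtain ⟨v1, hv1⟩ : ∃ v1, v1 ∉ Submodule.span R {u0} := by
    obtain ⟨x, hx⟩ := exists_notMem_span_pair hV u0 u0
    exact ⟨x, by simpa using hx⟩
  have hv10 : v1 ≠ 0 := ne_zero_of_notMem hv1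
  have H : ∀ v, v ∉ Submodule.span R {u0} → ∃ a, Joined R' g u0 (g u0) v a := by
    intro v hv
    obtain ⟨a, h1, h2⟩ := hg.exists_add (hg.represents hu0) (ne_zero_of_notMem hv) hv
    exact ⟨a, hg.represents hu0, h1, h2⟩
  choose! h hh using H
  have K : ∀ v, v ∉ Submodule.span R {v1} → ∃ a, Joined R' g v1 (h v1) v a := by
    intro v hv
    obtain ⟨a, h1, h2⟩ := hg.exists_add (hh v1 hv1).2.1 (ne_zero_of_notMem hv) hv
    exact ⟨a, (hh v1 hv1).2.1, h1, h2⟩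
  choose! k hk using K
  -- Two vectors off the line of `u0`: if they are coplanar with `u0`, pass to a third base point.
  have G1 : ∀ v v', v ∉ Submodule.span R {u0} → v' ∉ Submodule.span R {u0} →
      v' ∉ Submodule.span R {v} → Joined R' g v (h v) v' (h v') := by
    intro v v' hv hv' hvv'
    by_cases hc : v' ∈ Submodule.span R {u0, v}
    · obtain ⟨x, hx⟩ := exists_independent₃ hV hu0 hv
      have hle : Submodule.span R {u0, v'} ≤ Submodule.span R {u0, v} := by
        rw [Submodule.span_le]
        rintro y (rfl | rfl)
        · exact Submodule.subset_span (by simp)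
        · exact hc
      have hle' : Submodule.span R {v, v'} ≤ Submodule.span R {u0, v} := by
        rw [Submodule.span_le]
        rintro y (rfl | rfl)
        · exact Submodule.subset_span (by simp)
        · exact hc
      have hx' : Independent₃ R u0 v' x := ⟨hu0, hv', fun hm => hx.2.2 (hle hm)⟩
      have hx'' : Independent₃ R v v' x :=
        ⟨ne_zero_of_notMem hv, hvv', fun hm => hx.2.2 (hle' hm)⟩
      have hxu := hx.swap_right.2.1
      have j1 := hg.joined_of_common hx.swap_right (hh x hxu) (hh v hv)
      have j2 := hg.joined_of_common hx'.swap_right (hh x hxu) (hh v' hv')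
      exact hg.joined_of_common hx''.swap_right.swap_left j1 j2
    · exact hg.joined_of_common ⟨hu0, hv, hc⟩ (hh v hv) (hh v' hv')
  have off : ∀ v, v ≠ 0 → v ∈ Submodule.span R {u0} → v ∉ Submodule.span R {v1} := by
    intro v hv0 hv hv'
    rw [← span_singleton_eq_of_mem hv0 hv, span_singleton_eq_of_mem hv0 hv'] at hv1
    exact hv1 (Submodule.mem_span_singleton_self v1)
  have G2 : ∀ v v', v ≠ 0 → v ∈ Submodule.span R {u0} → v' ∉ Submodule.span R {u0} →
      Joined R' g v (k v) v' (h v') := by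
    intro v v' hv0 hv hv'
    have hspan := span_singleton_eq_of_mem hv0 hv
    have hv1v : v ∉ Submodule.span R {v1} := off v hv0 hv
    have hv'v : v' ∉ Submodule.span R {v} := by rwa [hspan]
    have main : ∀ y, y ∉ Submodule.span R {u0} → Independent₃ R v1 v y →
        Joined R' g v (k v) y (h y) := fun y hy hi =>
      hg.joined_of_common hi (hk v hv1v) (G1 v1 y hv1 hy hi.swap_right.2.1)
    by_cases hc : v' ∈ Submodule.span R {v1, v}
    · obtain ⟨x, hx⟩ := exists_independent₃ hV hv10 hv1v
      have hle : Submodule.span R {v, v'} ≤ Submodule.span R {v1, v} := by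
        rw [Submodule.span_le]
        rintro y (rfl | rfl)
        · exact Submodule.subset_span (by simp)
        · exact hc
      have hi : Independent₃ R v v' x := ⟨hv0, hv'v, fun hm => hx.2.2 (hle hm)⟩
      have hxu : x ∉ Submodule.span R {u0} := by
        rw [← hspan]; exact hi.swap_right.2.1
      have j1 := main x hxu hx
      have j2 := G1 x v' hxu hv' hi.swap_left.swap_right.swap_left.2.1
      exact hg.joined_of_common hi.swap_right.swap_left j1.symm j2
    · exact main v' hv' ⟨hv10, hv1v, hc⟩
  refine ⟨fun v => if v = 0 then 0 else if v ∈ Submodule.span R {u0} then k v else h v,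
    by simp, ?_, ?_⟩
  · intro v hv0
    by_cases hv : v ∈ Submodule.span R {u0}
    · simpa [hv0, hv] using (hk v (off v hv0 hv)).2.1
    · simpa [hv0, hv] using (hh v hv).2.1
  · intro u v hu0' hv
    have hv0 := ne_zero_of_notMem hv
    by_cases hu : u ∈ Submodule.span R {u0}
    · have hv' : v ∉ Submodule.span R {u0} := by
        rwa [← span_singleton_eq_of_mem hu0' hu]
      simpa [hu0', hv0, hu, hv'] using G2 u v hu0' hu hv'
    · by_cases hv' : v ∈ Submodule.span R {u0}
      · simpa [hu0', hv0, hu, hv'] using (G2 v u hv0 hv' hu).symm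
      · simpa [hu0', hv0, hu, hv'] using G1 u v hu hv' hv

lemma IsCollineation.exists_additive (hV : 3 ≤ finrank R V) :
    ∃ T : V →+ W, ∀ v, v ≠ 0 → Represents R' g v (T v) := by
  obtain ⟨T, T0, hT, hJ⟩ := hg.exists_coherent hV
  have : Nontrivial V := Module.nontrivial_of_finrank_pos (R := R) (by omega)
  have add1 : ∀ u v, u ≠ 0 → v ∉ Submodule.span R {u} → T (u + v) = T u + T v := by
    intro u v hu hv
    obtain ⟨x, hx⟩ := exists_independent₃ hV hu hv
    have hi := hx.swap_right.swap_left
    have hxuv : u + v ∉ Submodule.span R {x} := by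
      intro h
      apply hi.2.2
      rw [← add_sub_cancel_left u v]
      exact Submodule.sub_mem _ (Submodule.span_mono (by simp) h) (Submodule.subset_span (by simp))
    have j := hg.add_add hi.2.1 hi.2.2 (hT x hi.1) (hT u hu) (hT v (ne_zero_of_notMem hv))
      (hJ x u hi.1 hi.2.1).2.2 (hJ x v hi.1 hi.swap_right.2.1).2.2
    have j' := hJ x (u + v) hi.1 hxuv
    refine hg.add_unique hi.1 hxuv j'.2.1 j.2 j'.2.2 ?_
    rw [← add_assoc, ← add_assoc]; exact j.1
  have add2 : ∀ u v, T (u + v) = T u + T v := by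
    intro u v
    by_cases hu : u = 0
    · simp [hu, T0]
    by_cases hv : v ∈ Submodule.span R {u}
    swap
    · exact add1 u v hu hv
    by_cases hv0 : v = 0
    · simp [hv0, T0]
    obtain ⟨x, hx⟩ : ∃ x, x ∉ Submodule.span R {u} := by
      obtain ⟨x, hx⟩ := exists_notMem_span_pair hV u u
      exact ⟨x, by simpa using hx⟩
    have e1 : T (u + v + x) = T (u + v) + T x := by
      by_cases h0 : u + v = 0
      · simp [h0, T0]
      · have : u + v ∈ Submodule.span R {u} :=
          Submodule.add_mem _ (Submodule.mem_span_singleton_self u) hv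
        apply add1 _ _ h0
        rwa [span_singleton_eq_of_mem h0 this]
    have e2 : T (u + (v + x)) = T u + T (v + x) := by
      apply add1 _ _ hu
      intro h
      exact hx (by simpa using Submodule.sub_mem _ h hv)
    have e3 : T (v + x) = T v + T x := by
      apply add1 _ _ hv0
      rwa [span_singleton_eq_of_mem hv0 hv]
    rw [add_assoc, e2, e3, ← add_assoc] at e1
    exact (add_right_cancel e1).symm
  exact ⟨⟨⟨T, T0⟩, add2⟩, hT⟩

/-- The fundamental theorem of projective geometry: a collineation of projective spaces of
dimension at least two is induced by a semilinear bijection. -/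
theorem IsCollineation.exists_semilinear (hV : 3 ≤ finrank R V) :
    ∃ (σ : R ≃+* R') (l : V →ₛₗ[(σ : R →+* R')] W), Function.Bijective l ∧
      ∀ v, v ≠ 0 → Represents R' g v (l v) := by
  obtain ⟨T, hT⟩ := hg.exists_additive hV
  have : Nontrivial V := Module.nontrivial_of_finrank_pos (R := R) (by omega)
  have hinj : Function.Injective T := by
    rw [injective_iff_map_eq_zero]
    intro v hv
    by_contra h
    exact (hT v h).2.1 hv
  have hind : ∀ u v, u ≠ 0 → v ∉ Submodule.span R {u} → ∀ α β : R',
      α • T u + β • T v = 0 → α = 0 ∧ β = 0 := by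
    intro u v hu hv α β h
    obtain ⟨x, hx⟩ := exists_independent₃ hV hu hv
    have := hg.independent hx.2.1 hx.2.2 (hT u hu) (hT v (ne_zero_of_notMem hv))
      (hT x (ne_zero_of_notMem hx.2.2)) (α := α) (β := β) (γ := 0) (by simpa using h)
    exact ⟨this.1, this.2.1⟩
  have S : ∀ (c : R) (v : V), ∃ d : R', T (c • v) = d • T v := by
    intro c v
    by_cases hv : v = 0
    · exact ⟨0, by simp [hv]⟩
    by_cases hc : c = 0
    · exact ⟨0, by simp [hc]⟩
    have h1 := hT (c • v) (smul_ne_zero hc hv)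
    have h2 := (hg.mem_singleton_iff (hT v hv) h1).1
      (Submodule.smul_mem _ _ (Submodule.mem_span_singleton_self v))
    obtain ⟨d, hd⟩ := Submodule.mem_span_singleton.1 h2
    exact ⟨d, hd.symm⟩
  choose s hs using S
  have s_ind : ∀ c u v, u ≠ 0 → v ∉ Submodule.span R {u} → s c u = s c v := by
    intro c u v hu hv
    have h1 := hs c (u + v)
    rw [smul_add, map_add, map_add, hs, hs, smul_add] at h1
    have h2 : (s c u - s c (u + v)) • T u + (s c v - s c (u + v)) • T v = 0 := by
      simp only [sub_smul]
      rw [sub_add_sub_comm, h1, sub_self]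
    obtain ⟨e1, e2⟩ := hind u v hu hv _ _ h2
    rw [sub_eq_zero.1 e1, sub_eq_zero.1 e2]
  have s_const : ∀ c u v, u ≠ 0 → v ≠ 0 → s c u = s c v := by
    intro c u v hu hv
    by_cases h : v ∈ Submodule.span R {u}
    · obtain ⟨x, hx⟩ : ∃ x, x ∉ Submodule.span R {u} := by
        obtain ⟨x, hx⟩ := exists_notMem_span_pair hV u u
        exact ⟨x, by simpa using hx⟩
      rw [s_ind c u x hu hx]
      refine (s_ind c v x hv ?_).symm
      rwa [span_singleton_eq_of_mem hv h]
    · exact s_ind c u v hu h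
  obtain ⟨u, hu⟩ := exists_ne (0 : V)
  have hTu : T u ≠ 0 := (hT u hu).2.1
  have hs' : ∀ c v, T (c • v) = s c u • T v := by
    intro c v
    by_cases hv : v = 0
    · simp [hv]
    · rw [s_const c u v hu hv, hs]
  have cancel : ∀ a b : R', a • T u = b • T u → a = b := by
    intro a b h
    rw [← sub_eq_zero, ← sub_smul] at h
    exact sub_eq_zero.1 ((smul_eq_zero.1 h).resolve_right hTu)
  let σ : R →+* R' :=
    { toFun := fun c => s c u
      map_one' := cancel _ _ (by rw [← hs', one_smul, one_smul])
      map_zero' := cancel _ _ (by rw [← hs', zero_smul, zero_smul, map_zero])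
      map_add' := fun a b => cancel _ _ (by rw [← hs', add_smul, map_add, hs', hs', add_smul])
      map_mul' := fun a b => cancel _ _ (by rw [← hs', mul_smul, hs', hs', mul_smul]) }
  have hσ : ∀ c v, T (c • v) = σ c • T v := hs'
  have hσ_surj : Function.Surjective σ := by
    intro r
    obtain ⟨x, hx⟩ : ∃ x, x ∉ Submodule.span R {u} := by
      obtain ⟨x, hx⟩ := exists_notMem_span_pair hV u u
      exact ⟨x, by simpa using hx⟩
    have hne : T x + r • T u ≠ 0 := by
      intro h
      have := hind u x hu hx r 1 (by rw [one_smul, add_comm]; exact h)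
      exact one_ne_zero this.2
    obtain ⟨y, hy0, hy⟩ := hg.surj _ hne
    have hrep : Represents R' g y (T x + r • T u) := ⟨hy0, hne, hy⟩
    have hm : y ∈ Submodule.span R {x, u} :=
      (hg.mem_pair_iff (hT x (ne_zero_of_notMem hx)) (hT u hu) hrep).2
        (Submodule.mem_span_pair.2 ⟨1, r, by simp⟩)
    obtain ⟨α, β, rfl⟩ := Submodule.mem_span_pair.1 hm
    obtain ⟨c, hc⟩ := hrep.congr (hT _ hy0)
    rw [map_add, hσ, hσ, smul_add, smul_smul] at hc
    have h2 : (σ β - c * r) • T u + (σ α - c) • T x = 0 := by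
      simp only [sub_smul]
      rw [sub_add_sub_comm, add_comm (σ β • T u), hc, add_comm (c • T x), sub_self]
    obtain ⟨e1, e2⟩ := hind u x hu hx _ _ h2
    have e1' := sub_eq_zero.1 e1
    have e2' := sub_eq_zero.1 e2
    have hα : σ α ≠ 0 := by
      intro h0
      have hβ : σ β = 0 := by rw [e1', ← e2', h0, zero_mul]
      exact (hT _ hy0).2.1 (by rw [map_add, hσ, hσ, h0, hβ, zero_smul, zero_smul, add_zero])
    refine ⟨α⁻¹ * β, ?_⟩
    rw [map_mul, map_inv₀, e1', ← e2', ← mul_assoc, inv_mul_cancel₀ hα, one_mul]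
  let e : R ≃+* R' := RingEquiv.ofBijective σ ⟨σ.injective, hσ_surj⟩
  refine ⟨e, { toFun := T, map_add' := map_add T, map_smul' := hσ }, ⟨hinj, ?_⟩, hT⟩
  intro w
  by_cases hw : w = 0
  · exact ⟨0, by rw [hw]; exact map_zero T⟩
  · obtain ⟨y, hy0, hy⟩ := hg.surj w hw
    have hrep : Represents R' g y w := ⟨hy0, hw, hy⟩
    obtain ⟨c, hc⟩ := (hT y hy0).congr hrep
    obtain ⟨r, rfl⟩ := hσ_surj c
    exact ⟨r • y, by rw [hc]; exact hσ r y⟩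

end

end FundamentalTheorem

/-! ### Antiflags: a point together with a hyperplane that misses it -/

section Antiflags

variable {R V : Type*} [DivisionRing R] [AddCommGroup V] [Module R V]

lemma exists_functional_avoiding {S : Submodule R V} {u v : V} (hu : u ∉ S) (hv : v ∉ S) :
    ∃ ψ : V →ₗ[R] R, S ≤ LinearMap.ker ψ ∧ ψ u ≠ 0 ∧ ψ v ≠ 0 := by
  obtain ⟨ψ₁, h₁, hS₁⟩ := Submodule.exists_le_ker_of_notMem hu
  obtain ⟨ψ₂, h₂, hS₂⟩ := Submodule.exists_le_ker_of_notMem hv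
  by_cases h1 : ψ₁ v = 0
  · by_cases h2 : ψ₂ u = 0
    · refine ⟨ψ₁ + ψ₂, fun x hx => ?_, by simpa [h2] using h₁, by simpa [h1] using h₂⟩
      have e1 : ψ₁ x = 0 := hS₁ hx
      have e2 : ψ₂ x = 0 := hS₂ hx
      simp [e1, e2]
    · exact ⟨ψ₂, hS₂, h2, h₂⟩
  · exact ⟨ψ₁, hS₁, h₁, h1⟩

lemma exists_mem_avoiding {S H₁ H₂ : Submodule R V} (h₁ : ¬ S ≤ H₁) (h₂ : ¬ S ≤ H₂) :
    ∃ w ∈ S, w ∉ H₁ ∧ w ∉ H₂ := by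
  obtain ⟨a, haS, ha⟩ := SetLike.not_le_iff_exists.1 h₁
  obtain ⟨b, hbS, hb⟩ := SetLike.not_le_iff_exists.1 h₂
  by_cases h1 : a ∈ H₂
  · by_cases h2 : b ∈ H₁
    · exact ⟨a + b, S.add_mem haS hbS, fun h => ha ((H₁.add_mem_iff_left h2).1 h),
        fun h => hb ((H₂.add_mem_iff_right h1).1 h)⟩
    · exact ⟨b, hbS, h2, hb⟩
  · exact ⟨a, haS, ha, h1⟩

lemma exists_span_eq {P : Submodule R V} (hP : finrank R P = 1) :
    ∃ v : V, v ≠ 0 ∧ Submodule.span R {v} = P := by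
  obtain ⟨v, hv, hspan⟩ := finrank_eq_one_iff'.1 hP
  refine ⟨v, by simpa using hv, le_antisymm ((Submodule.span_singleton_le_iff_mem _ _).2 v.2) ?_⟩
  intro w hw
  obtain ⟨c, hc⟩ := hspan ⟨w, hw⟩
  exact Submodule.mem_span_singleton.2 ⟨c, congrArg Subtype.val hc⟩

lemma notMem_span_of_ker {v q : V} {φ : V →ₗ[R] R} (hv : φ v ≠ 0) (hq : q ≠ 0) (h : φ q = 0) :
    q ∉ Submodule.span R {v} := by
  intro hm
  obtain ⟨c, rfl⟩ := Submodule.mem_span_singleton.1 hm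
  rw [map_smul, smul_eq_mul, mul_eq_zero, or_iff_left hv] at h
  simp [h] at hq

/-- Two antiflags commute if each point lies on the hyperplane of the other. Equivalently, they
are distinct members of one frame. -/
def Commute₁ (a c : complPairs R V 1) : Prop := a.1.1 ≤ c.1.2 ∧ c.1.1 ≤ a.1.2

variable [FiniteDimensional R V]

lemma finrank_ker_add_one {φ : V →ₗ[R] R} (hφ : φ ≠ 0) :
    1 + finrank R (LinearMap.ker φ) = finrank R V := by
  have h := φ.finrank_range_add_finrank_ker
  have h2 : LinearMap.range φ = ⊤ := LinearMap.range_eq_top.2 (LinearMap.surjective hφ)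
  rw [h2, finrank_top, finrank_self] at h
  exact h

/-- The antiflag formed by the point `⟨v⟩` and the hyperplane `ker φ`. -/
def antiflag (v : V) (φ : V →ₗ[R] R) (h : φ v ≠ 0) : complPairs R V 1 :=
  ⟨(Submodule.span R {v}, LinearMap.ker φ), by
    have hv : v ≠ 0 := by rintro rfl; simp at h
    have hφ : φ ≠ 0 := by rintro rfl; simp at h
    refine ⟨finrank_span_singleton hv, finrank_ker_add_one hφ, ?_⟩
    rw [eq_top_iff]
    intro x _
    refine Submodule.mem_sup.2 ⟨(φ x * (φ v)⁻¹) • v, Submodule.smul_mem _ _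
      (Submodule.mem_span_singleton_self v), x - (φ x * (φ v)⁻¹) • v, ?_, by simp⟩
    simp [h]⟩

lemma exists_ker_eq {H : Submodule R V} (hH : 1 + finrank R H = finrank R V) :
    ∃ φ : V →ₗ[R] R, φ ≠ 0 ∧ LinearMap.ker φ = H := by
  have hlt : H < ⊤ := by
    rw [lt_top_iff_ne_top]; rintro rfl; rw [finrank_top] at hH; omega
  obtain ⟨φ, hφ, hle⟩ := Submodule.exists_le_ker_of_lt_top H hlt
  refine ⟨φ, hφ, (Submodule.eq_of_le_of_finrank_eq hle ?_).symm⟩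
  have := finrank_ker_add_one hφ
  omega

lemma exists_eq_antiflag (a : complPairs R V 1) :
    ∃ (v : V) (φ : V →ₗ[R] R) (h : φ v ≠ 0), a = antiflag v φ h := by
  obtain ⟨⟨P, H⟩, h1, h2, h3⟩ := a
  obtain ⟨v, hv, rfl⟩ := exists_span_eq h1
  obtain ⟨φ, hφ, rfl⟩ := exists_ker_eq h2
  refine ⟨v, φ, fun h => hφ ?_, rfl⟩
  have : Submodule.span R {v} ≤ LinearMap.ker φ :=
    (Submodule.span_singleton_le_iff_mem _ _).2 h
  rw [← LinearMap.ker_eq_top, ← h3]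
  exact (sup_eq_right.2 this).symm

@[simp] lemma antiflag_fst (v : V) (φ : V →ₗ[R] R) (h : φ v ≠ 0) :
    (antiflag v φ h).1.1 = Submodule.span R {v} := rfl

@[simp] lemma antiflag_snd (v : V) (φ : V →ₗ[R] R) (h : φ v ≠ 0) :
    (antiflag v φ h).1.2 = LinearMap.ker φ := rfl

lemma commute₁_antiflag {v w : V} {φ ψ : V →ₗ[R] R} {h : φ v ≠ 0} {h' : ψ w ≠ 0} :
    Commute₁ (antiflag v φ h) (antiflag w ψ h') ↔ ψ v = 0 ∧ φ w = 0 := by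
  simp [Commute₁, Submodule.span_singleton_le_iff_mem]

/-- The antiflags that commute with both `x` and `y`. -/
def perp (x y : complPairs R V 1) : Set (complPairs R V 1) :=
  {c | Commute₁ x c ∧ Commute₁ y c}

/-- The antiflags that commute with all members of `perp x y`. -/
def biperp (x y : complPairs R V 1) : Set (complPairs R V 1) :=
  {d | ∀ c ∈ perp x y, Commute₁ d c}

/-- Adjacency of antiflags, phrased through commutation only; `adjacent_iff` shows that it means
to have the point or the hyperplane in common, but not both. -/
def Adjacent (x y : complPairs R V 1) : Prop :=
  x ≠ y ∧ ∀ z ∈ biperp x y, ∀ w ∈ biperp x y, z ≠ w → perp z w ⊆ perp x y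

lemma hyperplane_eq_of_le {H H' : Submodule R V} (hH : 1 + finrank R H = finrank R V)
    (hH' : 1 + finrank R H' = finrank R V) (h : H ≤ H') : H = H' :=
  Submodule.eq_of_le_of_finrank_eq h (by omega)

lemma point_eq_of_le {P P' : Submodule R V} (hP : finrank R P = 1) (hP' : finrank R P' = 1)
    (h : P ≤ P') : P = P' :=
  Submodule.eq_of_le_of_finrank_eq h (by omega)

lemma finrank_inf_hyperplanes {H H' : Submodule R V} (hH : 1 + finrank R H = finrank R V)
    (hH' : 1 + finrank R H' = finrank R V) (hne : H ≠ H') :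
    2 + finrank R (H ⊓ H' : Submodule R V) = finrank R V := by
  have h1 := Submodule.finrank_sup_add_finrank_inf_eq H H'
  have h2 : H < H ⊔ H' := by
    rw [left_lt_sup]
    exact fun h => hne (hyperplane_eq_of_le hH' hH h).symm
  have h3 := Submodule.finrank_lt_finrank_of_lt h2
  have h4 := Submodule.finrank_le (H ⊔ H')
  omega

lemma finrank_sup_points {P P' : Submodule R V} (hP : finrank R P = 1)
    (hP' : finrank R P' = 1) (hne : P ≠ P') : finrank R (P ⊔ P' : Submodule R V) = 2 := by
  have h1 := Submodule.finrank_sup_add_finrank_inf_eq P P'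
  have h2 : P < P ⊔ P' := by
    rw [left_lt_sup]
    exact fun h => hne (point_eq_of_le hP' hP h).symm
  have h3 := Submodule.finrank_lt_finrank_of_lt h2
  have h4 := Submodule.finrank_add_le_finrank_add_finrank P P'
  omega

/-- For antiflags with a common point `P`, the antiflags in `biperp x y` have the point `P` and a
hyperplane of the pencil spanned by the two given ones, and any two of them span this pencil. -/
lemma adjacent_of_fst_eq (hV : 3 ≤ finrank R V) {x y : complPairs R V 1} (hne : x ≠ y)
    (h : x.1.1 = y.1.1) : Adjacent x y := by
  have hH : x.1.2 ≠ y.1.2 := fun h' => hne (Subtype.ext (Prod.ext h h'))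
  have hfr := finrank_inf_hyperplanes x.2.2.1 y.2.2.1 hH
  have hbot : x.1.2 ⊓ y.1.2 ≠ ⊥ := by
    intro hb; rw [hb, finrank_bot] at hfr; omega
  obtain ⟨q₀, hq₀, hq₀0⟩ := Submodule.exists_mem_ne_zero_of_ne_bot hbot
  have key : ∀ d ∈ biperp x y, d.1.1 = x.1.1 ∧ x.1.2 ⊓ y.1.2 ≤ d.1.2 := by
    intro d hd
    obtain ⟨v, φ, hφ, rfl⟩ := exists_eq_antiflag x
    obtain ⟨v', φ', hφ', rfl⟩ := exists_eq_antiflag y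
    obtain ⟨u, χ, hχ, rfl⟩ := exists_eq_antiflag d
    have hv' : v' ∈ Submodule.span R {v} := by
      have h' : Submodule.span R {v} = Submodule.span R {v'} := h
      rw [h']; exact Submodule.mem_span_singleton_self v'
    have mem : ∀ (q : V) (ψ : V →ₗ[R] R) (hq : ψ q ≠ 0), φ q = 0 → φ' q = 0 → ψ v = 0 →
        ψ u = 0 ∧ χ q = 0 := by
      intro q ψ hq h1 h2 h3
      have h4 : ψ v' = 0 := by
        obtain ⟨c, rfl⟩ := Submodule.mem_span_singleton.1 hv'
        simp [h3]
      exact commute₁_antiflag.1 (hd (antiflag q ψ hq)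
        ⟨commute₁_antiflag.2 ⟨h3, h1⟩, commute₁_antiflag.2 ⟨h4, h2⟩⟩)
    constructor
    · apply point_eq_of_le (antiflag u χ hχ).2.1 (antiflag v φ hφ).2.1
      rw [antiflag_fst, antiflag_fst, Submodule.span_singleton_le_iff_mem]
      by_contra hu
      obtain ⟨ψ, h1, h2, h3⟩ := exists_functional_avoiding hu
        (notMem_span_of_ker hφ hq₀0 hq₀.1)
      exact h2 (mem q₀ ψ h3 hq₀.1 hq₀.2 (h1 (Submodule.mem_span_singleton_self v))).1
    · rintro q ⟨hq1, hq2⟩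
      by_cases hq0 : q = 0
      · rw [hq0]; exact Submodule.zero_mem _
      have := notMem_span_of_ker hφ hq0 hq1
      obtain ⟨ψ, h1, h2, -⟩ := exists_functional_avoiding this this
      exact (mem q ψ h2 hq1 hq2 (h1 (Submodule.mem_span_singleton_self v))).2
  refine ⟨hne, fun z hz w hw hzw c hc => ?_⟩
  obtain ⟨z1, z2⟩ := key z hz
  obtain ⟨w1, w2⟩ := key w hw
  have hzw2 : z.1.2 ≠ w.1.2 := fun h' => hzw (Subtype.ext (Prod.ext (z1.trans w1.symm) h'))
  have hfr' := finrank_inf_hyperplanes z.2.2.1 w.2.2.1 hzw2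
  have heq : x.1.2 ⊓ y.1.2 = z.1.2 ⊓ w.1.2 :=
    Submodule.eq_of_le_of_finrank_eq (le_inf z2 w2) (by omega)
  have hc1 : c.1.1 ≤ x.1.2 ⊓ y.1.2 := by rw [heq]; exact le_inf hc.1.2 hc.2.2
  have hc2 : x.1.1 ≤ c.1.2 := by rw [← z1]; exact hc.1.1
  exact ⟨⟨hc2, hc1.trans inf_le_left⟩, ⟨h ▸ hc2, hc1.trans inf_le_right⟩⟩

lemma adjacent_of_snd_eq (hV : 3 ≤ finrank R V) {x y : complPairs R V 1} (hne : x ≠ y)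
    (h : x.1.2 = y.1.2) : Adjacent x y := by
  have hP : x.1.1 ≠ y.1.1 := fun h' => hne (Subtype.ext (Prod.ext h' h))
  have hfr := finrank_sup_points x.2.1 y.2.1 hP
  have key : ∀ d ∈ biperp x y, d.1.2 = x.1.2 ∧ d.1.1 ≤ x.1.1 ⊔ y.1.1 := by
    intro d hd
    -- A hyperplane through both points cannot contain the common hyperplane.
    have hnle : ∀ ψ : V →ₗ[R] R, ψ ≠ 0 → x.1.1 ⊔ y.1.1 ≤ LinearMap.ker ψ →
        ¬ x.1.2 ≤ LinearMap.ker ψ := by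
      intro ψ hψ h1 h2
      apply hψ
      rw [← LinearMap.ker_eq_top, eq_top_iff, ← x.2.2.2]
      exact sup_le (le_sup_left.trans h1) h2
    have mem : ∀ (q : V) (ψ : V →ₗ[R] R) (hq : ψ q ≠ 0), q ∈ x.1.2 →
        x.1.1 ⊔ y.1.1 ≤ LinearMap.ker ψ → d.1.1 ≤ LinearMap.ker ψ ∧ q ∈ d.1.2 := by
      intro q ψ hq h1 h2
      have hspan : Submodule.span R {q} ≤ x.1.2 := (Submodule.span_singleton_le_iff_mem _ _).2 h1
      have := hd (antiflag q ψ hq) ⟨⟨le_sup_left.trans h2, hspan⟩,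
        ⟨le_sup_right.trans h2, h ▸ hspan⟩⟩
      exact ⟨this.1, (Submodule.span_singleton_le_iff_mem _ _).1 this.2⟩
    constructor
    · refine (hyperplane_eq_of_le x.2.2.1 d.2.2.1 ?_).symm
      by_contra hle
      have hlt : x.1.1 ⊔ y.1.1 < ⊤ := by
        rw [lt_top_iff_ne_top]; intro ht; rw [ht, finrank_top] at hfr; omega
      obtain ⟨ψ, hψ, hψle⟩ := Submodule.exists_le_ker_of_lt_top _ hlt
      obtain ⟨q, hq, h1, h2⟩ := exists_mem_avoiding hle (hnle ψ hψ hψle)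
      exact h1 (mem q ψ h2 hq hψle).2
    · intro u hu
      by_contra hu'
      obtain ⟨ψ, h1, h2, -⟩ := exists_functional_avoiding hu' hu'
      have hψ : ψ ≠ 0 := by rintro rfl; simp at h2
      obtain ⟨q, hq, h3, -⟩ := exists_mem_avoiding (hnle ψ hψ h1) (hnle ψ hψ h1)
      exact h2 ((mem q ψ h3 hq h1).1 hu)
  refine ⟨hne, fun z hz w hw hzw c hc => ?_⟩
  obtain ⟨z1, z2⟩ := key z hz
  obtain ⟨w1, w2⟩ := key w hw
  have hzw2 : z.1.1 ≠ w.1.1 := fun h' => hzw (Subtype.ext (Prod.ext h' (z1.trans w1.symm)))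
  have hfr' := finrank_sup_points z.2.1 w.2.1 hzw2
  have heq : z.1.1 ⊔ w.1.1 = x.1.1 ⊔ y.1.1 :=
    Submodule.eq_of_le_of_finrank_eq (sup_le z2 w2) (by omega)
  have hc1 : x.1.1 ⊔ y.1.1 ≤ c.1.2 := by rw [← heq]; exact sup_le hc.1.1 hc.2.1
  have hc2 : c.1.1 ≤ x.1.2 := by rw [← z1]; exact hc.1.2
  exact ⟨⟨le_sup_left.trans hc1, hc2⟩, ⟨le_sup_right.trans hc1, h ▸ hc2⟩⟩

/-- If neither the points nor the hyperplanes agree, `biperp x y` contains two antiflags with the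
same point, and these do not determine the other point. -/
lemma eq_or_eq_of_adjacent (hV : 3 ≤ finrank R V) {x y : complPairs R V 1}
    (h : Adjacent x y) : x.1.1 = y.1.1 ∨ x.1.2 = y.1.2 := by
  by_contra! hcon
  obtain ⟨hP, hH⟩ := hcon
  have hfr := finrank_inf_hyperplanes x.2.2.1 y.2.2.1 hH
  have hbot : x.1.2 ⊓ y.1.2 ≠ ⊥ := by
    intro hb; rw [hb, finrank_bot] at hfr; omega
  obtain ⟨q, hq, hq0⟩ := Submodule.exists_mem_ne_zero_of_ne_bot hbot
  have hHle : ¬ x.1.2 ≤ y.1.2 := fun hle => hH (hyperplane_eq_of_le x.2.2.1 y.2.2.1 hle)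
  have hPle : ¬ y.1.1 ≤ x.1.1 := fun hle => hP (point_eq_of_le y.2.1 x.2.1 hle).symm
  obtain ⟨v, φ, hφ, rfl⟩ := exists_eq_antiflag x
  obtain ⟨v', φ', hφ', rfl⟩ := exists_eq_antiflag y
  rw [antiflag_fst, antiflag_fst, Submodule.span_singleton_le_iff_mem] at hPle
  -- A third hyperplane of the pencil through `ker φ ⊓ ker φ'` that misses `v`.
  obtain ⟨φ'', h1, h2, h3⟩ : ∃ φ'' : V →ₗ[R] R, φ'' v ≠ 0 ∧
      (∀ p, φ p = 0 → φ' p = 0 → φ'' p = 0) ∧ LinearMap.ker φ ≠ LinearMap.ker φ'' := by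
    by_cases hv : φ' v = 0
    · refine ⟨φ + φ', by simpa [hv] using hφ, fun p h1 h2 => by simp [h1, h2], fun heq => ?_⟩
      apply hHle
      intro p hp
      have hp1 : φ p = 0 := hp
      have hp2 : p ∈ LinearMap.ker (φ + φ') := by rw [← heq]; exact hp
      simpa [hp1] using hp2
    · exact ⟨φ', hv, fun p _ h2 => h2, hH⟩
  obtain ⟨ψ, hψ, hψq, hψv'⟩ := exists_functional_avoiding
    (notMem_span_of_ker hφ hq0 hq.1) hPle
  have hψv : ψ v = 0 := hψ (Submodule.mem_span_singleton_self v)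
  have hx : antiflag v φ hφ ∈ biperp (antiflag v φ hφ) (antiflag v' φ' hφ') :=
    fun c hc => hc.1
  have hw : antiflag v φ'' h1 ∈ biperp (antiflag v φ hφ) (antiflag v' φ' hφ') := by
    intro c hc
    obtain ⟨r, χ, hχ, rfl⟩ := exists_eq_antiflag c
    have e1 := commute₁_antiflag.1 hc.1
    have e2 := commute₁_antiflag.1 hc.2
    exact commute₁_antiflag.2 ⟨e1.1, h2 r e1.2 e2.2⟩
  have hne : antiflag v φ hφ ≠ antiflag v φ'' h1 :=
    fun he => h3 (congrArg (fun a : complPairs R V 1 => a.1.2) he)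
  have := h.2 _ hx _ hw hne (show antiflag q ψ hψq ∈ _ from
    ⟨commute₁_antiflag.2 ⟨hψv, hq.1⟩, commute₁_antiflag.2 ⟨hψv, h2 q hq.1 hq.2⟩⟩)
  exact hψv' (commute₁_antiflag.1 this.2).1

lemma adjacent_iff (hV : 3 ≤ finrank R V) {x y : complPairs R V 1} :
    Adjacent x y ↔ x ≠ y ∧ (x.1.1 = y.1.1 ∨ x.1.2 = y.1.2) :=
  ⟨fun h => ⟨h.1, eq_or_eq_of_adjacent hV h⟩, fun h => h.2.elim
    (adjacent_of_fst_eq hV h.1) (adjacent_of_snd_eq hV h.1)⟩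

end Antiflags

section Antiflags

variable {R V : Type*} [DivisionRing R] [AddCommGroup V] [Module R V]

lemma exists_smul_eq_of_ker_le {φ ψ : V →ₗ[R] R} (hφ : φ ≠ 0)
    (h : LinearMap.ker φ ≤ LinearMap.ker ψ) : ∃ c : Rᵐᵒᵖ, c • φ = ψ := by
  obtain ⟨v, hv⟩ := LinearMap.surjective hφ 1
  refine ⟨MulOpposite.op (ψ v), LinearMap.ext fun x => ?_⟩
  have h1 : x - φ x • v ∈ LinearMap.ker φ := by simp [hv]
  have h2 : ψ (x - φ x • v) = 0 := h h1
  rw [map_sub, map_smul, sub_eq_zero] at h2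
  simp [h2]

lemma mem_span_pair_of_ker_inf_le {φ φ' ψ : V →ₗ[R] R} (hφ : φ ≠ 0)
    (h : LinearMap.ker φ ⊓ LinearMap.ker φ' ≤ LinearMap.ker ψ) :
    ψ ∈ Submodule.span Rᵐᵒᵖ {φ, φ'} := by
  rw [Submodule.mem_span_pair]
  by_cases hle : LinearMap.ker φ ≤ LinearMap.ker φ'
  · obtain ⟨c, hc⟩ := exists_smul_eq_of_ker_le hφ ((le_inf le_rfl hle).trans h)
    exact ⟨c, 0, by simpa using hc⟩
  · obtain ⟨w, hw, hw'⟩ := SetLike.not_le_iff_exists.1 hle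
    have hw0 : φ w = 0 := hw
    have hw1 : φ' w ≠ 0 := hw'
    have hker : LinearMap.ker φ ≤
        LinearMap.ker (ψ - MulOpposite.op ((φ' w)⁻¹ * ψ w) • φ') := by
      intro x hx
      have hx0 : φ x = 0 := hx
      have h1 : x - (φ' x * (φ' w)⁻¹) • w ∈ LinearMap.ker φ ⊓ LinearMap.ker φ' := by
        constructor <;> simp [hx0, hw0, hw1]
      have h2 : ψ (x - (φ' x * (φ' w)⁻¹) • w) = 0 := h h1
      rw [map_sub, map_smul, sub_eq_zero] at h2
      simp [h2, mul_assoc]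
    obtain ⟨c, hc⟩ := exists_smul_eq_of_ker_le hφ hker
    exact ⟨c, _, by rw [hc]; exact sub_add_cancel _ _⟩

lemma mem_span_pair_iff_ker {φ φ' ψ : V →ₗ[R] R} (hφ : φ ≠ 0) :
    ψ ∈ Submodule.span Rᵐᵒᵖ {φ, φ'} ↔
      LinearMap.ker φ ⊓ LinearMap.ker φ' ≤ LinearMap.ker ψ := by
  refine ⟨fun h => ?_, mem_span_pair_of_ker_inf_le hφ⟩
  obtain ⟨a, b, rfl⟩ := Submodule.mem_span_pair.1 h
  rintro x ⟨h1, h2⟩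
  have h1' : φ x = 0 := h1
  have h2' : φ' x = 0 := h2
  simp [h1', h2']

lemma antiflag_ext {x y : complPairs R V 1} (h1 : x.1.1 = y.1.1) (h2 : x.1.2 = y.1.2) : x = y :=
  Subtype.ext (Prod.ext h1 h2)

lemma mem_span_pair_iff_le_sup {P P₁ P₂ : Submodule R V} {u v x : V}
    (hu : Submodule.span R {u} = P₁) (hv : Submodule.span R {v} = P₂)
    (hx : Submodule.span R {x} = P) : x ∈ Submodule.span R {u, v} ↔ P ≤ P₁ ⊔ P₂ := by
  rw [← hx, ← hu, ← hv, Submodule.span_singleton_le_iff_mem, Submodule.span_insert]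

lemma annihilator_span_singleton (φ : V →ₗ[R] R) :
    annihilator (Submodule.span Rᵐᵒᵖ {φ}) = LinearMap.ker φ := by
  ext x
  refine ⟨fun h => h φ (Submodule.mem_span_singleton_self φ), fun h ψ hψ => ?_⟩
  obtain ⟨c, rfl⟩ := Submodule.mem_span_singleton.1 hψ
  have : φ x = 0 := h
  simp [this]

variable [FiniteDimensional R V]

lemma exists_antiflag_of_not_le {P H : Submodule R V} (hP : finrank R P = 1)
    (hH : 1 + finrank R H = finrank R V) (h : ¬ P ≤ H) :
    ∃ d : complPairs R V 1, d.1 = (P, H) := by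
  obtain ⟨v, hv, rfl⟩ := exists_span_eq hP
  obtain ⟨φ, hφ, rfl⟩ := exists_ker_eq hH
  rw [Submodule.span_singleton_le_iff_mem] at h
  exact ⟨antiflag v φ h, rfl⟩

lemma exists_antiflag_fst {P : Submodule R V} (hP : finrank R P = 1) :
    ∃ d : complPairs R V 1, d.1.1 = P := by
  obtain ⟨v, hv, rfl⟩ := exists_span_eq hP
  obtain ⟨φ, h, -⟩ := Submodule.exists_le_ker_of_notMem (p := (⊥ : Submodule R V)) (v := v)
    (by simpa using hv)
  exact ⟨antiflag v φ h, rfl⟩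

lemma exists_antiflag_snd {H : Submodule R V} (hH : 1 + finrank R H = finrank R V) :
    ∃ d : complPairs R V 1, d.1.2 = H := by
  obtain ⟨φ, hφ, rfl⟩ := exists_ker_eq hH
  obtain ⟨v, hv⟩ := LinearMap.surjective hφ 1
  exact ⟨antiflag v φ (by rw [hv]; exact one_ne_zero), rfl⟩

/-- Incidence of a point with a hyperplane, expressed through antiflags. -/
lemma not_fst_le_snd_iff (a c : complPairs R V 1) :
    ¬ a.1.1 ≤ c.1.2 ↔ ∃ d : complPairs R V 1, d.1.1 = a.1.1 ∧ d.1.2 = c.1.2 := by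
  constructor
  · intro h
    obtain ⟨d, hd⟩ := exists_antiflag_of_not_le a.2.1 c.2.2.1 h
    exact ⟨d, by rw [hd], by rw [hd]⟩
  · rintro ⟨d, h1, h2⟩ hle
    rw [← h1, ← h2] at hle
    have h3 := d.2.2.2
    rw [sup_eq_right.2 hle] at h3
    have h4 := d.2.2.1
    rw [h3, finrank_top] at h4
    omega

lemma le_sup_iff_forall_hyperplane {P Q₁ Q₂ : Submodule R V} :
    P ≤ Q₁ ⊔ Q₂ ↔ ∀ c : complPairs R V 1, Q₁ ≤ c.1.2 → Q₂ ≤ c.1.2 → P ≤ c.1.2 := by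
  refine ⟨fun h c h1 h2 => h.trans (sup_le h1 h2), fun h x hx => ?_⟩
  by_contra hxQ
  obtain ⟨φ, h1, h2⟩ := Submodule.exists_le_ker_of_notMem hxQ
  exact h1 (h (antiflag x φ h1) (le_sup_left.trans h2) (le_sup_right.trans h2) hx)

lemma inf_le_iff_forall_point {H H₁ H₂ : Submodule R V} :
    H₁ ⊓ H₂ ≤ H ↔ ∀ c : complPairs R V 1, c.1.1 ≤ H₁ → c.1.1 ≤ H₂ → c.1.1 ≤ H := by
  refine ⟨fun h c h1 h2 => (le_inf h1 h2).trans h, fun h x hx => ?_⟩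
  by_cases hx0 : x = 0
  · rw [hx0]; exact H.zero_mem
  obtain ⟨d, hd⟩ := exists_antiflag_fst (finrank_span_singleton (K := R) hx0)
  have := h d
  rw [hd] at this
  simp only [Submodule.span_singleton_le_iff_mem] at this
  exact this hx.1 hx.2

section

variable {F : complPairs R V 1 ≃ complPairs R V 1}
  (hF : ∀ a c, Commute₁ (F a) (F c) ↔ Commute₁ a c)
include hF

omit [FiniteDimensional R V] in
lemma mem_perp_map_iff {x y c : complPairs R V 1} :
    F c ∈ perp (F x) (F y) ↔ c ∈ perp x y :=
  and_congr (hF _ _) (hF _ _)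

omit [FiniteDimensional R V] in
lemma mem_biperp_map_iff {x y d : complPairs R V 1} :
    F d ∈ biperp (F x) (F y) ↔ d ∈ biperp x y := by
  refine ⟨fun h c hc => (hF _ _).1 (h _ ((mem_perp_map_iff hF).2 hc)), fun h c hc => ?_⟩
  obtain ⟨c, rfl⟩ := F.surjective c
  exact (hF _ _).2 (h c ((mem_perp_map_iff hF).1 hc))

omit [FiniteDimensional R V] in
lemma adjacent_map {x y : complPairs R V 1} (h : Adjacent x y) : Adjacent (F x) (F y) := by
  refine ⟨fun he => h.1 (F.injective he), fun z hz w hw hzw c hc => ?_⟩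
  obtain ⟨z, rfl⟩ := F.surjective z
  obtain ⟨w, rfl⟩ := F.surjective w
  obtain ⟨c, rfl⟩ := F.surjective c
  exact (mem_perp_map_iff hF).2 (h.2 z ((mem_biperp_map_iff hF).1 hz) w
    ((mem_biperp_map_iff hF).1 hw) (fun he => hzw (congrArg F he)) ((mem_perp_map_iff hF).1 hc))

lemma eq_or_eq_map_iff (hV : 3 ≤ finrank R V) {x y : complPairs R V 1} :
    ((F x).1.1 = (F y).1.1 ∨ (F x).1.2 = (F y).1.2) ↔ (x.1.1 = y.1.1 ∨ x.1.2 = y.1.2) := by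
  have main : ∀ G : complPairs R V 1 ≃ complPairs R V 1,
      (∀ a c, Commute₁ (G a) (G c) ↔ Commute₁ a c) → ∀ x y : complPairs R V 1,
      (x.1.1 = y.1.1 ∨ x.1.2 = y.1.2) →
      ((G x).1.1 = (G y).1.1 ∨ (G x).1.2 = (G y).1.2) := by
    intro G hG x y h
    by_cases hxy : x = y
    · rw [hxy]; exact Or.inl rfl
    · exact ((adjacent_iff hV).1 (adjacent_map hG ((adjacent_iff hV).2 ⟨hxy, h⟩))).2
  refine ⟨fun h => ?_, main F hF x y⟩
  have := main F.symm (fun a c => by rw [← hF]; simp) _ _ h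
  simpa using this

/-- The maximal sets of pairwise adjacent antiflags are those with a given point and those with a
given hyperplane. A bijection that preserves commutation permutes these sets, and since a point
set meets a hyperplane set whenever the point is off the hyperplane, it either preserves both
kinds or interchanges them. -/
lemma straight_or_twisted (hV : 3 ≤ finrank R V) :
    (∀ x y : complPairs R V 1, (x.1.1 = y.1.1 ↔ (F x).1.1 = (F y).1.1) ∧
      (x.1.2 = y.1.2 ↔ (F x).1.2 = (F y).1.2)) ∨
    (∀ x y : complPairs R V 1, (x.1.1 = y.1.1 ↔ (F x).1.2 = (F y).1.2) ∧
      (x.1.2 = y.1.2 ↔ (F x).1.1 = (F y).1.1)) := by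
  have E := @eq_or_eq_map_iff R V _ _ _ _ F hF hV
  have inj : ∀ {x y : complPairs R V 1}, (F x).1.1 = (F y).1.1 → (F x).1.2 = (F y).1.2 → x = y :=
    fun h1 h2 => F.injective (antiflag_ext h1 h2)
  -- For each antiflag there is another one with the same point.
  have other : ∀ x : complPairs R V 1, ∃ y : complPairs R V 1, y.1.1 = x.1.1 ∧ y.1.2 ≠ x.1.2 := by
    intro x
    obtain ⟨v, φ, hφ, rfl⟩ := exists_eq_antiflag x
    obtain ⟨w, hw⟩ : ∃ w, w ∉ Submodule.span R {v} := by
      obtain ⟨x, hx⟩ := exists_notMem_span_pair hV v v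
      exact ⟨x, by simpa using hx⟩
    set w' := w - (φ w * (φ v)⁻¹) • v with hw'
    have hw'v : w' ∉ Submodule.span R {v} := by
      intro h
      apply hw
      have := Submodule.add_mem _ h (Submodule.smul_mem _ (φ w * (φ v)⁻¹)
        (Submodule.mem_span_singleton_self v))
      simpa [hw'] using this
    have hφw' : φ w' = 0 := by simp [hw', hφ]
    have hv0 : v ∉ (⊥ : Submodule R V) := by
      rw [Submodule.mem_bot]; rintro rfl; simp at hφ
    have hw0 : w' ∉ (⊥ : Submodule R V) := by
      rw [Submodule.mem_bot]; intro h; exact hw'v (by rw [h]; exact Submodule.zero_mem _)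
    obtain ⟨ψ, -, h1, h2⟩ := exists_functional_avoiding hv0 hw0
    refine ⟨antiflag v ψ h1, rfl, fun h => h2 ?_⟩
    have : w' ∈ LinearMap.ker ψ := by
      have h' : LinearMap.ker ψ = LinearMap.ker φ := h
      rw [h']; exact hφw'
    exact this
  -- Within the set of antiflags at one point, `F` acts in one way only.
  have uni : ∀ x y z : complPairs R V 1, x.1.1 = y.1.1 → x.1.1 = z.1.1 → x ≠ y →
      (F x).1.1 = (F y).1.1 → (F x).1.1 = (F z).1.1 := by
    intro x y z hxy hxz hne h
    by_contra hcon
    have h1 := (E.2 (Or.inl hxz)).resolve_left hcon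
    have h2 := (E.2 (Or.inl (hxy.symm.trans hxz))).resolve_left (fun h' => hcon (h.trans h'))
    exact hne (inj h (h1.trans h2.symm))
  have uni' : ∀ x y z : complPairs R V 1, x.1.1 = y.1.1 → x.1.1 = z.1.1 → x ≠ y →
      (F x).1.2 = (F y).1.2 → (F x).1.2 = (F z).1.2 := by
    intro x y z hxy hxz hne h
    by_contra hcon
    have h1 := (E.2 (Or.inl hxz)).resolve_right hcon
    have h2 := (E.2 (Or.inl (hxy.symm.trans hxz))).resolve_right (fun h' => hcon (h.trans h'))
    exact hne (inj (h1.trans h2.symm) h)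
  -- Two points have a common complement, so the way `F` acts is the same at both.
  have common : ∀ x y : complPairs R V 1, ∃ x' y' : complPairs R V 1,
      x'.1.1 = x.1.1 ∧ y'.1.1 = y.1.1 ∧ x'.1.2 = y'.1.2 := by
    intro x y
    obtain ⟨v, φ, hφ, rfl⟩ := exists_eq_antiflag x
    obtain ⟨w, χ, hχ, rfl⟩ := exists_eq_antiflag y
    have hv0 : v ∉ (⊥ : Submodule R V) := by
      rw [Submodule.mem_bot]; rintro rfl; simp at hφ
    have hw0 : w ∉ (⊥ : Submodule R V) := by
      rw [Submodule.mem_bot]; rintro rfl; simp at hχ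
    obtain ⟨ψ, -, h1, h2⟩ := exists_functional_avoiding hv0 hw0
    exact ⟨antiflag v ψ h1, antiflag w ψ h2, rfl, rfl, rfl⟩
  have mixed : ∀ x x₂ y y₂ : complPairs R V 1, x.1.1 = x₂.1.1 → y.1.1 = y₂.1.1 → x ≠ x₂ →
      y ≠ y₂ → (F x).1.1 = (F x₂).1.1 → (F y).1.2 = (F y₂).1.2 → False := by
    intro x x₂ y y₂ hx hy hxne hyne h1 h2
    obtain ⟨x', y', hx', hy', hxy⟩ := common x y
    by_cases hP : x'.1.1 = y'.1.1
    · have e1 := uni x x₂ y hx (hx'.symm.trans (hP.trans hy')) hxne h1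
      have e2 := uni x x₂ y₂ hx ((hx'.symm.trans (hP.trans hy')).trans hy) hxne h1
      exact hyne (inj (e1.symm.trans e2) h2)
    obtain ⟨x'', hx''1, hx''2⟩ := other x'
    obtain ⟨y'', hy''1, hy''2⟩ := other y'
    have e1 : (F x').1.1 = (F x'').1.1 := (uni x x₂ x' hx hx'.symm hxne h1).symm.trans
      (uni x x₂ x'' hx (hx'.symm.trans hx''1.symm) hxne h1)
    have e2 : (F y').1.2 = (F y'').1.2 := (uni' y y₂ y' hy hy'.symm hyne h2).symm.trans
      (uni' y y₂ y'' hy (hy'.symm.trans hy''1.symm) hyne h2)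
    rcases E.2 (Or.inr hxy) with h | h
    · rcases E.1 (Or.inl (e1.symm.trans h)) with h' | h'
      · exact hP (hx''1.symm.trans h')
      · exact hx''2 (h'.trans hxy.symm)
    · rcases E.1 (Or.inr (h.trans e2)) with h' | h'
      · exact hP (h'.trans hy''1)
      · exact hy''2 (h'.symm.trans hxy)
  by_cases hs : ∃ x x₂ : complPairs R V 1, x ≠ x₂ ∧ x.1.1 = x₂.1.1 ∧ (F x).1.1 = (F x₂).1.1
  · left
    obtain ⟨x₀, x₁, h01, h02, h03⟩ := hs
    have P : ∀ x y : complPairs R V 1, x.1.1 = y.1.1 → (F x).1.1 = (F y).1.1 := by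
      intro x y h
      by_cases hxy : x = y
      · rw [hxy]
      · exact (E.2 (Or.inl h)).resolve_right fun h2 => mixed x₀ x₁ x y h02 h h01 hxy h03 h2
    have Q : ∀ x y : complPairs R V 1, x.1.2 = y.1.2 → (F x).1.2 = (F y).1.2 := by
      intro x y h
      by_cases hxy : x = y
      · rw [hxy]
      refine (E.2 (Or.inr h)).resolve_left fun h1 => ?_
      obtain ⟨z, hz1, hz2⟩ := other x
      rcases E.1 (Or.inl ((P z x hz1).trans h1)) with h' | h'
      · exact hxy (antiflag_ext (hz1.symm.trans h') h)
      · exact hz2 (h'.trans h.symm)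
    refine fun x y => ⟨⟨P x y, fun h => ?_⟩, ⟨Q x y, fun h => ?_⟩⟩
    · rcases E.1 (Or.inl h) with h' | h'
      · exact h'
      · rw [inj h (Q x y h')]
    · rcases E.1 (Or.inr h) with h' | h'
      · rw [inj (P x y h') h]
      · exact h'
  · right
    have P : ∀ x y : complPairs R V 1, x.1.1 = y.1.1 → (F x).1.2 = (F y).1.2 := by
      intro x y h
      by_cases hxy : x = y
      · rw [hxy]
      · exact (E.2 (Or.inl h)).resolve_left fun h1 => hs ⟨x, y, hxy, h, h1⟩
    have Q : ∀ x y : complPairs R V 1, x.1.2 = y.1.2 → (F x).1.1 = (F y).1.1 := by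
      intro x y h
      by_cases hxy : x = y
      · rw [hxy]
      refine (E.2 (Or.inr h)).resolve_right fun h1 => ?_
      obtain ⟨z, hz1, hz2⟩ := other x
      rcases E.1 (Or.inr ((P z x hz1).trans h1)) with h' | h'
      · exact hxy (antiflag_ext (hz1.symm.trans h') h)
      · exact hz2 (h'.trans h.symm)
    refine fun x y => ⟨⟨P x y, fun h => ?_⟩, ⟨Q x y, fun h => ?_⟩⟩
    · rcases E.1 (Or.inr h) with h' | h'
      · exact h'
      · rw [inj (Q x y h') h]
    · rcases E.1 (Or.inl h) with h' | h'
      · rw [inj h (P x y h')]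
      · exact h'

end

lemma exists_semilinear_of_straight (hV : 3 ≤ finrank R V)
    {F : complPairs R V 1 ≃ complPairs R V 1}
    (hF : ∀ x y : complPairs R V 1, (x.1.1 = y.1.1 ↔ (F x).1.1 = (F y).1.1) ∧
      (x.1.2 = y.1.2 ↔ (F x).1.2 = (F y).1.2)) :
    ∃ (σ : R ≃+* R) (l : V →ₛₗ[(σ : R →+* R)] V), Function.Bijective l ∧
      ∀ a : complPairs R V 1, (F a).1.1 = a.1.1.map l := by
  have inc : ∀ a c : complPairs R V 1, a.1.1 ≤ c.1.2 ↔ (F a).1.1 ≤ (F c).1.2 := by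
    intro a c
    rw [← not_iff_not, not_fst_le_snd_iff, not_fst_le_snd_iff]
    exact (exists_congr fun d => and_congr (hF d a).1 (hF d c).2).trans
      ⟨fun ⟨d, h⟩ => ⟨F d, h⟩, fun ⟨d, h⟩ => ⟨F.symm d, by rwa [F.apply_symm_apply]⟩⟩
  have G : ∀ v : V, ∃ w : V, v ≠ 0 → w ≠ 0 ∧ ∀ a : complPairs R V 1,
      a.1.1 = Submodule.span R {v} → Submodule.span R {w} = (F a).1.1 := by
    intro v
    by_cases hv : v = 0
    · exact ⟨0, fun h => absurd hv h⟩
    obtain ⟨a, ha⟩ := exists_antiflag_fst (finrank_span_singleton (K := R) hv)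
    obtain ⟨w, hw, hw'⟩ := exists_span_eq (F a).2.1
    exact ⟨w, fun _ => ⟨hw, fun b hb => hw'.trans ((hF a b).1.1 (ha.trans hb.symm))⟩⟩
  choose g hg using G
  have hcol : IsCollineation R R g := by
    refine ⟨fun v hv => (hg v hv).1, fun u v x hu hv hx => ?_, fun w hw => ?_⟩
    · obtain ⟨a, ha⟩ := exists_antiflag_fst (finrank_span_singleton (K := R) hu)
      obtain ⟨b, hb⟩ := exists_antiflag_fst (finrank_span_singleton (K := R) hv)
      obtain ⟨c, hc⟩ := exists_antiflag_fst (finrank_span_singleton (K := R) hx)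
      rw [mem_span_pair_iff_le_sup ha.symm hb.symm hc.symm,
        mem_span_pair_iff_le_sup ((hg u hu).2 a ha) ((hg v hv).2 b hb) ((hg x hx).2 c hc),
        le_sup_iff_forall_hyperplane, le_sup_iff_forall_hyperplane]
      exact (forall_congr' fun d => by rw [inc a d, inc b d, inc c d]).trans
        F.surjective.forall.symm
    · obtain ⟨b, hb⟩ := exists_antiflag_fst (finrank_span_singleton (K := R) hw)
      obtain ⟨a, rfl⟩ := F.surjective b
      obtain ⟨v, hv, hv'⟩ := exists_span_eq a.2.1
      refine ⟨v, hv, ?_⟩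
      rw [(hg v hv).2 a hv'.symm, hb]
      exact Submodule.mem_span_singleton_self w
  obtain ⟨σ, l, hl, hrep⟩ := hcol.exists_semilinear hV
  refine ⟨σ, l, hl, fun a => ?_⟩
  obtain ⟨v, hv, hv'⟩ := exists_span_eq a.2.1
  rw [← (hg v hv).2 a hv'.symm, ← hv', Submodule.map_span, Set.image_singleton,
    (hrep v hv).span_eq]

lemma exists_semilinear_dual_of_twisted (hV : 3 ≤ finrank R V)
    {F : complPairs R V 1 ≃ complPairs R V 1}
    (hF : ∀ x y : complPairs R V 1, (x.1.1 = y.1.1 ↔ (F x).1.2 = (F y).1.2) ∧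
      (x.1.2 = y.1.2 ↔ (F x).1.1 = (F y).1.1)) :
    ∃ (σ : R ≃+* Rᵐᵒᵖ) (s : V →ₛₗ[(σ : R →+* Rᵐᵒᵖ)] (V →ₗ[R] R)), Function.Bijective s ∧
      ∀ a : complPairs R V 1, (F a).1.2 = annihilator (a.1.1.map s) := by
  have inc : ∀ a c : complPairs R V 1, a.1.1 ≤ c.1.2 ↔ (F c).1.1 ≤ (F a).1.2 := by
    intro a c
    rw [← not_iff_not, not_fst_le_snd_iff, not_fst_le_snd_iff]
    exact (exists_congr fun d => (and_congr (hF d a).1 (hF d c).2).trans and_comm).trans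
      ⟨fun ⟨d, h⟩ => ⟨F d, h⟩, fun ⟨d, h⟩ => ⟨F.symm d, by rwa [F.apply_symm_apply]⟩⟩
  have G : ∀ v : V, ∃ φ : V →ₗ[R] R, v ≠ 0 → φ ≠ 0 ∧ ∀ a : complPairs R V 1,
      a.1.1 = Submodule.span R {v} → LinearMap.ker φ = (F a).1.2 := by
    intro v
    by_cases hv : v = 0
    · exact ⟨0, fun h => absurd hv h⟩
    obtain ⟨a, ha⟩ := exists_antiflag_fst (finrank_span_singleton (K := R) hv)
    obtain ⟨w, hw, hw'⟩ := exists_ker_eq (F a).2.2.1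
    exact ⟨w, fun _ => ⟨hw, fun b hb => hw'.trans ((hF a b).1.1 (ha.trans hb.symm))⟩⟩
  choose g hg using G
  have hcol : IsCollineation R Rᵐᵒᵖ g := by
    refine ⟨fun v hv => (hg v hv).1, fun u v x hu hv hx => ?_, fun w hw => ?_⟩
    · obtain ⟨a, ha⟩ := exists_antiflag_fst (finrank_span_singleton (K := R) hu)
      obtain ⟨b, hb⟩ := exists_antiflag_fst (finrank_span_singleton (K := R) hv)
      obtain ⟨c, hc⟩ := exists_antiflag_fst (finrank_span_singleton (K := R) hx)
      rw [mem_span_pair_iff_le_sup ha.symm hb.symm hc.symm,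
        mem_span_pair_iff_ker (hg u hu).1, (hg u hu).2 a ha, (hg v hv).2 b hb,
        (hg x hx).2 c hc, le_sup_iff_forall_hyperplane, inf_le_iff_forall_point]
      exact (forall_congr' fun d => by rw [inc a d, inc b d, inc c d]).trans
        F.surjective.forall.symm
    · obtain ⟨b, hb⟩ := exists_antiflag_snd (finrank_ker_add_one hw)
      obtain ⟨a, rfl⟩ := F.surjective b
      obtain ⟨v, hv, hv'⟩ := exists_span_eq a.2.1
      refine ⟨v, hv, ?_⟩
      have hk : LinearMap.ker (g v) ≤ LinearMap.ker w := by
        rw [(hg v hv).2 a hv'.symm, hb]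
      obtain ⟨c, hc⟩ := exists_smul_eq_of_ker_le (hg v hv).1 hk
      exact Submodule.mem_span_singleton.2 ⟨c, hc⟩
  obtain ⟨σ, s, hs, hrep⟩ := hcol.exists_semilinear hV
  refine ⟨σ, s, hs, fun a => ?_⟩
  obtain ⟨v, hv, hv'⟩ := exists_span_eq a.2.1
  rw [← (hg v hv).2 a hv'.symm, ← hv', Submodule.map_span, Set.image_singleton,
    (hrep v hv).span_eq, annihilator_span_singleton]

end Antiflags

/-! ### Coordinate subspaces of a basis -/

section Coordinates

variable {R V ι : Type*} [DivisionRing R] [AddCommGroup V] [Module R V]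

/-- The subspace spanned by the vectors of the basis `b` with index in `K`. -/
def coordSpan (b : Basis ι R V) (K : Finset ι) : Submodule R V :=
  Submodule.span R (b '' (K : Set ι))

lemma mem_coordSpan {b : Basis ι R V} {K : Finset ι} {v : V} :
    v ∈ coordSpan b K ↔ ∀ i, i ∉ K → b.repr v i = 0 := by
  rw [coordSpan, b.mem_span_image]
  refine ⟨fun h i hi => ?_, fun h i hi => ?_⟩
  · by_contra h0
    exact hi (h (Finsupp.mem_support_iff.2 h0))
  · by_contra h0
    exact (Finsupp.mem_support_iff.1 hi) (h i h0)

lemma basis_mem_coordSpan {b : Basis ι R V} {K : Finset ι} {i : ι} :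
    b i ∈ coordSpan b K ↔ i ∈ K := by
  classical
  rw [mem_coordSpan]
  refine ⟨fun h => ?_, fun h j hj => ?_⟩
  · by_contra hi
    simpa using h i hi
  · rw [b.repr_self, Finsupp.single_apply, if_neg]
    rintro rfl; exact hj h

lemma coordSpan_le_iff {b : Basis ι R V} {K : Finset ι} {S : Submodule R V} :
    coordSpan b K ≤ S ↔ ∀ i ∈ K, b i ∈ S := by
  rw [coordSpan, Submodule.span_le, Set.image_subset_iff]
  exact Iff.rfl

lemma coordSpan_singleton (b : Basis ι R V) (i : ι) :
    coordSpan b {i} = Submodule.span R {b i} := by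
  rw [coordSpan, Finset.coe_singleton, Set.image_singleton]

lemma coordSpan_le_coordSpan_iff {b : Basis ι R V} {K L : Finset ι} :
    coordSpan b K ≤ coordSpan b L ↔ K ⊆ L := by
  rw [coordSpan_le_iff]
  exact forall₂_congr fun i _ => basis_mem_coordSpan

lemma coordSpan_injective (b : Basis ι R V) : Function.Injective (coordSpan b) := fun _ _ h =>
  Finset.Subset.antisymm (coordSpan_le_coordSpan_iff.1 h.le) (coordSpan_le_coordSpan_iff.1 h.ge)

lemma finrank_coordSpan (b : Basis ι R V) (K : Finset ι) : finrank R (coordSpan b K) = K.card := by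
  classical
  have h : LinearIndependent R (fun i : (K : Set ι) => b i) :=
    b.linearIndependent.comp _ Subtype.val_injective
  have h2 := finrank_span_eq_card h
  rw [coordSpan, Set.image_eq_range, h2]
  simp

variable [DecidableEq ι]

lemma coordSpan_inter (b : Basis ι R V) (K L : Finset ι) :
    coordSpan b (K ∩ L) = coordSpan b K ⊓ coordSpan b L := by
  ext v
  simp only [Submodule.mem_inf, mem_coordSpan, Finset.mem_inter, not_and_or]
  exact ⟨fun h => ⟨fun i hi => h i (Or.inl hi), fun i hi => h i (Or.inr hi)⟩,
    fun h i hi => hi.elim (h.1 i) (h.2 i)⟩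

lemma coordSpan_union (b : Basis ι R V) (K L : Finset ι) :
    coordSpan b (K ∪ L) = coordSpan b K ⊔ coordSpan b L := by
  rw [coordSpan, Finset.coe_union, Set.image_union, Submodule.span_union]; rfl

variable [Fintype ι]

omit [DecidableEq ι] in
lemma coordSpan_univ (b : Basis ι R V) : coordSpan b Finset.univ = ⊤ := by
  rw [coordSpan, Finset.coe_univ, Set.image_univ, b.span_eq]

/-- The pair of complementary coordinate subspaces given by a set of indices. -/
def coordPair (b : Basis ι R V) (K : Finset ι) : Submodule R V × Submodule R V :=
  (coordSpan b K, coordSpan b Kᶜ)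

lemma coordPair_injective (b : Basis ι R V) : Function.Injective (coordPair b) :=
  fun _ _ h => coordSpan_injective b (congrArg Prod.fst h)

lemma coordPair_mem (b : Basis ι R V) {K : Finset ι} :
    coordPair b K ∈ complPairs R V K.card := by
  refine ⟨finrank_coordSpan b K, ?_, ?_⟩
  · show K.card + finrank R (coordSpan b Kᶜ) = _
    rw [finrank_coordSpan, Finset.card_add_card_compl, finrank_eq_card_basis b]
  · show coordSpan b K ⊔ coordSpan b Kᶜ = ⊤
    rw [← coordSpan_union, Finset.union_compl, coordSpan_univ]

lemma exists_eq_coordPair (b : Basis ι R V) {K : Finset ι} {k : ℕ} (hK : K.card = k) :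
    ∃ x : complPairs R V k, x.1 = coordPair b K := by
  subst hK
  exact ⟨⟨_, coordPair_mem b⟩, rfl⟩

lemma card_of_eq_coordPair {b : Basis ι R V} {K : Finset ι} {k : ℕ} {x : complPairs R V k}
    (hx : x.1 = coordPair b K) : K.card = k := by
  rw [← finrank_coordSpan b K, ← x.2.1, hx]; rfl

lemma coordPair_compl {ι' : Type*} [DecidableEq ι'] [Fintype ι'] {b : Basis ι R V}
    {b' : Basis ι' R V} {K : Finset ι} {K' : Finset ι'} (h : coordPair b K = coordPair b' K') :
    coordPair b Kᶜ = coordPair b' K'ᶜ := by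
  have h1 := congrArg Prod.fst h
  have h2 := congrArg Prod.snd h
  simp only [coordPair] at h1 h2 ⊢
  rw [h2, compl_compl, compl_compl, h1]

lemma coordPair_inter {ι' : Type*} [DecidableEq ι'] [Fintype ι'] {b : Basis ι R V}
    {b' : Basis ι' R V} {K L : Finset ι} {K' L' : Finset ι'}
    (hK : coordPair b K = coordPair b' K') (hL : coordPair b L = coordPair b' L') :
    coordPair b (K ∩ L) = coordPair b' (K' ∩ L') := by
  have h1 := congrArg Prod.fst hK
  have h2 := congrArg Prod.snd hK
  have h3 := congrArg Prod.fst hL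
  have h4 := congrArg Prod.snd hL
  simp only [coordPair] at h1 h2 h3 h4 ⊢
  rw [Finset.compl_inter, Finset.compl_inter, coordSpan_inter, coordSpan_inter, coordSpan_union,
    coordSpan_union, h1, h2, h3, h4]

lemma coordPair_union {ι' : Type*} [DecidableEq ι'] [Fintype ι'] {b : Basis ι R V}
    {b' : Basis ι' R V} {K L : Finset ι} {K' L' : Finset ι'}
    (hK : coordPair b K = coordPair b' K') (hL : coordPair b L = coordPair b' L') :
    coordPair b (K ∪ L) = coordPair b' (K' ∪ L') := by
  have := coordPair_compl (coordPair_inter (coordPair_compl hK) (coordPair_compl hL))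
  simpa only [← Finset.compl_union, compl_compl] using this

lemma coordPair_univ {ι' : Type*} [DecidableEq ι'] [Fintype ι'] (b : Basis ι R V)
    (b' : Basis ι' R V) : coordPair b Finset.univ = coordPair b' Finset.univ := by
  simp [coordPair, coordSpan]

/-- A family of index sets that is closed under intersection contains `{i}` if it separates `i` from
every other index. -/
lemma singleton_of_separating {P : Finset ι → Prop} (huniv : P Finset.univ)
    (hinter : ∀ K L, P K → P L → P (K ∩ L)) {i : ι}
    (hsep : ∀ m, m ≠ i → ∃ K, P K ∧ i ∈ K ∧ m ∉ K) : P {i} := by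
  have key : ∀ s : Finset ι, i ∉ s → ∃ K, P K ∧ i ∈ K ∧ Disjoint K s := by
    intro s
    induction s using Finset.induction_on with
    | empty => intro _; exact ⟨_, huniv, Finset.mem_univ i, Finset.disjoint_empty_right _⟩
    | insert m s hm ih =>
      intro hi
      rw [Finset.mem_insert, not_or] at hi
      obtain ⟨K, hK, hiK, hKs⟩ := ih hi.2
      obtain ⟨L, hL, hiL, hmL⟩ := hsep m (Ne.symm hi.1)
      refine ⟨K ∩ L, hinter K L hK hL, Finset.mem_inter.2 ⟨hiK, hiL⟩, ?_⟩
      rw [Finset.disjoint_insert_right]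
      exact ⟨fun h => hmL (Finset.mem_inter.1 h).2, hKs.mono_left Finset.inter_subset_left⟩
  obtain ⟨K, hK, hiK, hd⟩ := key ({i}ᶜ) (by simp)
  have : K = {i} := by
    refine Finset.Subset.antisymm (fun j hj => ?_) (by simpa using hiK)
    by_contra hji
    exact Finset.disjoint_left.1 hd hj (by simpa using hji)
  rwa [← this]

lemma coordPair_eq_of_mem {b d : Basis ι R V} {K : Finset ι}
    (h1 : ∀ i ∈ K, d i ∈ coordSpan b K) (h2 : ∀ i, i ∉ K → d i ∈ coordSpan b Kᶜ) :
    coordPair d K = coordPair b K := by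
  have : FiniteDimensional R V := b.finiteDimensional_of_finite
  have e1 : coordSpan d K = coordSpan b K :=
    Submodule.eq_of_le_of_finrank_eq (coordSpan_le_iff.2 h1) (by simp only [finrank_coordSpan])
  have e2 : coordSpan d Kᶜ = coordSpan b Kᶜ :=
    Submodule.eq_of_le_of_finrank_eq
      (coordSpan_le_iff.2 fun i hi => h2 i (Finset.mem_compl.1 hi))
      (by simp only [finrank_coordSpan])
  rw [coordPair, coordPair, e1, e2]

lemma coordPair_eq_map {b d : Basis ι R V} (π : Equiv.Perm ι)
    (h : ∀ i, Submodule.span R {b i} = Submodule.span R {d (π i)}) (K : Finset ι) :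
    coordPair b K = coordPair d (K.map π.toEmbedding) := by
  have key : ∀ K : Finset ι, coordSpan b K = coordSpan d (K.map π.toEmbedding) := by
    intro K
    apply le_antisymm
    · refine coordSpan_le_iff.2 fun i hi => ?_
      have h1 : b i ∈ Submodule.span R {d (π i)} := by
        rw [← h]; exact Submodule.mem_span_singleton_self _
      rw [← coordSpan_singleton] at h1
      refine coordSpan_le_coordSpan_iff.2 ?_ h1
      simpa using hi
    · refine coordSpan_le_iff.2 fun i hi => ?_
      obtain ⟨j, hj, rfl⟩ := Finset.mem_map.1 hi
      have h1 : d (π j) ∈ Submodule.span R {b j} := by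
        rw [h]; exact Submodule.mem_span_singleton_self _
      rw [← coordSpan_singleton] at h1
      refine coordSpan_le_coordSpan_iff.2 ?_ h1
      simpa using hj
  have hc : (K.map π.toEmbedding)ᶜ = Kᶜ.map π.toEmbedding := by
    ext i; simp [Finset.mem_map_equiv]
  rw [coordPair, coordPair, hc, ← key, ← key]

lemma coordPair_reindex (b : Basis ι R V) (π : Equiv.Perm ι) (K : Finset ι) :
    coordPair (b.reindex π) K = coordPair b (K.map π.symm.toEmbedding) :=
  coordPair_eq_map π.symm (fun i => by rw [Basis.reindex_apply]) K

lemma coordPair_eq_of_span {b d : Basis ι R V}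
    (h : ∀ i, Submodule.span R {b i} = Submodule.span R {d i}) (K : Finset ι) :
    coordPair b K = coordPair d K := by
  have := coordPair_eq_map (Equiv.refl ι) h K
  simpa using this

lemma mem_baseSubset_iff {b : Basis ι R V} {k : ℕ} {x : complPairs R V k} :
    x ∈ baseSubset b k ↔ ∃ K, x.1 = coordPair b K := by
  classical
  constructor
  · rintro ⟨⟨A, hA⟩, ⟨C, hC⟩⟩
    have hA' : x.1.1 = coordSpan b A.toFinset := by rw [hA, coordSpan, Set.coe_toFinset]
    have hC' : x.1.2 = coordSpan b C.toFinset := by rw [hC, coordSpan, Set.coe_toFinset]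
    refine ⟨A.toFinset, Prod.ext hA' ?_⟩
    have h1 := x.2.1
    have h2 := x.2.2.1
    have h3 := x.2.2.2
    rw [hA', finrank_coordSpan] at h1
    rw [hC', finrank_coordSpan, finrank_eq_card_basis b] at h2
    rw [hA', hC', ← coordSpan_union, ← coordSpan_univ b] at h3
    have h4 := coordSpan_injective b h3
    have h5 : A.toFinsetᶜ ⊆ C.toFinset := by
      intro i hi
      have : i ∈ A.toFinset ∪ C.toFinset := by rw [h4]; exact Finset.mem_univ i
      exact (Finset.mem_union.1 this).resolve_left (Finset.mem_compl.1 hi)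
    have h6 := Finset.card_add_card_compl A.toFinset
    rw [hC']
    show _ = coordSpan b _
    rw [Finset.eq_of_subset_of_card_le h5 (by omega)]
  · rintro ⟨K, hK⟩
    exact ⟨⟨K, by rw [hK]; rfl⟩, ⟨(Kᶜ : Finset ι), by rw [hK]; rfl⟩⟩

lemma mem_baseSubset_of_eq {b : Basis ι R V} {k : ℕ} {x : complPairs R V k} {K : Finset ι}
    (h : x.1 = coordPair b K) : x ∈ baseSubset b k := mem_baseSubset_iff.2 ⟨K, h⟩

lemma baseSubset_eq_of_map {b d : Basis ι R V} (π : Equiv.Perm ι)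
    (h : ∀ i, Submodule.span R {b i} = Submodule.span R {d (π i)}) (k : ℕ) :
    baseSubset b k = baseSubset d k := by
  ext x
  rw [mem_baseSubset_iff, mem_baseSubset_iff]
  constructor
  · rintro ⟨K, hK⟩
    exact ⟨_, hK.trans (coordPair_eq_map π h K)⟩
  · rintro ⟨K, hK⟩
    refine ⟨K.map π.symm.toEmbedding, hK.trans ?_⟩
    rw [coordPair_eq_map π h, Finset.map_map]
    congr 1
    ext i; simp

/-- If the common coordinate pairs of two bases separate the index `i` from all others, then the
antiflag of `b` at `i` is an antiflag of `b'`. -/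
lemma exists_coordPair_singleton_eq {b b' : Basis ι R V} {i : ι}
    (hsep : ∀ m, m ≠ i → ∃ K L, coordPair b K = coordPair b' L ∧ ¬ (i ∈ K ↔ m ∈ K)) :
    ∃ j, coordPair b {i} = coordPair b' {j} := by
  have h : ∃ L, coordPair b {i} = coordPair b' L := by
    refine singleton_of_separating (P := fun K => ∃ L, coordPair b K = coordPair b' L)
      ⟨_, coordPair_univ b b'⟩ ?_ ?_
    · rintro K K' ⟨L, h⟩ ⟨L', h'⟩
      exact ⟨_, coordPair_inter h h'⟩
    · intro m hm
      obtain ⟨K, L, h, hs⟩ := hsep m hm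
      by_cases hi : i ∈ K
      · exact ⟨K, ⟨L, h⟩, hi, by tauto⟩
      · exact ⟨Kᶜ, ⟨Lᶜ, coordPair_compl h⟩, by simpa using hi, by simp; tauto⟩
  obtain ⟨L, hL⟩ := h
  have h1 : L.card = 1 := by
    rw [← finrank_coordSpan b' L, ← show coordSpan b {i} = coordSpan b' L from
      congrArg Prod.fst hL, finrank_coordSpan, Finset.card_singleton]
  obtain ⟨j, rfl⟩ := Finset.card_eq_one.1 h1
  exact ⟨j, hL⟩

lemma span_eq_of_coordPair_singleton {b b' : Basis ι R V} {i j : ι}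
    (h : coordPair b {i} = coordPair b' {j}) :
    Submodule.span R {b i} = Submodule.span R {b' j} := by
  rw [← coordSpan_singleton, ← coordSpan_singleton]; exact congrArg Prod.fst h

lemma baseSubset_eq_of_separating {b b' : Basis ι R V} (k : ℕ)
    (hsep : ∀ i m, m ≠ i → ∃ K L, coordPair b K = coordPair b' L ∧ ¬ (i ∈ K ↔ m ∈ K)) :
    baseSubset b k = baseSubset b' k := by
  choose π hπ using fun i => exists_coordPair_singleton_eq (hsep i)
  have hinj : Function.Injective π := by
    intro i j hij
    have := (hπ i).trans ((congrArg (fun m => coordPair b' {m}) hij).trans (hπ j).symm)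
    simpa using coordPair_injective b this
  exact baseSubset_eq_of_map (Equiv.ofBijective π ⟨hinj, Finite.surjective_of_injective hinj⟩)
    (fun i => span_eq_of_coordPair_singleton (hπ i)) k

omit [DecidableEq ι] in
lemma exists_basis_of_span [FiniteDimensional R V] (hι : Fintype.card ι = finrank R V)
    (v : ι → V) (hv : ⊤ ≤ Submodule.span R (Set.range v)) : ∃ d : Basis ι R V, ∀ i, d i = v i :=
  ⟨basisOfTopLeSpanOfCardEqFinrank v hv hι,
    fun i => congrFun (coe_basisOfTopLeSpanOfCardEqFinrank v hv hι) i⟩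

omit [DecidableEq ι] in
lemma exists_basis_of_mem (b : Basis ι R V) (v : ι → V)
    (hv : ∀ i, b i ∈ Submodule.span R (Set.range v)) : ∃ d : Basis ι R V, ∀ i, d i = v i := by
  have : FiniteDimensional R V := b.finiteDimensional_of_finite
  refine exists_basis_of_span (finrank_eq_card_basis b).symm v ?_
  rw [← b.span_eq, Submodule.span_le]
  rintro _ ⟨i, rfl⟩
  exact hv i

lemma exists_elementary (b : Basis ι R V) {i j : ι} (hij : i ≠ j) (c : R) :
    ∃ d : Basis ι R V, d i = b i + c • b j ∧ ∀ l, l ≠ i → d l = b l := by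
  obtain ⟨d, hd⟩ := exists_basis_of_mem b (Function.update b i (b i + c • b j)) (by
    have hmem : ∀ l, l ≠ i → b l ∈ Submodule.span R
        (Set.range (Function.update b i (b i + c • b j))) := fun l hl =>
      Submodule.subset_span ⟨l, by simp [hl]⟩
    intro l
    by_cases hl : l = i
    · subst hl
      have h1 : b l + c • b j ∈ Submodule.span R
          (Set.range (Function.update b l (b l + c • b j))) :=
        Submodule.subset_span ⟨l, by simp⟩
      simpa using Submodule.sub_mem _ h1 (Submodule.smul_mem _ c (hmem j hij.symm))
    · exact hmem l hl)
  exact ⟨d, by simp [hd], fun l hl => by simp [hd, hl]⟩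

lemma coordPair_eq_of_elementary {b d : Basis ι R V} {i j : ι} {c : R}
    (hdi : d i = b i + c • b j) (hd : ∀ l, l ≠ i → d l = b l) {K : Finset ι}
    (hK : i ∈ K ↔ j ∈ K) : coordPair d K = coordPair b K := by
  apply coordPair_eq_of_mem
  · intro l hl
    by_cases hli : l = i
    · subst hli
      rw [hdi]
      exact Submodule.add_mem _ (basis_mem_coordSpan.2 hl)
        (Submodule.smul_mem _ _ (basis_mem_coordSpan.2 (hK.1 hl)))
    · rw [hd l hli]; exact basis_mem_coordSpan.2 hl
  · intro l hl
    by_cases hli : l = i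
    · subst hli
      rw [hdi]
      exact Submodule.add_mem _ (basis_mem_coordSpan.2 (by simpa using hl))
        (Submodule.smul_mem _ _ (basis_mem_coordSpan.2 (by simpa using fun h => hl (hK.2 h))))
    · rw [hd l hli]; exact basis_mem_coordSpan.2 (by simpa using hl)

lemma not_coordPair_eq_of_elementary {b d : Basis ι R V} {i j : ι} {c : R} (hc : c ≠ 0)
    (hij : i ≠ j) (hdi : d i = b i + c • b j) (hd : ∀ l, l ≠ i → d l = b l) {K L : Finset ι}
    (hi : i ∈ K) (hj : j ∉ K) : coordPair d K ≠ coordPair b L := by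
  intro h
  have h1 : coordSpan d K = coordSpan b L := congrArg Prod.fst h
  have h2 : d i ∈ coordSpan b L := by rw [← h1]; exact basis_mem_coordSpan.2 hi
  rw [mem_coordSpan] at h2
  have h3 : j ∈ L := by
    by_contra hjL
    have := h2 j hjL
    rw [hdi] at this
    simp [hij, hc] at this
  have h4 : b j ∈ coordSpan d K := by rw [h1]; exact basis_mem_coordSpan.2 h3
  rw [← hd j hij.symm] at h4
  exact hj (basis_mem_coordSpan.1 h4)

end Coordinates

/-! ### Pairs of indices and the coordinate pairs that do not separate them -/

section Unseparated

variable {ι : Type*} [Fintype ι] [DecidableEq ι]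

/-- Three indices can always be avoided: for `k = 1` take `{l}`, and for `k ≥ 2` the bound
`2 * k < card ι` leaves at least `k` indices outside `s`. -/
lemma exists_card_eq_avoiding {k : ℕ} (hk : 1 ≤ k) (hk2 : 2 * k < Fintype.card ι) {l : ι}
    {s : Finset ι} (hl : l ∉ s) (hs : s.card ≤ 3) :
    ∃ K : Finset ι, l ∈ K ∧ Disjoint K s ∧ K.card = k := by
  have h1 : ({l} : Finset ι) ⊆ sᶜ := by simpa using hl
  have h2 := Finset.card_add_card_compl s
  have h3 := Finset.card_le_card h1
  rw [Finset.card_singleton] at h3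
  obtain ⟨K, hK1, hK2, hK3⟩ := Finset.exists_subsuperset_card_eq h1
    (by rwa [Finset.card_singleton]) (show k ≤ sᶜ.card by omega)
  exact ⟨K, by simpa using hK1, (Finset.subset_compl_iff_disjoint_right.1 hK2), hK3⟩

omit [Fintype ι] in
lemma pair_subset_or_disjoint_iff {i j : ι} {K : Finset ι} :
    (({i, j} : Finset ι) ⊆ K ∨ Disjoint {i, j} K) ↔ (i ∈ K ↔ j ∈ K) := by
  rw [Finset.insert_subset_iff, Finset.singleton_subset_iff, Finset.disjoint_insert_left,
    Finset.disjoint_singleton_left]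
  tauto

variable {R V : Type*} [DivisionRing R] [AddCommGroup V] [Module R V]

/-- The members of the base subset of `b` whose index set `K` does not separate the elements
of `e`. For two-element sets `e` these are the maximal subsets that lie in a second base subset. -/
def unseparated (b : Basis ι R V) (k : ℕ) (e : Finset ι) : Set (complPairs R V k) :=
  {x | ∃ K, x.1 = coordPair b K ∧ (e ⊆ K ∨ Disjoint e K)}

lemma mem_unseparated_iff {b : Basis ι R V} {k : ℕ} {e K : Finset ι} {x : complPairs R V k}
    (hx : x.1 = coordPair b K) : x ∈ unseparated b k e ↔ e ⊆ K ∨ Disjoint e K := by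
  constructor
  · rintro ⟨L, hL, h⟩
    rwa [coordPair_injective b (hx.symm.trans hL)]
  · exact fun h => ⟨K, hx, h⟩

lemma unseparated_subset (b : Basis ι R V) (k : ℕ) (e : Finset ι) :
    unseparated b k e ⊆ baseSubset b k := by
  rintro x ⟨K, hK, -⟩
  exact mem_baseSubset_of_eq hK

lemma exists_inter_subset_unseparated {b b' : Basis ι R V} {k : ℕ}
    (hne : baseSubset b' k ≠ baseSubset b k) :
    ∃ e : Finset ι, e.card = 2 ∧ baseSubset b k ∩ baseSubset b' k ⊆ unseparated b k e := by
  by_contra! hcon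
  refine hne (baseSubset_eq_of_separating k fun i m hm => ?_).symm
  obtain ⟨x, ⟨hx, hx'⟩, hxe⟩ := Set.not_subset.1 (hcon {i, m} (Finset.card_pair hm.symm))
  obtain ⟨K, hK⟩ := mem_baseSubset_iff.1 hx
  obtain ⟨L, hL⟩ := mem_baseSubset_iff.1 hx'
  rw [mem_unseparated_iff hK, pair_subset_or_disjoint_iff] at hxe
  exact ⟨K, L, hK.symm.trans hL, hxe⟩

variable {k : ℕ} (hk : 1 ≤ k) (hk2 : 2 * k < Fintype.card ι)
include hk hk2

lemma elementary_baseSubset {b d : Basis ι R V} {i j : ι} {c : R} (hc : c ≠ 0)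
    (hij : i ≠ j) (hdi : d i = b i + c • b j) (hd : ∀ l, l ≠ i → d l = b l) :
    baseSubset d k ≠ baseSubset b k ∧ unseparated b k {i, j} ⊆ baseSubset d k := by
  constructor
  · intro h
    obtain ⟨K, hiK, hKj, hK⟩ := exists_card_eq_avoiding hk hk2 (l := i) (s := {j})
      (by simpa using hij) (by simp)
    obtain ⟨x, hx⟩ := exists_eq_coordPair d hK
    have : x ∈ baseSubset b k := h ▸ mem_baseSubset_of_eq hx
    obtain ⟨L, hL⟩ := mem_baseSubset_iff.1 this
    exact not_coordPair_eq_of_elementary hc hij hdi hd hiK (by simpa using hKj)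
      (hx.symm.trans hL)
  · rintro x ⟨K, hK, hs⟩
    rw [pair_subset_or_disjoint_iff] at hs
    exact mem_baseSubset_of_eq (hK.trans (coordPair_eq_of_elementary hdi hd hs).symm)

lemma exists_base_of_unseparated (b : Basis ι R V) {e : Finset ι} (he : e.card = 2) :
    ∃ d : Basis ι R V, baseSubset d k ≠ baseSubset b k ∧
      unseparated b k e ⊆ baseSubset d k := by
  obtain ⟨i, j, hij, rfl⟩ := Finset.card_eq_two.1 he
  obtain ⟨d, h1, h2⟩ := exists_elementary b hij 1
  exact ⟨d, elementary_baseSubset hk hk2 one_ne_zero hij h1 h2⟩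

lemma eq_of_unseparated_subset {b : Basis ι R V} {e e' : Finset ι}
    (he : e.card = 2) (he' : e'.card = 2) (h : unseparated b k e ⊆ unseparated b k e') :
    e = e' := by
  by_contra hne
  obtain ⟨i, hi', hi⟩ : ∃ i ∈ e', i ∉ e := by
    by_contra! hcon
    exact hne (Finset.eq_of_subset_of_card_le hcon (by omega)).symm
  obtain ⟨K, hiK, hd, hK⟩ := exists_card_eq_avoiding hk hk2 (l := i) (s := e ∪ e'.erase i)
    (by simp [hi]) ((Finset.card_union_le _ _).trans (by
      rw [Finset.card_erase_of_mem hi']; omega))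
  rw [Finset.disjoint_union_right] at hd
  obtain ⟨x, hx⟩ := exists_eq_coordPair b hK
  have hx1 := h ((mem_unseparated_iff hx).2 (Or.inr hd.1.symm))
  rw [mem_unseparated_iff hx] at hx1
  rcases hx1 with h1 | h1
  · obtain ⟨j, hj⟩ : (e'.erase i).Nonempty := by
      rw [← Finset.card_pos, Finset.card_erase_of_mem hi']; omega
    exact Finset.disjoint_left.1 hd.2 (h1 (Finset.mem_of_mem_erase hj)) hj
  · exact Finset.disjoint_left.1 h1 hi' hiK

/-- Three pairwise intersecting pairs of indices form a triangle, rather than a star, precisely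
when a coordinate pair that does not separate two of them does not separate the third. -/
lemma unseparated_inter_subset_iff {b : Basis ι R V} {e₁ e₂ e₃ : Finset ι}
    (h1 : e₁.card = 2) (h2 : e₂.card = 2) (h3 : e₃.card = 2)
    (h13 : e₁ ≠ e₃) (h23 : e₂ ≠ e₃) (d12 : ¬ Disjoint e₁ e₂)
    (d13 : ¬ Disjoint e₁ e₃) (d23 : ¬ Disjoint e₂ e₃) :
    unseparated b k e₁ ∩ unseparated b k e₂ ⊆ unseparated b k e₃ ↔ e₁ ∩ e₂ ∩ e₃ = ∅ := by
  constructor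
  · intro h
    by_contra hne
    obtain ⟨p, hp⟩ := Finset.nonempty_iff_ne_empty.2 hne
    simp only [Finset.mem_inter] at hp
    obtain ⟨⟨hp1, hp2⟩, hp3⟩ := hp
    obtain ⟨d, hd3, hd1⟩ : ∃ d ∈ e₃, d ∉ e₁ := by
      by_contra! hcon
      exact h13 (Finset.eq_of_subset_of_card_le hcon (by omega)).symm
    have hpd : p ≠ d := fun h => hd1 (h ▸ hp1)
    have he3 : ({p, d} : Finset ι) = e₃ := Finset.eq_of_subset_of_card_le
      (by rw [Finset.insert_subset_iff, Finset.singleton_subset_iff]; exact ⟨hp3, hd3⟩)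
      (by rw [h3, Finset.card_pair hpd])
    have hd2 : d ∉ e₂ := by
      intro hd2
      apply h23
      rw [← he3]
      exact (Finset.eq_of_subset_of_card_le
        (by rw [Finset.insert_subset_iff, Finset.singleton_subset_iff]; exact ⟨hp2, hd2⟩)
        (by rw [h2, Finset.card_pair hpd])).symm
    have hcard : (e₁ ∪ e₂).card ≤ 3 := by
      have h4 := Finset.card_union_add_card_inter e₁ e₂
      have h5 : 0 < (e₁ ∩ e₂).card := Finset.card_pos.2 ⟨p, Finset.mem_inter.2 ⟨hp1, hp2⟩⟩
      omega
    obtain ⟨K, hdK, hK, hKc⟩ := exists_card_eq_avoiding hk hk2 (l := d) (s := e₁ ∪ e₂)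
      (by simp [hd1, hd2]) hcard
    rw [Finset.disjoint_union_right] at hK
    obtain ⟨x, hx⟩ := exists_eq_coordPair b hKc
    have hx3 := h ⟨(mem_unseparated_iff hx).2 (Or.inr hK.1.symm),
      (mem_unseparated_iff hx).2 (Or.inr hK.2.symm)⟩
    rw [mem_unseparated_iff hx] at hx3
    rcases hx3 with h4 | h4
    · exact Finset.disjoint_left.1 hK.1 (h4 hp3) hp1
    · exact Finset.disjoint_left.1 h4 hd3 hdK
  · rintro h x ⟨⟨K, hx, hK1⟩, hx2⟩
    rw [mem_unseparated_iff hx] at hx2 ⊢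
    obtain ⟨p, hp1, hp2⟩ := Finset.not_disjoint_iff.1 d12
    obtain ⟨q, hq1, hq3⟩ := Finset.not_disjoint_iff.1 d13
    obtain ⟨r, hr2, hr3⟩ := Finset.not_disjoint_iff.1 d23
    have hqr : q ≠ r := by
      rintro rfl
      have : q ∈ e₁ ∩ e₂ ∩ e₃ := by simp [hq1, hr2, hq3]
      rw [h] at this; simp at this
    have he3 : ({q, r} : Finset ι) = e₃ := Finset.eq_of_subset_of_card_le
      (by rw [Finset.insert_subset_iff, Finset.singleton_subset_iff]; exact ⟨hq3, hr3⟩)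
      (by rw [h3, Finset.card_pair hqr])
    rw [← he3, pair_subset_or_disjoint_iff]
    rcases hK1 with hK1 | hK1 <;> rcases hx2 with hK2 | hK2
    · exact ⟨fun _ => hK2 hr2, fun _ => hK1 hq1⟩
    · exact absurd (hK1 hp1) (Finset.disjoint_left.1 hK2 hp2)
    · exact absurd (hK2 hp2) (Finset.disjoint_left.1 hK1 hp1)
    · exact ⟨fun hm => absurd hm (Finset.disjoint_left.1 hK1 hq1),
        fun hm => absurd hm (Finset.disjoint_left.1 hK2 hr2)⟩

end Unseparated

/-! ### Triangle-preserving maps on pairs of indices -/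

section Triangles

variable {ι : Type*} [DecidableEq ι]

/-- Three two-element sets that are the sides of a triangle. -/
def IsTriangle (e₁ e₂ e₃ : Finset ι) : Prop :=
  e₁ ≠ e₂ ∧ e₁ ≠ e₃ ∧ e₂ ≠ e₃ ∧ ¬ Disjoint e₁ e₂ ∧ ¬ Disjoint e₁ e₃ ∧ ¬ Disjoint e₂ e₃ ∧
    e₁ ∩ e₂ ∩ e₃ = ∅

lemma isTriangle_pairs {i j l : ι} (hij : i ≠ j) (hil : i ≠ l) (hjl : j ≠ l) :
    IsTriangle ({i, j} : Finset ι) {i, l} {j, l} := by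
  have mem : ∀ {a b c : ι}, c ∈ ({a, b} : Finset ι) ↔ c = a ∨ c = b := by simp
  refine ⟨fun h => ?_, fun h => ?_, fun h => ?_, ?_, ?_, ?_, ?_⟩
  · have : j ∈ ({i, l} : Finset ι) := by rw [← h]; simp
    rcases mem.1 this with h | h
    exacts [hij h.symm, hjl h]
  · have : i ∈ ({j, l} : Finset ι) := by rw [← h]; simp
    rcases mem.1 this with h | h
    exacts [hij h, hil h]
  · have : i ∈ ({j, l} : Finset ι) := by rw [← h]; simp
    rcases mem.1 this with h | h
    exacts [hij h, hil h]
  · exact Finset.not_disjoint_iff.2 ⟨i, by simp, by simp⟩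
  · exact Finset.not_disjoint_iff.2 ⟨j, by simp, by simp⟩
  · exact Finset.not_disjoint_iff.2 ⟨l, by simp, by simp⟩
  · rw [Finset.eq_empty_iff_forall_notMem]
    intro p hp
    simp only [Finset.mem_inter, mem] at hp
    obtain ⟨⟨rfl | rfl, h2⟩, h3⟩ := hp
    · exact h3.elim hij hil
    · exact h2.elim (fun h => hij h.symm) hjl

/-- A map of the two-element sets that preserves triangles both ways comes from a permutation. -/
lemma exists_perm_of_triangles [Fintype ι] (hι : 3 ≤ Fintype.card ι) (φ : Finset ι → Finset ι)
    (hcard : ∀ e, e.card = 2 → (φ e).card = 2)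
    (htri : ∀ e₁ e₂ e₃ : Finset ι, e₁.card = 2 → e₂.card = 2 → e₃.card = 2 →
      (IsTriangle (φ e₁) (φ e₂) (φ e₃) ↔ IsTriangle e₁ e₂ e₃)) :
    ∃ τ : Equiv.Perm ι, ∀ i j, i ≠ j → φ {i, j} = {τ i, τ j} := by
  have third : ∀ i j : ι, ∃ l, l ≠ i ∧ l ≠ j := by
    intro i j
    have h1 : ({i, j} : Finset ι).card < (Finset.univ : Finset ι).card :=
      (Finset.card_le_two).trans_lt (by rw [Finset.card_univ]; omega)
    obtain ⟨l, -, hl⟩ := Finset.exists_mem_notMem_of_card_lt_card h1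
    exact ⟨l, by simpa using hl⟩
  have tri : ∀ {i j l : ι}, i ≠ j → i ≠ l → j ≠ l →
      IsTriangle (φ {i, j}) (φ {i, l}) (φ {j, l}) := fun hij hil hjl =>
    (htri _ _ _ (Finset.card_pair hij) (Finset.card_pair hil) (Finset.card_pair hjl)).2
      (isTriangle_pairs hij hil hjl)
  -- The images of the pairs through `i` have a common element.
  have star : ∀ i, ∃ a, ∀ j, j ≠ i → a ∈ φ {i, j} := by
    intro i
    obtain ⟨j, hj, -⟩ := third i i
    obtain ⟨l, hl, hlj⟩ := third i j
    have t := tri hj.symm hl.symm hlj.symm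
    obtain ⟨a, ha1, ha2⟩ := Finset.not_disjoint_iff.1 t.2.2.2.1
    refine ⟨a, fun m hm => ?_⟩
    by_cases hmj : m = j
    · rw [hmj]; exact ha1
    by_cases hml : m = l
    · rw [hml]; exact ha2
    by_contra ham
    have t1 := tri hj.symm hm.symm (Ne.symm hmj)
    have t2 := tri hl.symm hm.symm (Ne.symm hml)
    have inter : φ {i, j} ∩ φ {i, l} = {a} := by
      refine (Finset.eq_of_subset_of_card_le (s := {a})
        (by simp [ha1, ha2]) ?_).symm
      rw [Finset.card_singleton]
      by_contra hc
      have h1 := hcard _ (Finset.card_pair hj.symm)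
      have h2 := hcard _ (Finset.card_pair hl.symm)
      have e1 := Finset.eq_of_subset_of_card_le
        (Finset.inter_subset_left (s₁ := φ {i, j}) (s₂ := φ {i, l})) (by omega)
      have e2 := Finset.eq_of_subset_of_card_le
        (Finset.inter_subset_right (s₁ := φ {i, j}) (s₂ := φ {i, l})) (by omega)
      exact t.1 (e1.symm.trans e2)
    have ht : IsTriangle (φ {i, j}) (φ {i, l}) (φ {i, m}) :=
      ⟨t.1, t1.1, t2.1, t.2.2.2.1, t1.2.2.2.1, t2.2.2.2.1, by
        rw [inter]; exact Finset.singleton_inter_of_notMem ham⟩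
    rw [htri _ _ _ (Finset.card_pair hj.symm) (Finset.card_pair hl.symm)
      (Finset.card_pair hm.symm)] at ht
    have : i ∈ ({i, j} ∩ {i, l} ∩ {i, m} : Finset ι) := by simp
    rw [ht.2.2.2.2.2.2] at this
    simp at this
  choose τ hτ using star
  have hinj : Function.Injective τ := by
    intro i j hij
    by_contra hne
    obtain ⟨l, hli, hlj⟩ := third i j
    have t := tri hne hli.symm hlj.symm
    have : τ i ∈ φ {i, j} ∩ φ {i, l} ∩ φ {j, l} := by
      simp only [Finset.mem_inter]
      exact ⟨⟨hτ i j (Ne.symm hne), hτ i l hli⟩, hij ▸ hτ j l hlj⟩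
    rw [t.2.2.2.2.2.2] at this
    simp at this
  refine ⟨Equiv.ofBijective τ ⟨hinj, Finite.surjective_of_injective hinj⟩, fun i j hij => ?_⟩
  refine (Finset.eq_of_subset_of_card_le ?_ ?_).symm
  · rw [Finset.insert_subset_iff, Finset.singleton_subset_iff]
    exact ⟨hτ i j hij.symm, by rw [Finset.pair_comm]; exact hτ j i hij⟩
  · rw [hcard _ (Finset.card_pair hij)]
    exact (Finset.card_pair (hinj.ne hij)).ge

end Triangles

/-! ### Disjoint pairs of indices -/

section Decoupled

variable {R V : Type*} [DivisionRing R] [AddCommGroup V] [Module R V]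

/-- Any base subsets that replace `A` and keep `X`, respectively `X'`, contain new elements that
are compatible, i.e. lie in a common base subset. For the sets `unseparated b k e` and
`unseparated b k e'` with `e ≠ e'` this says that `e` and `e'` are disjoint. -/
def Decoupled {k : ℕ} (A X X' : Set (complPairs R V k)) : Prop :=
  ∀ A₁ A₂ : Set (complPairs R V k), IsBaseSubset A₁ → IsBaseSubset A₂ → A₁ ≠ A → A₂ ≠ A →
    X ⊆ A₁ → X' ⊆ A₂ →
    ∃ x ∈ A₁ \ A, ∃ y ∈ A₂ \ A, ∃ A₃ : Set (complPairs R V k), IsBaseSubset A₃ ∧ x ∈ A₃ ∧ y ∈ A₃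

section

variable {ι : Type*} [Fintype ι] [DecidableEq ι]

lemma exists_perm_extending {s : Finset ι} {j : ι → ι} (hj : Set.InjOn j s) :
    ∃ π : Equiv.Perm ι, ∀ i ∈ s, π i = j i := by
  obtain ⟨g, hg⟩ := Finset.exists_equiv_extend_of_card_eq (t := (Finset.univ : Finset ι))
    Finset.card_univ.symm (Finset.subset_univ (Finset.image j s)) hj
  exact ⟨g.trans (Equiv.subtypeUnivEquiv Finset.mem_univ), hg⟩

lemma coordPair_eq_of_disjoint {b d : Basis ι R V} {e : Finset ι}
    (h : ∀ l, l ∉ e → coordPair b {l} = coordPair d {l}) {K : Finset ι} (hK : Disjoint K e) :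
    coordPair b K = coordPair d K := by
  induction K using Finset.induction_on with
  | empty => simpa using coordPair_compl (coordPair_univ b d)
  | insert l K hl ih =>
    rw [Finset.disjoint_insert_left] at hK
    rw [Finset.insert_eq]
    exact coordPair_union (h l hK.1) (ih hK.2)

lemma coordPair_eq_of_not_separating {b d : Basis ι R V} {e : Finset ι}
    (h : ∀ l, l ∉ e → coordPair b {l} = coordPair d {l}) {K : Finset ι}
    (hK : e ⊆ K ∨ Disjoint e K) : coordPair b K = coordPair d K := by
  rcases hK with hK | hK
  · have := coordPair_compl (coordPair_eq_of_disjoint h (K := Kᶜ)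
      (Finset.disjoint_left.2 fun l hl hle => (Finset.mem_compl.1 hl) (hK hle)))
    simpa using this
  · exact coordPair_eq_of_disjoint h hK.symm

variable {k : ℕ} (hk : 1 ≤ k) (hk2 : 2 * k < Fintype.card ι)
include hk hk2

/-- A base subset containing `unseparated b k e` comes from a basis that agrees with `b` off `e`. -/
lemma exists_aligned {b c : Basis ι R V} {e : Finset ι} (he : e.card = 2)
    (h : unseparated b k e ⊆ baseSubset c k) :
    ∃ d : Basis ι R V, baseSubset d k = baseSubset c k ∧ (∀ l, l ∉ e → d l = b l) ∧
      ∀ l, l ∉ e → coordPair b {l} = coordPair d {l} := by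
  have H : ∀ l, ∃ j, l ∉ e → coordPair b {l} = coordPair c {j} := by
    intro l
    by_cases hl : l ∈ e
    · exact ⟨l, fun h => absurd hl h⟩
    obtain ⟨j, hj⟩ : ∃ j, coordPair b {l} = coordPair c {j} := by
      refine exists_coordPair_singleton_eq fun m hm => ?_
      obtain ⟨K, hlK, hK, hKc⟩ := exists_card_eq_avoiding hk hk2 (l := l) (s := insert m e)
        (by simp [hl, hm.symm]) ((Finset.card_insert_le _ _).trans (by omega))
      rw [Finset.disjoint_insert_right] at hK
      obtain ⟨x, hx⟩ := exists_eq_coordPair b hKc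
      obtain ⟨L, hL⟩ := mem_baseSubset_iff.1
        (h ((mem_unseparated_iff hx).2 (Or.inr hK.2.symm)))
      exact ⟨K, L, hx.symm.trans hL, fun h => hK.1 (h.1 hlK)⟩
    exact ⟨j, fun _ => hj⟩
  choose j hj using H
  obtain ⟨π, hπ⟩ := exists_perm_extending (s := eᶜ) (j := j) (by
    intro l hl m hm hlm
    have hl' : l ∉ e := by simpa using hl
    have hm' : m ∉ e := by simpa using hm
    have := (hj l hl').trans ((congrArg (fun i => coordPair c {i}) hlm).trans (hj m hm').symm)
    simpa using coordPair_injective b this)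
  have hbc : ∀ l, l ∉ e → coordPair b {l} = coordPair c {π l} := fun l hl => by
    rw [hπ l (by simpa using hl)]; exact hj l hl
  set v : ι → V := fun l => if l ∈ e then c (π l) else b l with hv
  have hspan : ∀ l, Submodule.span R {v l} = Submodule.span R {c (π l)} := by
    intro l
    by_cases hl : l ∈ e
    · simp [hv, hl]
    · simpa [hv, hl] using span_eq_of_coordPair_singleton (hbc l hl)
  obtain ⟨d, hd⟩ := exists_basis_of_mem (c.reindex π.symm) v (by
    intro l
    rw [Basis.reindex_apply, Equiv.symm_symm]
    have h1 : c (π l) ∈ Submodule.span R {v l} := by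
      rw [hspan]; exact Submodule.mem_span_singleton_self _
    exact Submodule.span_mono (by rintro _ rfl; exact ⟨l, rfl⟩) h1)
  have hdc : ∀ l, Submodule.span R {d l} = Submodule.span R {c (π l)} := fun l => by
    rw [hd, hspan]
  refine ⟨d, baseSubset_eq_of_map π hdc k, fun l hl => by simp [hd, hv, hl], fun l hl => ?_⟩
  rw [hbc l hl, coordPair_eq_map π hdc, Finset.map_singleton]
  rfl

end

/-- The projection onto `coordSpan b K` along the complementary coordinate subspace. -/
noncomputable def coordProj {ι : Type*} [DecidableEq ι] (b : Basis ι R V) (K : Finset ι) :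
    V →ₗ[R] V :=
  b.constr ℕ fun i => if i ∈ K then b i else 0

section

variable {ι : Type*} [Fintype ι] [DecidableEq ι]

omit [Fintype ι] in
lemma coordProj_basis (b : Basis ι R V) (K : Finset ι) (i : ι) :
    coordProj b K (b i) = if i ∈ K then b i else 0 := by
  rw [coordProj, Basis.constr_basis]

omit [Fintype ι] in
lemma coordProj_of_mem {b : Basis ι R V} {K : Finset ι} {v : V} (hv : v ∈ coordSpan b K) :
    coordProj b K v = v := by
  have : coordSpan b K ≤ LinearMap.eqLocus (coordProj b K) LinearMap.id :=
    coordSpan_le_iff.2 fun i hi => by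
      rw [LinearMap.mem_eqLocus, coordProj_basis, if_pos hi]; rfl
  exact this hv

lemma coordProj_of_mem_compl {b : Basis ι R V} {K : Finset ι} {v : V}
    (hv : v ∈ coordSpan b Kᶜ) : coordProj b K v = 0 := by
  have : coordSpan b Kᶜ ≤ LinearMap.ker (coordProj b K) :=
    coordSpan_le_iff.2 fun i hi => by
      rw [LinearMap.mem_ker, coordProj_basis, if_neg (Finset.mem_compl.1 hi)]
  exact this hv

lemma coordProj_eq_of_coordPair_eq {b b' : Basis ι R V} {K L : Finset ι}
    (h : coordPair b K = coordPair b' L) : coordProj b K = coordProj b' L := by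
  refine b.ext fun i => ?_
  rw [coordProj_basis]
  split_ifs with hi
  · rw [coordProj_of_mem]
    rw [← show coordSpan b K = coordSpan b' L from congrArg Prod.fst h]
    exact basis_mem_coordSpan.2 hi
  · rw [coordProj_of_mem_compl]
    rw [← show coordSpan b Kᶜ = coordSpan b' Lᶜ from congrArg Prod.snd h]
    exact basis_mem_coordSpan.2 (Finset.mem_compl.2 hi)

omit [Fintype ι] in
lemma coordProj_comm (b : Basis ι R V) (K L : Finset ι) (v : V) :
    coordProj b K (coordProj b L v) = coordProj b L (coordProj b K v) := by
  have : coordProj b K ∘ₗ coordProj b L = coordProj b L ∘ₗ coordProj b K := by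
    refine b.ext fun i => ?_
    simp only [LinearMap.comp_apply, coordProj_basis]
    split_ifs <;> simp [coordProj_basis, *]
  exact LinearMap.congr_fun this v

/-- Projections that are coordinate for the bases obtained from `b` by adding `b p` to `b q`,
respectively `b q` to `b r`, do not commute if they separate these indices. -/
lemma not_common_of_elementary {b b₁ b₂ d : Basis ι R V} {p q r : ι} (hpq : p ≠ q) (hpr : p ≠ r)
    (hqr : q ≠ r) (h₁q : b₁ q = b q + (1 : R) • b p) (h₁ : ∀ l, l ≠ q → b₁ l = b l)
    (h₂r : b₂ r = b r + (1 : R) • b q) (h₂ : ∀ l, l ≠ r → b₂ l = b l) {K K' L L' : Finset ι}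
    (hK : coordPair b₁ K = coordPair d K') (hL : coordPair b₂ L = coordPair d L')
    (hsK : ¬ (q ∈ K ↔ p ∈ K)) (hsL : ¬ (r ∈ L ↔ q ∈ L)) : False := by
  rw [one_smul] at h₁q h₂r
  have hcomm : coordProj b₁ K (coordProj b₂ L (b r)) = coordProj b₂ L (coordProj b₁ K (b r)) := by
    rw [coordProj_eq_of_coordPair_eq hK, coordProj_eq_of_coordPair_eq hL, coordProj_comm]
  have A1 : coordProj b₁ K (b p) = if p ∈ K then b p else 0 := by
    rw [← h₁ p hpq, coordProj_basis]
  have A3 : coordProj b₁ K (b r) = if r ∈ K then b r else 0 := by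
    rw [← h₁ r hqr.symm, coordProj_basis]
  have A2 : coordProj b₁ K (b q) =
      (if q ∈ K then b q + b p else 0) - if p ∈ K then b p else 0 := by
    have : b q = b₁ q - b p := by rw [h₁q, add_sub_cancel_right]
    conv_lhs => rw [this]
    rw [map_sub, A1, coordProj_basis, h₁q]
  have B2 : coordProj b₂ L (b q) = if q ∈ L then b q else 0 := by
    rw [← h₂ q hqr, coordProj_basis]
  have B3 : coordProj b₂ L (b r) =
      (if r ∈ L then b r + b q else 0) - if q ∈ L then b q else 0 := by
    have : b r = b₂ r - b q := by rw [h₂r, add_sub_cancel_right]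
    conv_lhs => rw [this]
    rw [map_sub, B2, coordProj_basis, h₂r]
  have hrep : b.repr (coordProj b₁ K (coordProj b₂ L (b r))) p =
      b.repr (coordProj b₂ L (coordProj b₁ K (b r))) p := by rw [hcomm]
  by_cases c1 : q ∈ K <;> by_cases c2 : p ∈ K <;> by_cases c3 : r ∈ L <;> by_cases c4 : q ∈ L <;>
    by_cases c5 : r ∈ K <;>
    first
    | (apply hsK; simp only [c1, c2]; done)
    | (apply hsL; simp only [c3, c4]; done)
    | simp [A2, A3, B3, c1, c2, c3, c4, c5, hpq.symm, hpr.symm] at hrep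

end

section

variable {b : Basis (Fin (finrank R V)) R V} {k : ℕ} (hk : 1 ≤ k) (hk2 : 2 * k < finrank R V)
include hk hk2

lemma not_decoupled_of_not_disjoint {e e' : Finset (Fin (finrank R V))} (he : e.card = 2)
    (he' : e'.card = 2) (hne : e ≠ e') (hd : ¬ Disjoint e e') :
    ¬ Decoupled (baseSubset b k) (unseparated b k e) (unseparated b k e') := by
  intro h
  have hk2' : 2 * k < Fintype.card (Fin (finrank R V)) := by simpa using hk2
  obtain ⟨q, hq, hq'⟩ := Finset.not_disjoint_iff.1 hd
  have pair : ∀ s : Finset (Fin (finrank R V)), s.card = 2 → q ∈ s → ∃ p, p ≠ q ∧ s = {q, p} := by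
    intro s hs hqs
    obtain ⟨p, hp⟩ := Finset.card_eq_one.1 (show (s.erase q).card = 1 by
      rw [Finset.card_erase_of_mem hqs, hs])
    have hps : p ∈ s.erase q := by rw [hp]; simp
    exact ⟨p, Finset.ne_of_mem_erase hps, by rw [← hp, Finset.insert_erase hqs]⟩
  obtain ⟨p, hpq, rfl⟩ := pair e he hq
  obtain ⟨r, hrq, rfl⟩ := pair e' he' hq'
  have hpr : p ≠ r := by rintro rfl; exact hne rfl
  obtain ⟨b₁, h₁q, h₁⟩ := exists_elementary b hpq.symm 1
  obtain ⟨b₂, h₂r, h₂⟩ := exists_elementary b hrq 1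
  obtain ⟨n1, s1⟩ := elementary_baseSubset hk hk2' one_ne_zero hpq.symm h₁q h₁
  obtain ⟨n2, s2⟩ := elementary_baseSubset hk hk2' one_ne_zero hrq h₂r h₂
  rw [Finset.pair_comm] at s2
  obtain ⟨x, ⟨hx, hxb⟩, y, ⟨hy, hyb⟩, A₃, ⟨d, rfl⟩, hxd, hyd⟩ :=
    h _ _ ⟨b₁, rfl⟩ ⟨b₂, rfl⟩ n1 n2 s1 s2
  obtain ⟨K, hK⟩ := mem_baseSubset_iff.1 hx
  obtain ⟨L, hL⟩ := mem_baseSubset_iff.1 hy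
  obtain ⟨K', hK'⟩ := mem_baseSubset_iff.1 hxd
  obtain ⟨L', hL'⟩ := mem_baseSubset_iff.1 hyd
  refine not_common_of_elementary hpq hpr hrq.symm h₁q h₁ h₂r h₂ (hK.symm.trans hK')
    (hL.symm.trans hL') (fun hs => hxb ?_) (fun hs => hyb ?_)
  · exact mem_baseSubset_of_eq (hK.trans (coordPair_eq_of_elementary h₁q h₁ hs))
  · exact mem_baseSubset_of_eq (hL.trans (coordPair_eq_of_elementary h₂r h₂ hs))

lemma decoupled_of_disjoint {e e' : Finset (Fin (finrank R V))} (he : e.card = 2)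
    (he' : e'.card = 2) (hd : Disjoint e e') :
    Decoupled (baseSubset b k) (unseparated b k e) (unseparated b k e') := by
  have hk2' : 2 * k < Fintype.card (Fin (finrank R V)) := by simpa using hk2
  rintro A₁ A₂ ⟨c₁, rfl⟩ ⟨c₂, rfl⟩ n1 n2 s1 s2
  obtain ⟨b₁, hb₁, a₁, g₁⟩ := exists_aligned hk hk2' he s1
  obtain ⟨b₂, hb₂, a₂, g₂⟩ := exists_aligned hk hk2' he' s2
  rw [← hb₁] at n1 ⊢
  rw [← hb₂] at n2 ⊢
  have hmem : ∀ l, l ∈ e → l ∉ e' := fun _ hl => Finset.disjoint_left.1 hd hl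
  -- A set of `k - 1` further indices.
  obtain ⟨T, hT, hTc⟩ : ∃ T ⊆ (e ∪ e')ᶜ, T.card = k - 1 := by
    apply Finset.exists_subset_card_eq
    have h1 := Finset.card_add_card_compl (e ∪ e')
    rw [Finset.card_union_of_disjoint hd, Fintype.card_fin] at h1
    have h2 : 4 ≤ finrank R V := by omega
    omega
  have hTe : ∀ l ∈ T, l ∉ e ∧ l ∉ e' := by
    intro l hl
    simpa using hT hl
  obtain ⟨i, hi⟩ : e.Nonempty := by rw [← Finset.card_pos]; omega
  obtain ⟨m, hm⟩ : e'.Nonempty := by rw [← Finset.card_pos]; omega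
  have hiT : i ∉ T := fun h => (hTe i h).1 hi
  have hmT : m ∉ T := fun h => (hTe m h).2 hm
  have hKc : (insert i T).card = k := by rw [Finset.card_insert_of_notMem hiT]; omega
  have hLc : (insert m T).card = k := by rw [Finset.card_insert_of_notMem hmT]; omega
  -- A new base subset that shares with the old one a pair separating the elements of `s` would be
  -- the old one.
  have notBase : ∀ (b' : Basis (Fin (finrank R V)) R V) (s : Finset (Fin (finrank R V))) (j)
      (K : Finset (Fin (finrank R V))), s.card = 2 → j ∈ s → j ∈ K →
      (∀ l ∈ s, l ≠ j → l ∉ K) → (∀ l, l ∉ s → coordPair b {l} = coordPair b' {l}) →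
      baseSubset b' k ≠ baseSubset b k → ∀ x : complPairs R V k, x.1 = coordPair b' K →
      x ∉ baseSubset b k := by
    intro b' s j K hs hjs hjK hsK hbs hne x hx hxb
    obtain ⟨L, hL⟩ := mem_baseSubset_iff.1 hxb
    apply hne
    refine baseSubset_eq_of_separating k fun l l' hl => ?_
    by_cases h1 : l ∈ s
    · by_cases h2 : l' ∈ s
      · refine ⟨K, L, hx.symm.trans hL, ?_⟩
        by_cases h3 : l = j
        · subst h3
          exact fun h => hsK l' h2 hl (h.1 hjK)
        · have h4 : l' = j := by
            by_contra h4
            have h5 : ({l, l', j} : Finset _).card ≤ s.card := Finset.card_le_card (by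
              simp only [Finset.insert_subset_iff, Finset.singleton_subset_iff]
              exact ⟨h1, h2, hjs⟩)
            rw [Finset.card_eq_three.2 ⟨l, l', j, hl.symm, h3, h4, rfl⟩] at h5
            omega
          subst h4
          exact fun h => hsK l h1 h3 (h.2 hjK)
      · refine ⟨{l'}, {l'}, (hbs l' h2).symm, ?_⟩
        simp [hl.symm]
    · refine ⟨{l}, {l}, (hbs l h1).symm, ?_⟩
      simp [hl]
  have sp1 : coordSpan b e = coordSpan b₁ e :=
    congrArg Prod.fst (coordPair_eq_of_not_separating g₁ (Or.inl (Finset.Subset.refl e)))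
  have sp1' : coordSpan b e' = coordSpan b₁ e' :=
    congrArg Prod.fst (coordPair_eq_of_not_separating g₁ (Or.inr hd))
  have sp2 : coordSpan b e = coordSpan b₂ e :=
    congrArg Prod.fst (coordPair_eq_of_not_separating g₂ (Or.inr hd.symm))
  have sp2' : coordSpan b e' = coordSpan b₂ e' :=
    congrArg Prod.fst (coordPair_eq_of_not_separating g₂ (Or.inl (Finset.Subset.refl e')))
  -- The common basis follows `b₁` on `e` and `b₂` elsewhere.
  obtain ⟨d, hdv⟩ := exists_basis_of_mem b (fun l => if l ∈ e then b₁ l else b₂ l) (by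
    intro l
    by_cases h1 : l ∈ e
    · have h2 : b l ∈ coordSpan b₁ e := by rw [← sp1]; exact basis_mem_coordSpan.2 h1
      refine (coordSpan_le_iff.2 fun j hj => ?_) h2
      exact Submodule.subset_span ⟨j, by simp [hj]⟩
    · by_cases h2 : l ∈ e'
      · have h3 : b l ∈ coordSpan b₂ e' := by rw [← sp2']; exact basis_mem_coordSpan.2 h2
        refine (coordSpan_le_iff.2 fun j hj => ?_) h3
        have hje : j ∉ e := fun h => hmem j h hj
        exact Submodule.subset_span ⟨j, by simp [hje]⟩
      · rw [← a₂ l h2]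
        exact Submodule.subset_span ⟨l, by simp [h1]⟩)
  have de : ∀ l, l ∈ e → d l = b₁ l := fun l hl => by simp [hdv, hl]
  have de' : ∀ l, l ∉ e → d l = b₂ l := fun l hl => by simp [hdv, hl]
  have do1 : ∀ l, l ∉ e' → d l = b₁ l := fun l hl => by
    by_cases h : l ∈ e
    · exact de l h
    · rw [de' l h, a₂ l hl, a₁ l h]
  obtain ⟨x, hx⟩ := exists_eq_coordPair b₁ hKc
  obtain ⟨y, hy⟩ := exists_eq_coordPair b₂ hLc
  have hxK : coordPair d (insert i T) = coordPair b₁ (insert i T) := by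
    apply coordPair_eq_of_mem
    · intro l hl
      have hl' : l ∉ e' := by
        rcases Finset.mem_insert.1 hl with rfl | h
        exacts [hmem l hi, (hTe l h).2]
      rw [do1 l hl']
      exact basis_mem_coordSpan.2 hl
    · intro l hl
      by_cases hl' : l ∈ e'
      · have h1 : d l ∈ coordSpan b₁ e' := by
          rw [← sp1', sp2', de' l (fun h => hmem l h hl')]
          exact basis_mem_coordSpan.2 hl'
        refine coordSpan_le_coordSpan_iff.2 (fun j hj => ?_) h1
        rw [Finset.mem_compl, Finset.mem_insert, not_or]
        exact ⟨fun h => hmem i hi (h ▸ hj), fun h => (hTe j h).2 hj⟩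
      · rw [do1 l hl']
        exact basis_mem_coordSpan.2 (Finset.mem_compl.2 hl)
  have hyL : coordPair d (insert m T) = coordPair b₂ (insert m T) := by
    apply coordPair_eq_of_mem
    · intro l hl
      have hl' : l ∉ e := by
        rcases Finset.mem_insert.1 hl with rfl | h
        exacts [fun h => hmem l h hm, (hTe l h).1]
      rw [de' l hl']
      exact basis_mem_coordSpan.2 hl
    · intro l hl
      by_cases hl' : l ∈ e
      · have h1 : d l ∈ coordSpan b₂ e := by
          rw [← sp2, sp1, de l hl']
          exact basis_mem_coordSpan.2 hl'
        refine coordSpan_le_coordSpan_iff.2 (fun j hj => ?_) h1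
        rw [Finset.mem_compl, Finset.mem_insert, not_or]
        exact ⟨fun h => hmem j hj (h ▸ hm), fun h => (hTe j h).1 hj⟩
      · rw [de' l hl']
        exact basis_mem_coordSpan.2 (Finset.mem_compl.2 hl)
  refine ⟨x, ⟨mem_baseSubset_of_eq hx, ?_⟩, y, ⟨mem_baseSubset_of_eq hy, ?_⟩, baseSubset d k,
    ⟨d, rfl⟩, mem_baseSubset_of_eq (hx.trans hxK.symm), mem_baseSubset_of_eq (hy.trans hyL.symm)⟩
  · refine notBase b₁ e i _ he hi (Finset.mem_insert_self _ _) (fun l hl hli => ?_) g₁ n1 x hx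
    rw [Finset.mem_insert, not_or]
    exact ⟨hli, fun h => (hTe l h).1 hl⟩
  · refine notBase b₂ e' m _ he' hm (Finset.mem_insert_self _ _) (fun l hl hli => ?_) g₂ n2 y hy
    rw [Finset.mem_insert, not_or]
    exact ⟨hli, fun h => (hTe l h).2 hl⟩

end

end Decoupled

/-! ### Bijections preserving base subsets act on each base subset by a permutation of indices -/

section Carries

variable {R V : Type*} [DivisionRing R] [AddCommGroup V] [Module R V] {k : ℕ}

lemma isBaseSubset_symm_image {f : complPairs R V k ≃ complPairs R V k}
    (hf : ∀ X : Set (complPairs R V k), IsBaseSubset (f '' X) ↔ IsBaseSubset X)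
    (X : Set (complPairs R V k)) : IsBaseSubset (f.symm '' X) ↔ IsBaseSubset X := by
  rw [← hf, Equiv.image_symm_image]

lemma Decoupled.image {f : complPairs R V k ≃ complPairs R V k}
    (hf : ∀ X : Set (complPairs R V k), IsBaseSubset (f '' X) ↔ IsBaseSubset X)
    {A X X' : Set (complPairs R V k)} (h : Decoupled A X X') :
    Decoupled (f '' A) (f '' X) (f '' X') := by
  intro A₁ A₂ h1 h2 n1 n2 s1 s2
  obtain ⟨x, ⟨hx, hxA⟩, y, ⟨hy, hyA⟩, A₃, h3, hx3, hy3⟩ := h (f.symm '' A₁) (f.symm '' A₂)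
    ((isBaseSubset_symm_image hf _).2 h1) ((isBaseSubset_symm_image hf _).2 h2)
    (fun h => n1 (by rw [← h, Equiv.image_symm_image]))
    (fun h => n2 (by rw [← h, Equiv.image_symm_image]))
    (by simpa using Set.image_mono (f := f.symm) s1)
    (by simpa using Set.image_mono (f := f.symm) s2)
  refine ⟨f x, ⟨?_, fun h => hxA ((f.injective.mem_set_image).1 h)⟩, f y,
    ⟨?_, fun h => hyA ((f.injective.mem_set_image).1 h)⟩, f '' A₃, (hf _).2 h3,
    Set.mem_image_of_mem f hx3, Set.mem_image_of_mem f hy3⟩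
  · obtain ⟨a, ha, rfl⟩ := hx; simpa using ha
  · obtain ⟨a, ha, rfl⟩ := hy; simpa using ha

lemma decoupled_image_iff {f : complPairs R V k ≃ complPairs R V k}
    (hf : ∀ X : Set (complPairs R V k), IsBaseSubset (f '' X) ↔ IsBaseSubset X)
    {A X X' : Set (complPairs R V k)} :
    Decoupled (f '' A) (f '' X) (f '' X') ↔ Decoupled A X X' := by
  refine ⟨fun h => ?_, fun h => h.image hf⟩
  simpa using h.image (f := f.symm) (isBaseSubset_symm_image hf)

/-- The relation of forming a triangle, in terms of base subsets only. -/
def TriangleSets (A X₁ X₂ X₃ : Set (complPairs R V k)) : Prop :=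
  X₁ ≠ X₂ ∧ X₁ ≠ X₃ ∧ X₂ ≠ X₃ ∧ ¬ Decoupled A X₁ X₂ ∧ ¬ Decoupled A X₁ X₃ ∧
    ¬ Decoupled A X₂ X₃ ∧ X₁ ∩ X₂ ⊆ X₃

lemma triangleSets_image_iff {f : complPairs R V k ≃ complPairs R V k}
    (hf : ∀ X : Set (complPairs R V k), IsBaseSubset (f '' X) ↔ IsBaseSubset X)
    {A X₁ X₂ X₃ : Set (complPairs R V k)} :
    TriangleSets (f '' A) (f '' X₁) (f '' X₂) (f '' X₃) ↔ TriangleSets A X₁ X₂ X₃ := by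
  simp only [TriangleSets, decoupled_image_iff hf, ← Set.image_inter f.injective,
    Set.image_subset_image_iff f.injective, Ne, f.injective.image_injective.eq_iff]

/-- `f` carries the basis `b` to the basis `b'` if it sends each coordinate pair of `b` to the
coordinate pair of `b'` with the same index set. -/
def Carries (f : complPairs R V k ≃ complPairs R V k) (b b' : Basis (Fin (finrank R V)) R V) :
    Prop :=
  ∀ (x : complPairs R V k) (K : Finset (Fin (finrank R V))),
    x.1 = coordPair b K → (f x).1 = coordPair b' K

lemma Carries.symm {f : complPairs R V k ≃ complPairs R V k}
    {b b' : Basis (Fin (finrank R V)) R V} (h : Carries f b b') : Carries f.symm b' b := by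
  intro x K hx
  obtain ⟨y, hy⟩ := exists_eq_coordPair b (card_of_eq_coordPair hx)
  have h1 : f y = x := Subtype.ext ((h y K hy).trans hx.symm)
  rw [← h1, Equiv.symm_apply_apply, hy]

variable (hk : 1 ≤ k) (hk2 : 2 * k < finrank R V)
include hk hk2

lemma isTriangle_iff {b : Basis (Fin (finrank R V)) R V} {e₁ e₂ e₃ : Finset (Fin (finrank R V))}
    (h1 : e₁.card = 2) (h2 : e₂.card = 2) (h3 : e₃.card = 2) :
    IsTriangle e₁ e₂ e₃ ↔ TriangleSets (baseSubset b k) (unseparated b k e₁)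
      (unseparated b k e₂) (unseparated b k e₃) := by
  have hk2' : 2 * k < Fintype.card (Fin (finrank R V)) := by simpa using hk2
  have ne_iff : ∀ {e e' : Finset (Fin (finrank R V))}, e.card = 2 → e'.card = 2 →
      (unseparated b k e ≠ unseparated b k e' ↔ e ≠ e') := by
    intro e e' he he'
    exact not_congr ⟨fun h => eq_of_unseparated_subset hk hk2' he he' h.le,
      fun h => congrArg _ h⟩
  have dec_iff : ∀ {e e' : Finset (Fin (finrank R V))}, e.card = 2 → e'.card = 2 → e ≠ e' →
      (¬ Decoupled (baseSubset b k) (unseparated b k e) (unseparated b k e') ↔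
        ¬ Disjoint e e') := by
    intro e e' he he' hne
    exact ⟨fun h hd => h (decoupled_of_disjoint hk hk2 he he' hd),
      not_decoupled_of_not_disjoint hk hk2 he he' hne⟩
  rw [TriangleSets, ne_iff h1 h2, ne_iff h1 h3, ne_iff h2 h3]
  constructor
  · rintro ⟨n12, n13, n23, d12, d13, d23, h⟩
    exact ⟨n12, n13, n23, (dec_iff h1 h2 n12).2 d12, (dec_iff h1 h3 n13).2 d13,
      (dec_iff h2 h3 n23).2 d23,
      (unseparated_inter_subset_iff hk hk2' h1 h2 h3 n13 n23 d12 d13 d23).2 h⟩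
  · rintro ⟨n12, n13, n23, d12, d13, d23, h⟩
    rw [dec_iff h1 h2 n12] at d12
    rw [dec_iff h1 h3 n13] at d13
    rw [dec_iff h2 h3 n23] at d23
    exact ⟨n12, n13, n23, d12, d13, d23,
      (unseparated_inter_subset_iff hk hk2' h1 h2 h3 n13 n23 d12 d13 d23).1 h⟩

lemma exists_image_unseparated_subset {f : complPairs R V k ≃ complPairs R V k}
    (hf : ∀ X : Set (complPairs R V k), IsBaseSubset (f '' X) ↔ IsBaseSubset X)
    {b b' : Basis (Fin (finrank R V)) R V} (hb : f '' baseSubset b k = baseSubset b' k)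
    {e : Finset (Fin (finrank R V))} (he : e.card = 2) :
    ∃ e' : Finset (Fin (finrank R V)), e'.card = 2 ∧
      f '' unseparated b k e ⊆ unseparated b' k e' := by
  have hk2' : 2 * k < Fintype.card (Fin (finrank R V)) := by simpa using hk2
  obtain ⟨d, hd, hsub⟩ := exists_base_of_unseparated hk hk2' b he
  obtain ⟨d', hd'⟩ := (hf (baseSubset d k)).2 ⟨d, rfl⟩
  have hne : baseSubset d' k ≠ baseSubset b' k := by
    rw [← hd', ← hb]
    exact fun h => hd (f.injective.image_injective h)
  obtain ⟨e', he', h⟩ := exists_inter_subset_unseparated hne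
  refine ⟨e', he', Set.Subset.trans (Set.subset_inter ?_ ?_) h⟩
  · rw [← hb]; exact Set.image_mono (unseparated_subset b k e)
  · rw [← hd']; exact Set.image_mono hsub

lemma exists_image_unseparated_eq {f : complPairs R V k ≃ complPairs R V k}
    (hf : ∀ X : Set (complPairs R V k), IsBaseSubset (f '' X) ↔ IsBaseSubset X)
    {b b' : Basis (Fin (finrank R V)) R V} (hb : f '' baseSubset b k = baseSubset b' k)
    {e : Finset (Fin (finrank R V))} (he : e.card = 2) :
    ∃ e' : Finset (Fin (finrank R V)), e'.card = 2 ∧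
      f '' unseparated b k e = unseparated b' k e' := by
  have hk2' : 2 * k < Fintype.card (Fin (finrank R V)) := by simpa using hk2
  obtain ⟨e', he', h⟩ := exists_image_unseparated_subset hk hk2 hf hb he
  have hb' : f.symm '' baseSubset b' k = baseSubset b k := by
    rw [← hb, Equiv.symm_image_image]
  obtain ⟨e'', he'', h'⟩ := exists_image_unseparated_subset hk hk2
    (isBaseSubset_symm_image hf) hb' he'
  have h1 : unseparated b k e ⊆ f.symm '' unseparated b' k e' := by
    simpa using Set.image_mono (f := f.symm) h
  have h2 := eq_of_unseparated_subset hk hk2' he he'' (h1.trans h')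
  subst h2
  refine ⟨e', he', h.antisymm ?_⟩
  simpa using Set.image_mono (f := f) h'

/-- The permutation found from the triangles is absorbed into the order of the image basis. The size
of the index set rules out the complement, which separates the same pairs of indices. -/
theorem exists_carries (hn : 3 ≤ finrank R V) {f : complPairs R V k ≃ complPairs R V k}
    (hf : ∀ X : Set (complPairs R V k), IsBaseSubset (f '' X) ↔ IsBaseSubset X)
    (b : Basis (Fin (finrank R V)) R V) : ∃ b', Carries f b b' := by
  obtain ⟨c, hc⟩ := (hf (baseSubset b k)).2 ⟨b, rfl⟩
  have H : ∀ e : Finset (Fin (finrank R V)), ∃ e' : Finset (Fin (finrank R V)), e.card = 2 →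
      e'.card = 2 ∧ f '' unseparated b k e = unseparated c k e' := by
    intro e
    by_cases he : e.card = 2
    · obtain ⟨e', h⟩ := exists_image_unseparated_eq hk hk2 hf hc he
      exact ⟨e', fun _ => h⟩
    · exact ⟨∅, fun h => absurd h he⟩
  choose φ hφ using H
  obtain ⟨τ, hτ⟩ := exists_perm_of_triangles (by simpa using hn) φ (fun e he => (hφ e he).1)
    (fun e₁ e₂ e₃ h1 h2 h3 => by
      rw [isTriangle_iff hk hk2 (b := c) (hφ _ h1).1 (hφ _ h2).1 (hφ _ h3).1,
        isTriangle_iff hk hk2 (b := b) h1 h2 h3, ← (hφ _ h1).2, ← (hφ _ h2).2, ← (hφ _ h3).2,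
        ← hc, triangleSets_image_iff hf])
  refine ⟨c.reindex τ.symm, fun x K hx => ?_⟩
  have hfx : f x ∈ baseSubset c k := by
    rw [← hc]; exact Set.mem_image_of_mem f (mem_baseSubset_of_eq hx)
  obtain ⟨L, hL⟩ := mem_baseSubset_iff.1 hfx
  have sep : ∀ i j, (i ∈ K ↔ j ∈ K) ↔ (τ i ∈ L ↔ τ j ∈ L) := by
    intro i j
    by_cases hij : i = j
    · subst hij; simp
    rw [← pair_subset_or_disjoint_iff, ← mem_unseparated_iff hx, ← pair_subset_or_disjoint_iff,
      ← mem_unseparated_iff hL, ← hτ i j hij, ← (hφ _ (Finset.card_pair hij)).2,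
      f.injective.mem_set_image]
  have hKc := card_of_eq_coordPair hx
  have hLc := card_of_eq_coordPair hL
  rw [hL, coordPair_reindex, Equiv.symm_symm]
  congr 1
  obtain ⟨i₀, hi₀⟩ : K.Nonempty := by rw [← Finset.card_pos]; omega
  by_cases h0 : τ i₀ ∈ L
  · ext j
    rw [Finset.mem_map_equiv]
    have := sep i₀ (τ.symm j)
    rw [Equiv.apply_symm_apply] at this
    tauto
  · -- Otherwise `L` would correspond to the complement of `K`, which has another size.
    exfalso
    have : L = (K.map τ.toEmbedding)ᶜ := by
      ext j
      rw [Finset.mem_compl, Finset.mem_map_equiv]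
      have := sep i₀ (τ.symm j)
      rw [Equiv.apply_symm_apply] at this
      tauto
    have h1 := Finset.card_add_card_compl (K.map τ.toEmbedding)
    rw [← this, Finset.card_map, Fintype.card_fin] at h1
    omega

end Carries

/-! ### The induced bijection of antiflags -/

section Connected

variable {R V ι : Type*} [DivisionRing R] [AddCommGroup V] [Module R V] [Fintype ι] [DecidableEq ι]

/-- Any two bases with the same antiflag at `i` are connected by rescalings of the basis vectors and
by elementary changes and permutations that do not involve `i`: this is Gaussian elimination. -/
lemma basis_induction {i : ι} {P : Basis ι R V → Prop}
    (hmove : ∀ (b d : Basis ι R V) (l m : ι) (t : R), l ≠ i → m ≠ i → l ≠ m →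
      d l = b l + t • b m → (∀ l', l' ≠ l → d l' = b l') → P b → P d)
    (hperm : ∀ (b : Basis ι R V) (π : Equiv.Perm ι), π i = i → P b → P (b.reindex π))
    (hscale : ∀ b d : Basis ι R V, (∀ l, Submodule.span R {b l} = Submodule.span R {d l}) →
      P b → P d)
    {b c : Basis ι R V} (hbc : coordPair b {i} = coordPair c {i}) (hb : P b) : P c := by
  -- Elementary changes add any combination of the other vectors to `b l`.
  have combine : ∀ (b : Basis ι R V), P b → ∀ (l : ι) (t : ι → R), l ≠ i → ∀ s : Finset ι,
      l ∉ s → i ∉ s → ∃ d : Basis ι R V, P d ∧ d l = b l + ∑ m ∈ s, t m • b m ∧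
        (∀ l', l' ≠ l → d l' = b l') ∧ coordPair d {i} = coordPair b {i} := by
    intro b hb l t hl s
    induction s using Finset.induction_on with
    | empty => exact fun _ _ => ⟨b, hb, by simp, fun _ _ => rfl, rfl⟩
    | insert m s hm ih =>
      intro hls his
      rw [Finset.mem_insert, not_or] at hls his
      obtain ⟨d, hd, hdl, hd', hdi⟩ := ih hls.2 his.2
      obtain ⟨d₁, h1, h2⟩ := exists_elementary d hls.1 (t m)
      refine ⟨d₁, hmove d d₁ l m (t m) hl (Ne.symm his.1) hls.1 h1 h2 hd, ?_,
        fun l' hl' => (h2 l' hl').trans (hd' l' hl'), ?_⟩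
      · rw [h1, hdl, hd' m (Ne.symm hls.1), Finset.sum_insert hm]
        abel
      · rw [← hdi]
        exact coordPair_eq_of_elementary h1 h2 (by simp [hl, Ne.symm his.1])
  have key : ∀ s : Finset ι, i ∉ s → ∃ d : Basis ι R V, P d ∧ coordPair d {i} = coordPair c {i} ∧
      ∀ l ∈ s, d l = c l := by
    intro s
    induction s using Finset.induction_on with
    | empty => exact fun _ => ⟨b, hb, hbc, by simp⟩
    | insert j s hj ih =>
      intro his
      rw [Finset.mem_insert, not_or] at his
      obtain ⟨d, hd, hdi, hds⟩ := ih his.2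
      have hci : d.repr (c j) i = 0 := by
        have h1 : coordSpan d {i}ᶜ = coordSpan c {i}ᶜ := congrArg Prod.snd hdi
        have h2 : c j ∈ coordSpan d {i}ᶜ := by
          rw [h1]; exact basis_mem_coordSpan.2 (by simpa using Ne.symm his.1)
        exact mem_coordSpan.1 h2 i (by simp)
      obtain ⟨l, hls, hl⟩ : ∃ l, l ∉ s ∧ d.repr (c j) l ≠ 0 := by
        by_contra! hcon
        have h1 : c j ∈ coordSpan d s := mem_coordSpan.2 hcon
        have h2 : coordSpan d s ≤ coordSpan c s := coordSpan_le_iff.2 fun m hm => by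
          rw [hds m hm]; exact basis_mem_coordSpan.2 hm
        exact hj (basis_mem_coordSpan.1 (h2 h1))
      have hli : l ≠ i := by rintro rfl; exact hl hci
      set a := d.repr (c j) l with ha
      -- Rescale `d l`, then add the remaining terms of the expansion of `c j`.
      obtain ⟨d₁, hd₁⟩ := exists_basis_of_mem d (Function.update d l (a • d l)) (by
        intro m
        by_cases hm : m = l
        · subst hm
          have h1 : a • d m ∈ Submodule.span R (Set.range (Function.update d m (a • d m))) :=
            Submodule.subset_span ⟨m, by simp⟩
          exact (Submodule.smul_mem_iff _ hl).1 h1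
        · exact Submodule.subset_span ⟨m, by simp [hm]⟩)
      have hd₁l : d₁ l = a • d l := by simp [hd₁]
      have hd₁' : ∀ m, m ≠ l → d₁ m = d m := fun m hm => by simp [hd₁, hm]
      have hspan : ∀ m, Submodule.span R {d m} = Submodule.span R {d₁ m} := by
        intro m
        by_cases hm : m = l
        · subst hm
          rw [hd₁l, Submodule.span_singleton_smul_eq (IsUnit.mk0 a hl)]
        · rw [hd₁' m hm]
      obtain ⟨d₂, hd₂, hd₂l, hd₂', hd₂i⟩ := combine d₁ (hscale d d₁ hspan hd) l
        (fun m => d.repr (c j) m) hli ((Finset.univ.erase l).erase i) (by simp) (by simp)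
      have hcj : d₂ l = c j := by
        rw [hd₂l, hd₁l]
        have h1 : ∑ m ∈ (Finset.univ.erase l).erase i, d.repr (c j) m • d₁ m =
            ∑ m ∈ Finset.univ.erase l, d.repr (c j) m • d m := by
          rw [← Finset.sum_erase_add (Finset.univ.erase l) _
            (Finset.mem_erase.2 ⟨Ne.symm hli, Finset.mem_univ i⟩), hci, zero_smul, add_zero]
          refine Finset.sum_congr rfl fun m hm => ?_
          rw [hd₁' m (Finset.ne_of_mem_erase (Finset.mem_of_mem_erase hm))]
        rw [h1, ha, Finset.add_sum_erase _ (fun m => d.repr (c j) m • d m) (Finset.mem_univ l)]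
        exact d.sum_repr (c j)
      refine ⟨d₂.reindex (Equiv.swap l j), hperm _ _ ?_ hd₂, ?_, ?_⟩
      · exact Equiv.swap_apply_of_ne_of_ne (Ne.symm hli) his.1
      · rw [coordPair_reindex, Finset.map_singleton, Equiv.symm_swap, Equiv.coe_toEmbedding,
          Equiv.swap_apply_of_ne_of_ne (Ne.symm hli) his.1, hd₂i, ← hdi]
        exact (coordPair_eq_of_span hspan {i}).symm
      · intro m hm
        rw [Basis.reindex_apply, Equiv.symm_swap]
        rcases Finset.mem_insert.1 hm with rfl | hms
        · rw [Equiv.swap_apply_right, hcj]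
        · have h1 : m ≠ l := by rintro rfl; exact hls hms
          have h2 : m ≠ j := by rintro rfl; exact hj hms
          rw [Equiv.swap_apply_of_ne_of_ne h1 h2, hd₂' m h1, hd₁' m h1, hds m hms]
  obtain ⟨d, hd, hdi, hdc⟩ := key (Finset.univ.erase i) (by simp)
  refine hscale d c (fun l => ?_) hd
  by_cases hl : l = i
  · subst hl; exact span_eq_of_coordPair_singleton hdi
  · rw [hdc l (by simp [hl])]

end Connected

section AntiflagMap

variable {R V : Type*} [DivisionRing R] [AddCommGroup V] [Module R V] {k : ℕ}

/-- If `f` carries `b` and `c`, then an antiflag shared by `b` and `c` has the same image for both,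
provided that the shared coordinate pairs of type `k` suffice to cut it out. -/
lemma coordPair_singleton_transfer {f : complPairs R V k ≃ complPairs R V k}
    {b b' c c' : Basis (Fin (finrank R V)) R V} (hb : Carries f b b') (hc : Carries f c c')
    {i j : Fin (finrank R V)}
    (hsep : ∀ m, m ≠ i → ∃ K L, i ∈ K ∧ m ∉ K ∧ K.card = k ∧ coordPair b K = coordPair c L)
    (hij : coordPair b {i} = coordPair c {j}) : coordPair b' {i} = coordPair c' {j} := by
  have h : ∃ L, coordPair b {i} = coordPair c L ∧ coordPair b' {i} = coordPair c' L := by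
    refine singleton_of_separating
      (P := fun K => ∃ L, coordPair b K = coordPair c L ∧ coordPair b' K = coordPair c' L)
      ⟨_, coordPair_univ b c, coordPair_univ b' c'⟩ ?_ ?_
    · rintro K K' ⟨L, h1, h2⟩ ⟨L', h1', h2'⟩
      exact ⟨_, coordPair_inter h1 h1', coordPair_inter h2 h2'⟩
    · intro m hm
      obtain ⟨K, L, hi, hmK, hK, hKL⟩ := hsep m hm
      obtain ⟨x, hx⟩ := exists_eq_coordPair b hK
      exact ⟨K, ⟨L, hKL, (hb x K hx).symm.trans (hc x L (hx.trans hKL))⟩, hi, hmK⟩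
  obtain ⟨L, h1, h2⟩ := h
  rw [h2, coordPair_injective c (h1.symm.trans hij)]

section

variable (hk : 1 ≤ k) (hk2 : 2 * k < finrank R V) (hn : 3 ≤ finrank R V)
include hk hk2 hn

/-- The image of an antiflag does not depend on the basis used to compute it. -/
lemma coordPair_singleton_eq_of_carries {f : complPairs R V k ≃ complPairs R V k}
    (hf : ∀ X : Set (complPairs R V k), IsBaseSubset (f '' X) ↔ IsBaseSubset X)
    {b b' c c' : Basis (Fin (finrank R V)) R V} (hb : Carries f b b') (hc : Carries f c c')
    {i j : Fin (finrank R V)} (hij : coordPair b {i} = coordPair c {j}) :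
    coordPair b' {i} = coordPair c' {j} := by
  have hk2' : 2 * k < Fintype.card (Fin (finrank R V)) := by simpa using hk2
  have sep : ∀ i m : Fin (finrank R V), m ≠ i → ∃ K : Finset (Fin (finrank R V)),
      i ∈ K ∧ m ∉ K ∧ K.card = k := by
    intro i m hm
    obtain ⟨K, h1, h2, h3⟩ := exists_card_eq_avoiding hk hk2' (l := i) (s := {m})
      (by simpa using hm.symm) (by simp)
    exact ⟨K, h1, by simpa using h2, h3⟩
  have same : ∀ (d d' e e' : Basis (Fin (finrank R V)) R V) (π : Equiv.Perm _),
      (∀ l, Submodule.span R {d l} = Submodule.span R {e (π l)}) → Carries f d d' →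
      Carries f e e' → ∀ l, coordPair d' {l} = coordPair e' {π l} := by
    intro d d' e e' π h hd he l
    refine coordPair_singleton_transfer hd he (fun m hm => ?_) ?_
    · obtain ⟨K, h1, h2, h3⟩ := sep l m hm
      exact ⟨K, _, h1, h2, h3, coordPair_eq_map π h K⟩
    · rw [coordPair_eq_map π h, Finset.map_singleton]; rfl
  obtain ⟨c₂', hc₂'⟩ := exists_carries hk hk2 hn hf (c.reindex (Equiv.swap i j))
  have e1 := same (c.reindex (Equiv.swap i j)) c₂' c c' (Equiv.swap i j)
    (fun l => by rw [Basis.reindex_apply, Equiv.symm_swap]) hc₂' hc i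
  rw [Equiv.swap_apply_left] at e1
  rw [← e1]
  have hbc : coordPair b {i} = coordPair (c.reindex (Equiv.swap i j)) {i} := by
    rw [coordPair_reindex, Finset.map_singleton, Equiv.symm_swap, Equiv.coe_toEmbedding,
      Equiv.swap_apply_left, hij]
  refine basis_induction (i := i)
    (P := fun d => ∀ d', Carries f d d' → coordPair b' {i} = coordPair d' {i})
    ?_ ?_ ?_ hbc (fun d' hd' => ?_) c₂' hc₂'
  · intro d e l m t hl hm hlm hel he hd e' he'
    obtain ⟨d', hd'⟩ := exists_carries hk hk2 hn hf d
    rw [hd d' hd']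
    refine coordPair_singleton_transfer hd' he' (fun p hp => ?_) ?_
    · obtain ⟨K, h1, h2, h3⟩ := exists_card_eq_avoiding hk hk2' (l := i) (s := {l, m, p})
        (by simp [hl.symm, hm.symm, hp.symm]) Finset.card_le_three
      simp only [Finset.disjoint_insert_right, Finset.disjoint_singleton_right] at h2
      exact ⟨K, K, h1, h2.2.2, h3,
        (coordPair_eq_of_elementary hel he (by simp [h2.1, h2.2.1])).symm⟩
    · exact (coordPair_eq_of_elementary hel he (by simp [hl, hm])).symm
  · intro d π hπ hd e' he'
    obtain ⟨d', hd'⟩ := exists_carries hk hk2 hn hf d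
    rw [hd d' hd', same _ _ _ _ π.symm (fun l => by rw [Basis.reindex_apply]) he' hd' i]
    rw [show π.symm i = i from π.injective (by rw [Equiv.apply_symm_apply, hπ])]
  · intro d e h hd e' he'
    obtain ⟨d', hd'⟩ := exists_carries hk hk2 hn hf d
    rw [hd d' hd', same _ _ _ _ (Equiv.refl _) h hd' he' i]
    rfl
  · exact same _ _ _ _ (Equiv.refl _) (fun _ => rfl) hb hd' i

end

lemma exists_coordPair_eq [FiniteDimensional R V] (x : complPairs R V k) :
    ∃ (b : Basis (Fin (finrank R V)) R V) (K : Finset (Fin (finrank R V))),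
      x.1 = coordPair b K := by
  obtain ⟨h1, h2, h3⟩ := x.2
  have hc : IsCompl x.1.1 x.1.2 := by
    refine ⟨?_, codisjoint_iff.2 h3⟩
    rw [disjoint_iff, ← Submodule.finrank_eq_zero (R := R)]
    have h4 := Submodule.finrank_sup_add_finrank_inf_eq x.1.1 x.1.2
    rw [h3, finrank_top] at h4
    omega
  let B := ((finBasis R x.1.1).prod (finBasis R x.1.2)).map (Submodule.prodEquivOfIsCompl _ _ hc)
  let e : Fin (finrank R x.1.1) ⊕ Fin (finrank R x.1.2) ≃ Fin (finrank R V) :=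
    finSumFinEquiv.trans (finCongr (by omega))
  have hB1 : ∀ i, B (Sum.inl i) = (finBasis R x.1.1 i : V) := fun i => by simp [B]
  have hB2 : ∀ i, B (Sum.inr i) = (finBasis R x.1.2 i : V) := fun i => by simp [B]
  have key : ∀ (S : Submodule R V) (n : ℕ) (v : Basis (Fin n) R S),
      S = Submodule.span R (Set.range fun i => (v i : V)) := by
    intro S n v
    have := congrArg (Submodule.map S.subtype) v.span_eq
    rw [Submodule.map_span, Submodule.map_subtype_top, ← Set.range_comp] at this
    exact this.symm
  have : x ∈ baseSubset (B.reindex e) k := by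
    refine ⟨⟨Set.range (e ∘ Sum.inl), ?_⟩, ⟨Set.range (e ∘ Sum.inr), ?_⟩⟩
    · rw [← Set.range_comp]
      conv_lhs => rw [key _ _ (finBasis R x.1.1)]
      congr 2
      ext i
      simp [hB1]
    · rw [← Set.range_comp]
      conv_lhs => rw [key _ _ (finBasis R x.1.2)]
      congr 2
      ext i
      simp [hB2]
  obtain ⟨K, hK⟩ := mem_baseSubset_iff.1 this
  exact ⟨_, K, hK⟩

variable [FiniteDimensional R V]

lemma exists_coordPair_singleton (a : complPairs R V 1) :
    ∃ (b : Basis (Fin (finrank R V)) R V) (i : Fin (finrank R V)), a.1 = coordPair b {i} := by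
  obtain ⟨b, K, hK⟩ := exists_coordPair_eq a
  obtain ⟨i, rfl⟩ := Finset.card_eq_one.1 (card_of_eq_coordPair hK)
  exact ⟨b, i, hK⟩

/-- Commuting antiflags are members of one frame. -/
lemma Commute₁.exists_basis {a c : complPairs R V 1} (h : Commute₁ a c) :
    ∃ (b : Basis (Fin (finrank R V)) R V) (i j : Fin (finrank R V)), i ≠ j ∧
      a.1 = coordPair b {i} ∧ c.1 = coordPair b {j} := by
  obtain ⟨v, φ, hφ, rfl⟩ := exists_eq_antiflag a
  obtain ⟨w, ψ, hψ, rfl⟩ := exists_eq_antiflag c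
  obtain ⟨hψv, hφw⟩ := commute₁_antiflag.1 h
  have hP : Submodule.span R {v} ≠ Submodule.span R {w} := by
    intro he
    have : v ∈ Submodule.span R {w} := by rw [← he]; exact Submodule.mem_span_singleton_self v
    obtain ⟨r, rfl⟩ := Submodule.mem_span_singleton.1 this
    rw [map_smul, hφw, smul_zero] at hφ
    exact hφ rfl
  have hH : LinearMap.ker φ ≠ LinearMap.ker ψ := by
    intro he
    have : v ∈ LinearMap.ker φ := by rw [he]; exact hψv
    exact hφ this
  have e1 := finrank_sup_points (antiflag v φ hφ).2.1 (antiflag w ψ hψ).2.1 hP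
  have e2 := finrank_inf_hyperplanes (antiflag v φ hφ).2.2.1 (antiflag w ψ hψ).2.2.1 hH
  let x : complPairs R V 2 := ⟨(Submodule.span R {v} ⊔ Submodule.span R {w},
    LinearMap.ker φ ⊓ LinearMap.ker ψ), e1, e2, by
      rw [eq_top_iff]
      intro u _
      refine Submodule.mem_sup.2 ⟨(φ u * (φ v)⁻¹) • v + (ψ u * (ψ w)⁻¹) • w,
        Submodule.add_mem_sup (Submodule.smul_mem _ _ (Submodule.mem_span_singleton_self v))
          (Submodule.smul_mem _ _ (Submodule.mem_span_singleton_self w)),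
        u - ((φ u * (φ v)⁻¹) • v + (ψ u * (ψ w)⁻¹) • w), ?_, by simp⟩
      constructor <;> simp [hφ, hψ, hψv, hφw]⟩
  obtain ⟨b, K, hK⟩ := exists_coordPair_eq x
  obtain ⟨i, j, hij, rfl⟩ := Finset.card_eq_two.1 (card_of_eq_coordPair hK)
  have hx1 : Submodule.span R {v} ⊔ Submodule.span R {w} = coordSpan b {i, j} :=
    congrArg Prod.fst hK
  have hx2 : LinearMap.ker φ ⊓ LinearMap.ker ψ = coordSpan b {i, j}ᶜ := congrArg Prod.snd hK
  have hbl : ∀ l, l ≠ i → l ≠ j → φ (b l) = 0 ∧ ψ (b l) = 0 := by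
    intro l hli hlj
    have : b l ∈ LinearMap.ker φ ⊓ LinearMap.ker ψ := by
      rw [hx2]; exact basis_mem_coordSpan.2 (by simp [hli, hlj])
    exact this
  obtain ⟨d, hd⟩ := exists_basis_of_mem b (fun l => if l = i then v else if l = j then w else b l)
    (by
      intro l
      by_cases hl : l ∈ ({i, j} : Finset (Fin (finrank R V)))
      · have h1 : b l ∈ Submodule.span R {v} ⊔ Submodule.span R {w} := by
          rw [hx1]; exact basis_mem_coordSpan.2 hl
        refine (sup_le ?_ ?_ : Submodule.span R {v} ⊔ Submodule.span R {w} ≤ _) h1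
        · rw [Submodule.span_singleton_le_iff_mem]
          exact Submodule.subset_span ⟨i, by simp⟩
        · rw [Submodule.span_singleton_le_iff_mem]
          exact Submodule.subset_span ⟨j, by simp [hij.symm]⟩
      · simp only [Finset.mem_insert, Finset.mem_singleton, not_or] at hl
        exact Submodule.subset_span ⟨l, by simp [hl.1, hl.2]⟩)
  have hdi : d i = v := by simp [hd]
  have hdj : d j = w := by simp [hd, hij.symm]
  have hdl : ∀ l, l ≠ i → l ≠ j → d l = b l := fun l h1 h2 => by simp [hd, h1, h2]
  have pair : ∀ (a : complPairs R V 1) (m : Fin (finrank R V)),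
      a.1.1 = Submodule.span R {d m} → (∀ l, l ≠ m → d l ∈ a.1.2) → a.1 = coordPair d {m} := by
    intro a m h1 h2
    refine Prod.ext (h1.trans (coordSpan_singleton d m).symm) ?_
    refine (Submodule.eq_of_le_of_finrank_eq (coordSpan_le_iff.2 fun l hl => h2 l (by
      simpa using hl)) ?_).symm
    have h3 := a.2.2.1
    have h4 := Finset.card_add_card_compl ({m} : Finset (Fin (finrank R V)))
    rw [Finset.card_singleton, Fintype.card_fin] at h4
    rw [finrank_coordSpan]
    omega
  refine ⟨d, i, j, hij, pair _ i (by rw [hdi]; rfl) fun l hl => ?_,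
    pair _ j (by rw [hdj]; rfl) fun l hl => ?_⟩
  · by_cases hlj : l = j
    · rw [hlj, hdj]; exact hφw
    · rw [hdl l hl hlj]; exact (hbl l hl hlj).1
  · by_cases hli : l = i
    · rw [hli, hdi]; exact hψv
    · rw [hdl l hli hl]; exact (hbl l hli hl).2

variable (hk : 1 ≤ k) (hk2 : 2 * k < finrank R V) (hn : 3 ≤ finrank R V)
include hk hk2 hn

lemma exists_antiflag_map {f : complPairs R V k ≃ complPairs R V k}
    (hf : ∀ X : Set (complPairs R V k), IsBaseSubset (f '' X) ↔ IsBaseSubset X) :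
    ∃ F : complPairs R V 1 → complPairs R V 1,
      ∀ (b b' : Basis (Fin (finrank R V)) R V) (i : Fin (finrank R V)) (a : complPairs R V 1),
        Carries f b b' → a.1 = coordPair b {i} → (F a).1 = coordPair b' {i} := by
  have H : ∀ a : complPairs R V 1, ∃ a' : complPairs R V 1,
      ∀ (b b' : Basis (Fin (finrank R V)) R V) (i : Fin (finrank R V)),
        Carries f b b' → a.1 = coordPair b {i} → a'.1 = coordPair b' {i} := by
    intro a
    obtain ⟨b, i, ha⟩ := exists_coordPair_singleton a
    obtain ⟨b', hb⟩ := exists_carries hk hk2 hn hf b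
    obtain ⟨a', ha'⟩ := exists_eq_coordPair b' (Finset.card_singleton i)
    refine ⟨a', fun c c' j hc hac => ?_⟩
    rw [ha']
    exact coordPair_singleton_eq_of_carries hk hk2 hn hf hb hc (ha.symm.trans hac)
  choose F hF using H
  exact ⟨F, fun b b' i a => hF a b b' i⟩

/-- The bijection of antiflags induced by `f`, computed in any basis. -/
lemma exists_antiflag_equiv {f : complPairs R V k ≃ complPairs R V k}
    (hf : ∀ X : Set (complPairs R V k), IsBaseSubset (f '' X) ↔ IsBaseSubset X) :
    ∃ F : complPairs R V 1 ≃ complPairs R V 1,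
      (∀ a c, Commute₁ (F a) (F c) ↔ Commute₁ a c) ∧
      ∀ (b b' : Basis (Fin (finrank R V)) R V) (i : Fin (finrank R V)) (a : complPairs R V 1),
        Carries f b b' → a.1 = coordPair b {i} → (F a).1 = coordPair b' {i} := by
  have hf' := isBaseSubset_symm_image hf
  obtain ⟨F, hF⟩ := exists_antiflag_map hk hk2 hn hf
  obtain ⟨G, hG⟩ := exists_antiflag_map hk hk2 hn hf'
  have hGF : ∀ a, G (F a) = a := by
    intro a
    obtain ⟨b, i, ha⟩ := exists_coordPair_singleton a
    obtain ⟨b', hb⟩ := exists_carries hk hk2 hn hf b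
    exact Subtype.ext ((hG b' b i (F a) hb.symm (hF b b' i a hb ha)).trans ha.symm)
  have hFG : ∀ a, F (G a) = a := by
    intro a
    obtain ⟨b, i, ha⟩ := exists_coordPair_singleton a
    obtain ⟨b', hb⟩ := exists_carries hk hk2 hn hf' b
    exact Subtype.ext ((hF b' b i (G a) hb.symm (hG b b' i a hb ha)).trans ha.symm)
  have comm : ∀ (f : complPairs R V k ≃ complPairs R V k)
      (_ : ∀ X : Set (complPairs R V k), IsBaseSubset (f '' X) ↔ IsBaseSubset X)
      (F : complPairs R V 1 → complPairs R V 1),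
      (∀ (b b' : Basis (Fin (finrank R V)) R V) (i : Fin (finrank R V)) (a : complPairs R V 1),
        Carries f b b' → a.1 = coordPair b {i} → (F a).1 = coordPair b' {i}) →
      ∀ a c, Commute₁ a c → Commute₁ (F a) (F c) := by
    intro f hf F hF a c h
    obtain ⟨b, i, j, hij, ha, hc⟩ := h.exists_basis
    obtain ⟨b', hb⟩ := exists_carries hk hk2 hn hf b
    rw [Commute₁, hF b b' i a hb ha, hF b b' j c hb hc]
    exact ⟨coordSpan_le_coordSpan_iff.2 (by simpa using hij.symm),
      coordSpan_le_coordSpan_iff.2 (by simpa using hij)⟩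
  refine ⟨⟨F, G, hGF, hFG⟩, fun a c => ⟨fun h => ?_, comm f hf F hF a c⟩, hF⟩
  have := comm f.symm hf' G hG _ _ h
  simpa only [Equiv.coe_fn_mk, hGF] using this

end AntiflagMap

/-! ### Bijections preserving base subsets -/

section Main

variable {R V : Type*} [DivisionRing R] [AddCommGroup V] [Module R V] {k : ℕ}

lemma coordSpan_eq_iSup {ι : Type*} (b : Basis ι R V) (K : Finset ι) :
    coordSpan b K = ⨆ i ∈ K, coordSpan b {i} := by
  apply le_antisymm
  · refine coordSpan_le_iff.2 fun i hi => ?_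
    exact (le_iSup₂ (f := fun i (_ : i ∈ K) => coordSpan b {i}) i hi)
      (basis_mem_coordSpan.2 (Finset.mem_singleton_self i))
  · exact iSup₂_le fun i hi => coordSpan_le_coordSpan_iff.2 (Finset.singleton_subset_iff.2 hi)

lemma mem_annihilator_map_coordSpan_iff {ι : Type*} {σ : R ≃+* Rᵐᵒᵖ}
    (s : V →ₛₗ[(σ : R →+* Rᵐᵒᵖ)] (V →ₗ[R] R)) (b : Basis ι R V) (K : Finset ι) (v : V) :
    v ∈ annihilator ((coordSpan b K).map s) ↔ ∀ i ∈ K, s (b i) v = 0 := by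
  constructor
  · exact fun h i hi => h _ (Submodule.mem_map_of_mem (basis_mem_coordSpan.2 hi))
  · rintro h _ ⟨u, hu, rfl⟩
    have hle : coordSpan b K ≤ (Submodule.span Rᵐᵒᵖ {φ : V →ₗ[R] R | φ v = 0}).comap s :=
      coordSpan_le_iff.2 fun i hi => Submodule.subset_span (h i hi)
    have hmem : s u ∈ Submodule.span Rᵐᵒᵖ {φ : V →ₗ[R] R | φ v = 0} := hle hu
    generalize s u = φ at hmem ⊢
    induction hmem using Submodule.span_induction with
    | mem φ hφ => exact hφ
    | zero => rfl
    | add φ ψ _ _ h1 h2 => rw [LinearMap.add_apply, h1, h2, add_zero]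
    | smul c φ _ h1 => rw [LinearMap.smul_apply, h1, smul_zero]

section

variable [FiniteDimensional R V] (hn : 3 ≤ finrank R V)
include hn

lemma induced_of_two_mul_lt (hk : 1 ≤ k) (hk2 : 2 * k < finrank R V)
    {f : complPairs R V k ≃ complPairs R V k}
    (hf : ∀ X : Set (complPairs R V k), IsBaseSubset (f '' X) ↔ IsBaseSubset X) :
    InducedBySemilinearAut f ∨ InducedBySemilinearDual f := by
  obtain ⟨F, hcomm, hF⟩ := exists_antiflag_equiv hk hk2 hn hf
  rcases straight_or_twisted hcomm hn with h | h
  · left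
    obtain ⟨σ, l, hl, hFl⟩ := exists_semilinear_of_straight hn h
    refine ⟨σ, l, hl, fun p => ?_⟩
    obtain ⟨b, K, hp⟩ := exists_coordPair_eq p
    obtain ⟨b', hb⟩ := exists_carries hk hk2 hn hf b
    have h1 : ∀ i, coordSpan b' {i} = (coordSpan b {i}).map l := by
      intro i
      obtain ⟨a, ha⟩ := exists_eq_coordPair b (Finset.card_singleton i)
      have h2 := hFl a
      rw [hF b b' i a hb ha, ha] at h2
      exact h2
    have h2 : ∀ L, coordSpan b' L = (coordSpan b L).map l := by
      intro L
      rw [coordSpan_eq_iSup, coordSpan_eq_iSup b L, Submodule.map_iSup]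
      refine iSup_congr fun i => ?_
      rw [Submodule.map_iSup]
      exact iSup_congr fun _ => h1 i
    rw [hb p K hp, hp, coordPair, h2, h2]
    rfl
  · right
    obtain ⟨σ, s, hs, hFs⟩ := exists_semilinear_dual_of_twisted hn h
    refine ⟨σ, s, hs, fun p => ?_⟩
    obtain ⟨b, K, hp⟩ := exists_coordPair_eq p
    obtain ⟨b', hb⟩ := exists_carries hk hk2 hn hf b
    have h1 : ∀ i v, b'.repr v i = 0 ↔ s (b i) v = 0 := by
      intro i v
      obtain ⟨a, ha⟩ := exists_eq_coordPair b (Finset.card_singleton i)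
      have h2 := hFs a
      rw [hF b b' i a hb ha, ha] at h2
      have h3 : v ∈ coordSpan b' {i}ᶜ ↔ v ∈ annihilator ((coordSpan b {i}).map s) := by
        rw [← show coordSpan b' {i}ᶜ = annihilator ((coordSpan b {i}).map s) from h2]
      rw [mem_coordSpan, mem_annihilator_map_coordSpan_iff] at h3
      simpa using h3
    have h2 : ∀ L, coordSpan b' L = annihilator ((coordSpan b Lᶜ).map s) := by
      intro L
      ext v
      rw [mem_coordSpan, mem_annihilator_map_coordSpan_iff]
      exact forall_congr' fun i => by rw [Finset.mem_compl, h1]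
    rw [hb p K hp, hp, coordPair, h2, h2, compl_compl]
    rfl

end

/-- Interchanging the members of a complementary pair. -/
def swapPairs {k' : ℕ} (h : k + k' = finrank R V) : complPairs R V k ≃ complPairs R V k' where
  toFun p := ⟨p.1.swap, by
    have := p.2.2.1
    exact ⟨by show finrank R p.1.2 = k'; omega,
      by show k' + finrank R p.1.1 = _; rw [p.2.1]; omega, by
        rw [← p.2.2.2]; exact sup_comm _ _⟩⟩
  invFun p := ⟨p.1.swap, by
    have := p.2.2.1
    exact ⟨by show finrank R p.1.2 = k; omega,
      by show k + finrank R p.1.1 = _; rw [p.2.1]; omega, by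
        rw [← p.2.2.2]; exact sup_comm _ _⟩⟩
  left_inv _ := rfl
  right_inv _ := rfl

lemma isBaseSubset_swapPairs_image {k' : ℕ} (h : k + k' = finrank R V)
    (X : Set (complPairs R V k)) : IsBaseSubset (swapPairs h '' X) ↔ IsBaseSubset X := by
  have hb : ∀ b : Basis (Fin (finrank R V)) R V,
      swapPairs h '' baseSubset b k = baseSubset b k' := by
    intro b
    ext p
    constructor
    · rintro ⟨q, ⟨h1, h2⟩, rfl⟩
      exact ⟨h2, h1⟩
    · rintro ⟨h1, h2⟩
      exact ⟨(swapPairs h).symm p, ⟨h2, h1⟩, by simp⟩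
  constructor
  · rintro ⟨b, hX⟩
    exact ⟨b, (swapPairs h).injective.image_injective (hX.trans (hb b).symm)⟩
  · rintro ⟨b, rfl⟩
    exact ⟨b, hb b⟩

/-- The pairs `(S, U)` and `(U, S)` play symmetric roles in both conclusions. -/
lemma induced_of_swap {k' : ℕ} (h : k + k' = finrank R V)
    {f : complPairs R V k ≃ complPairs R V k}
    (hind : InducedBySemilinearAut (((swapPairs h).symm.trans f).trans (swapPairs h)) ∨
      InducedBySemilinearDual (((swapPairs h).symm.trans f).trans (swapPairs h))) :
    InducedBySemilinearAut f ∨ InducedBySemilinearDual f := by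
  rcases hind with ⟨σ, l, hl, hfl⟩ | ⟨σ, s, hs, hfs⟩
  · refine Or.inl ⟨σ, l, hl, fun p => ?_⟩
    exact congrArg Prod.swap (hfl (swapPairs h p))
  · refine Or.inr ⟨σ, s, hs, fun p => ?_⟩
    exact congrArg Prod.swap (hfs (swapPairs h p))

/-- If `k` is `0` or the full dimension, there is only one complementary pair. -/
lemma induced_of_subsingleton [FiniteDimensional R V] (hk : k = 0 ∨ k = finrank R V)
    (f : complPairs R V k ≃ complPairs R V k) : InducedBySemilinearAut f := by
  have key : ∀ p : complPairs R V k, p.1 = if k = 0 then (⊥, ⊤) else (⊤, ⊥) := by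
    intro p
    obtain ⟨h1, h2, -⟩ := p.2
    split_ifs with h0
    · refine Prod.ext (Submodule.finrank_eq_zero.1 (h1.trans h0))
        (Submodule.eq_top_of_finrank_eq ?_)
      omega
    · refine Prod.ext (Submodule.eq_top_of_finrank_eq (h1.trans (hk.resolve_left h0)))
        ((Submodule.finrank_eq_zero (R := R)).1 ?_)
      omega
  refine ⟨RingEquiv.refl R, LinearMap.id, Function.bijective_id, fun p => ?_⟩
  have e1 : (f p).1 = p.1 := (key (f p)).trans (key p).symm
  rw [e1]
  exact Prod.ext (Submodule.map_id _).symm (Submodule.map_id _).symm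

end Main

end LinearInvolutions

theorem theorem1 {R : Type*} {V : Type*} [DivisionRing R] [AddCommGroup V] [Module R V]
    [FiniteDimensional R V] (n k : ℕ) (hV : Module.finrank R V = n) (hn : 3 ≤ n)
    (hkn : k ≤ n) (hk : n ≠ 2 * k)
    (f : LinearInvolutions.complPairs R V k ≃ LinearInvolutions.complPairs R V k)
    (hf : ∀ X : Set (LinearInvolutions.complPairs R V k),
      LinearInvolutions.IsBaseSubset (f '' X) ↔ LinearInvolutions.IsBaseSubset X) :
    LinearInvolutions.InducedBySemilinearAut f ∨
      LinearInvolutions.InducedBySemilinearDual f := by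
  subst hV
  by_cases h0 : k = 0 ∨ k = Module.finrank R V
  · exact Or.inl (LinearInvolutions.induced_of_subsingleton h0 f)
  rw [not_or] at h0
  by_cases h2 : 2 * k < Module.finrank R V
  · exact LinearInvolutions.induced_of_two_mul_lt hn (by omega) h2 hf
  · have hsum : k + (Module.finrank R V - k) = Module.finrank R V := by omega
    refine LinearInvolutions.induced_of_swap hsum
      (LinearInvolutions.induced_of_two_mul_lt hn (by omega) (by omega) fun X => ?_)
    rw [Equiv.coe_trans, Set.image_comp, LinearInvolutions.isBaseSubset_swapPairs_image,
      Equiv.coe_trans, Set.image_comp, hf,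
      ← LinearInvolutions.isBaseSubset_swapPairs_image hsum, Equiv.image_symm_image]
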